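/- **Setting.** Let $\mathbb Z_0=\mathbb Z\setminus\{0\}$. For $s\in\mathbb R$ let $\dot H^s$ be the space of sequences $u=(u_k)_{k\in\mathbb Z_0}$ of complex numbers (Fourier coefficients of real-valued $2\pi$-periodic functions of mean zero) with $u_{-k}=\overline{u_k}$ and $\|u\|_{\dot H^s}^2=\sum_{k\in\mathbb Z_0}|k|^{2s}|u_k|^2<\infty$; $\|\cdot\|_{L_2}=\|\cdot\|_{\dot H^0}$. For $n\in\mathbb N$ let $\Pi_n$ be the projection onto the modes $|k|\le n$ and $\Pi_{-n}=I-\Pi_n$. All indices $k_j$ below lie in $\mathbb Z_0$. For $k\in\mathbb Z_0$ and a time $t$ put $$B_2(u,v)_k=\sum_{k_1+k_2=k}\frac{e^{3ikk_1k_2t}}{k_1k_2}u_{k_1}v_{k_2}.$$ In triple sums $k_1+k_2+k_3=k$ with $k_2+k_3\ne0$; write $\rho=(k_1+k_2)(k_2+k_3)(k_3+k_1)$; "res" means $\rho=0$ and "nonres" means $\rho\neq0$: $$R_{3\mathrm{res}}(v^3)_k=\sum^{\mathrm{res}}\frac{v_{k_1}v_{k_2}v_{k_3}}{k_1},\qquad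 R_{3\mathrm{nres}}(u,v,w)_k=\sum^{\mathrm{nonres}}\frac{e^{3i\rho t}}{k_1}u_{k_1}v_{k_2}w_{k_3},$$ $$R^{(n)}_{3\mathrm{nres}1}(v^3)=\sum_{\zeta}R_{3\mathrm{nres}}(\Pi_{\zeta_1n}v,\Pi_{\zeta_2n}v,\Pi_{\zeta_3n}v),\qquad B^{(n)}_{30}(v^3)_k=\sum^{\mathrm{nonres}}\frac{e^{3i\rho t}}{k_1\rho}v_{k_1}(\Pi_{-n}v)_{k_2}(\Pi_{-n}v)_{k_3},$$ where $\zeta$ runs over $\{-1,1\}^3\setminus\{(1,-1,-1),(-1,-1,-1)\}$. With $\Phi=k^3-k_1^3-k_2^3-k_3^3-k_4^3$ and $\sigma=(k_1+k_2)(k_1+k_3+k_4)(k_2+k_3+k_4)$ let $$B_{40}^{(n)}(v^4)_k=\frac12\sum\frac{e^{i\Phi t}}{\sigma}(\Pi_{-n}v)_{k_1}(\Pi_{-n}v)_{k_2}v_{k_3}v_{k_4}+\sum_{|k_3+k_4|>n}\frac{e^{i\Phi t}(k_3+k_4)}{k_1\sigma}v_{k_1}(\Pi_{-n}v)_{k_2}v_{k_3}v_{k_4},$$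 both sums over $k_1+k_2+k_3+k_4=k$ with $\sigma\ne0$ and $k_3+k_4\neq0$. The integrated *third form of the KdV equation* ($\partial_tu=u\partial_xu+\partial_x^3u$, $u_k(t)=e^{-ik^3t}v_k(t)$) is, for all $k\in\mathbb Z_0$, $$\Bigl(v_k-\tfrac16B_2(v^2)_k+\tfrac1{18}B^{(n)}_{30}(v^3)_k\Bigr)\Big|_0^t=-\frac i6\int_0^t\Bigl(R_{3\mathrm{res}}(v^3)_k+R^{(n)}_{3\mathrm{nres}1}(v^3)_k-\tfrac13B^{(n)}_{40}(v^4)_k\Bigr)(t')\,dt',\quad v(0)=v^0.\tag{1}$$ For $v=v^0+y$, $y(0)=0$, it reads, with $B_{2,t}$, $B^{(n)}_{30,t}$ denoting the operators at time $t$, $$y(t)-\tfrac13B_{2,t}(v^0,y(t))=\tfrac16B_{2,t}(y(t),y(t))+\tfrac16\bigl(B_{2,t}(v^0,v^0)-B_{2,0}(v^0,v^0)\bigr)-\tfrac1{18}\bigl(B^{(n)}_{30,t}((y(t)+v^0)^3)-B^{(n)}_{30,0}((v^0)^3)\bigr)-\frac i6\int_0^t\Bigl(R_{3\mathrm{res}}+R^{(n)}_{3\mathrm{nres}1}-\tfrac13B_{40}^{(n)}\Bigr)(y(t')+v^0)\,dt'.\tag{2}$$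 **Theorem.** There are functions $n_0:\mathbb R\to\mathbb N$ and $T^*:\mathbb R\to(0,\infty)$ such that the following holds for all $0\le s\le1/2$ and $v^0\in\dot H^s$, with $n_0=n_0(\|v^0\|_{L_2})$, $T^*=T^*(\|v^0\|_{L_2})$. For every $n\ge n_0$ equation (2) has a unique solution $y\in C_0([0,T^*];\dot H^s)=\{y\in C([0,T^*];\dot H^s):y(0)=0\}$, and $v=v^0+y$ is the unique solution of (1) in $C([0,T^*];\dot H^s)$. This solution extends to a solution $v\in C([0,T_{\max});\dot H^s)$ of (1) on a maximal interval $[0,T_{\max})$, $T^*<T_{\max}\le\infty$: every solution $w \in C([0,T);\dot H^s)$ of (1), $T>0$, has $T\le T_{\max}$ and coincides with $v$ on $[0,T)$. Either $T_{\max}=\infty$ or $\limsup_{t\to T_{\max}-0}\|v(t)\|_{\dot H^s}=\infty$. -/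

import Mathlib

open Set Filter Topology MeasureTheory

namespace KdV

/-! ### The homogeneous Sobolev spaces of real, mean-zero `2π`-periodic functions

A function is represented by its Fourier coefficients `u : ℤ → ℂ`. -/

/-- `‖u‖²_{Ḣ^s} = ∑_{k ≠ 0} |k|^{2s} |u_k|²`; meaningful under `MemHdot s u`. -/
noncomputable def hnorm (s : ℝ) (u : ℤ → ℂ) : ℝ :=
  Real.sqrt (∑' k : {k : ℤ // k ≠ 0}, |(k.1 : ℝ)| ^ (2 * s) * ‖u k.1‖ ^ 2)

/-- `u ∈ Ḣ^s`: mean value zero, real-valued, finite norm. -/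
def MemHdot (s : ℝ) (u : ℤ → ℂ) : Prop :=
  u 0 = 0 ∧ (∀ k, u (-k) = (starRingEnd ℂ) (u k)) ∧
    Summable fun k : {k : ℤ // k ≠ 0} => |(k.1 : ℝ)| ^ (2 * s) * ‖u k.1‖ ^ 2

/-- `v ∈ C(J; Ḣ^s)`: `v(t) ∈ Ḣ^s` for `t ∈ J`, and `v` is continuous on `J` in the norm. -/
def ContHdot (s : ℝ) (J : Set ℝ) (v : ℝ → ℤ → ℂ) : Prop :=
  (∀ t ∈ J, MemHdot s (v t)) ∧
    ∀ t₀ ∈ J, Tendsto (fun t => hnorm s (v t - v t₀)) (𝓝[J] t₀) (𝓝 0)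

/-! ### Index sets, phases and projections -/

/-- `k₁ + k₂ = k` with `k₁, k₂ ≠ 0`. -/
def pairs (k : ℤ) : Set (ℤ × ℤ) :=
  {p | p.1 ≠ 0 ∧ p.2 ≠ 0 ∧ p.1 + p.2 = k}

/-- The triples `k₁ + k₂ + k₃ = k` over which the cubic term runs. It arises from
`∑_{j + k₁ = k}` by inserting, for the index `j ≠ 0`, a sum over `k₂ + k₃ = j`; hence
`k₂ + k₃ ≠ 0` besides `k₁, k₂, k₃ ≠ 0`. -/
def triples (k : ℤ) : Set (ℤ × ℤ × ℤ) :=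
  {p | p.1 ≠ 0 ∧ p.2.1 ≠ 0 ∧ p.2.2 ≠ 0 ∧ p.2.1 + p.2.2 ≠ 0 ∧ p.1 + p.2.1 + p.2.2 = k}

/-- `(k₁ + k₂)(k₂ + k₃)(k₃ + k₁)`. -/
def res3 (p : ℤ × ℤ × ℤ) : ℤ :=
  (p.1 + p.2.1) * (p.2.1 + p.2.2) * (p.2.2 + p.1)

/-- Resonant triples. -/
def resTriples (k : ℤ) : Set (ℤ × ℤ × ℤ) := {p ∈ triples k | res3 p = 0}

/-- Non-resonant triples. -/
def nonresTriples (k : ℤ) : Set (ℤ × ℤ × ℤ) := {p ∈ triples k | res3 p ≠ 0}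

/-- Non-resonant quadruples `k₁ + k₂ + k₃ + k₄ = k`. They arise from non-resonant triples by
inserting a sum over `k₃ + k₄ = j` for one index `j ≠ 0` of the triple; hence
`k₃ + k₄ ≠ 0` besides `k₁, k₂, k₃, k₄ ≠ 0` and the three factors in the denominators. -/
def nonresQuads (k : ℤ) : Set (ℤ × ℤ × ℤ × ℤ) :=
  {p | p.1 ≠ 0 ∧ p.2.1 ≠ 0 ∧ p.2.2.1 ≠ 0 ∧ p.2.2.2 ≠ 0 ∧ p.2.2.1 + p.2.2.2 ≠ 0 ∧
    p.1 + p.2.1 + p.2.2.1 + p.2.2.2 = k ∧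
    p.1 + p.2.1 ≠ 0 ∧ p.1 + p.2.2.1 + p.2.2.2 ≠ 0 ∧ p.2.1 + p.2.2.1 + p.2.2.2 ≠ 0}

/-- `e^{i m t}`. -/
noncomputable def osc (m : ℤ) (t : ℝ) : ℂ := Complex.exp (Complex.I * (m : ℂ) * (t : ℂ))

/-- `Φ(k₁,…,k₄) = (k₁+k₂+k₃+k₄)³ - k₁³ - k₂³ - k₃³ - k₄³`. -/
def phase4 (k₁ k₂ k₃ k₄ : ℤ) : ℤ :=
  (k₁ + k₂ + k₃ + k₄) ^ 3 - k₁ ^ 3 - k₂ ^ 3 - k₃ ^ 3 - k₄ ^ 3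

/-- `Π_n`: projection on the modes `|k| ≤ n`. -/
def projLow (n : ℕ) (u : ℤ → ℂ) : ℤ → ℂ := fun k => if |k| ≤ (n : ℤ) then u k else 0

/-- `Π_{-n} = I - Π_n`. -/
def projHigh (n : ℕ) (u : ℤ → ℂ) : ℤ → ℂ := u - projLow n u

/-- `Π_{ζn}` for the sign `ζ = +1` (`true`) or `ζ = -1` (`false`). -/
def projSign (n : ℕ) (ζ : Bool) : (ℤ → ℂ) → ℤ → ℂ := if ζ then projLow n else projHigh n

/-! ### The multilinear operators

For arguments in `Ḣ^0` all the series below converge absolutely. -/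

/-- `B₂(u,v,t)_k`. -/
noncomputable def B2 (t : ℝ) (u v : ℤ → ℂ) (k : ℤ) : ℂ :=
  ∑' p : pairs k, osc (3 * k * p.1.1 * p.1.2) t * u p.1.1 * v p.1.2 /
    ((p.1.1 : ℂ) * (p.1.2 : ℂ))

/-- The resonant part of the cubic term. -/
noncomputable def R3res (u v w : ℤ → ℂ) (k : ℤ) : ℂ :=
  ∑' p : resTriples k, u p.1.1 * v p.1.2.1 * w p.1.2.2 / (p.1.1 : ℂ)

/-- The non-resonant part of the cubic term. -/
noncomputable def R3nres (t : ℝ) (u v w : ℤ → ℂ) (k : ℤ) : ℂ :=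
  ∑' p : nonresTriples k, osc (3 * res3 p.1) t / (p.1.1 : ℂ) *
    (u p.1.1 * v p.1.2.1 * w p.1.2.2)

/-- The sum of `R_{3nres}(Π_{ζ₁n}u, Π_{ζ₂n}v, Π_{ζ₃n}w)` over the six sign triples other than
`(+1,-1,-1)` and `(-1,-1,-1)`. -/
noncomputable def R3nres1 (n : ℕ) (t : ℝ) (u v w : ℤ → ℂ) (k : ℤ) : ℂ :=
  ∑ ζ ∈ (Finset.univ : Finset (Bool × Bool × Bool)).filter (fun ζ => ζ.2 ≠ (false, false)),
    R3nres t (projSign n ζ.1 u) (projSign n ζ.2.1 v) (projSign n ζ.2.2 w) k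

/-- `B_{30}^{(n)}(u,v,w)_k`. -/
noncomputable def B30 (n : ℕ) (t : ℝ) (u v w : ℤ → ℂ) (k : ℤ) : ℂ :=
  ∑' p : nonresTriples k, osc (3 * res3 p.1) t / ((p.1.1 : ℂ) * (res3 p.1 : ℂ)) *
    (u p.1.1 * projHigh n v p.1.2.1 * projHigh n w p.1.2.2)

/-- `B_{40}^{1(n)}(u,v,w,φ)_k`. -/
noncomputable def B401 (n : ℕ) (t : ℝ) (u v w φ : ℤ → ℂ) (k : ℤ) : ℂ :=
  ∑' p : nonresQuads k,
    osc (phase4 p.1.1 p.1.2.1 p.1.2.2.1 p.1.2.2.2) t /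
      (((p.1.1 + p.1.2.1) * (p.1.1 + p.1.2.2.1 + p.1.2.2.2) *
        (p.1.2.1 + p.1.2.2.1 + p.1.2.2.2) : ℤ) : ℂ) *
      (projHigh n u p.1.1 * projHigh n v p.1.2.1 * w p.1.2.2.1 * φ p.1.2.2.2)

/-- `B_{40}^{2(n)}(u,v,w,φ)_k`; here `Π_{-n}(w_{k₃}φ_{k₄})` is `w_{k₃}φ_{k₄}` if
`|k₃ + k₄| > n` and `0` otherwise. -/
noncomputable def B402 (n : ℕ) (t : ℝ) (u v w φ : ℤ → ℂ) (k : ℤ) : ℂ :=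
  ∑' p : nonresQuads k,
    osc (phase4 p.1.1 p.1.2.1 p.1.2.2.1 p.1.2.2.2) t *
      ((p.1.2.2.1 + p.1.2.2.2 : ℤ) : ℂ) /
      ((p.1.1 * (p.1.1 + p.1.2.1) * (p.1.1 + p.1.2.2.1 + p.1.2.2.2) *
        (p.1.2.1 + p.1.2.2.1 + p.1.2.2.2) : ℤ) : ℂ) *
      (u p.1.1 * projHigh n v p.1.2.1 *
        (if (n : ℤ) < |p.1.2.2.1 + p.1.2.2.2| then w p.1.2.2.1 * φ p.1.2.2.2 else 0))

/-- `B_{40}^{(n)}(v⁴)_k = ½ B_{40}^{1}(v⁴)_k + B_{40}^{2}(v⁴)_k`. -/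
noncomputable def B40 (n : ℕ) (t : ℝ) (v : ℤ → ℂ) (k : ℤ) : ℂ :=
  1 / 2 * B401 n t v v v v k + B402 n t v v v v k

/-! ### The third form of the periodic KdV equation

With the Fourier coefficients `u_k(t) = e^{-i k³ t} v_k(t)`, the equation
`∂_t u = u ∂_x u + ∂_x³ u` reads
`∂_t v_k = (i k / 2) ∑_{k₁+k₂=k} e^{3 i k k₁ k₂ t} v_{k₁} v_{k₂}`. Two differentiations by parts
in time, the second one applied to the part of the non-resonant cubic term in which `k₂` and
`k₃` are high modes, give
`∂_t (v - (1/6) B₂ + (1/18) B₃₀) = -(i/6) (R_{3res} + R_{3nres1} - (1/3) B₄₀)`. -/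

/-- `(R_{3res}(v³) + R_{3nres1}^{(n)}(v³) - ⅓ B_{40}^{(n)}(v⁴))_k` at time `t`. -/
noncomputable def rhs (n : ℕ) (t : ℝ) (v : ℤ → ℂ) (k : ℤ) : ℂ :=
  R3res v v v k + R3nres1 n t v v v k - 1 / 3 * B40 n t v k

/-- `(v - (1/6) B₂(v²) + (1/18) B_{30}^{(n)}(v³))_k` at time `t`. -/
noncomputable def lhs (n : ℕ) (t : ℝ) (v : ℤ → ℂ) (k : ℤ) : ℂ :=
  v k - 1 / 6 * B2 t v v k + 1 / 18 * B30 n t v v v k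

/-- `v ∈ C(J; Ḣ^s)` solves the integrated third form of the KdV equation on the interval `J`
(with left end point `0 ∈ J`), with `v(0) = v⁰`. -/
def SolvesThird (s : ℝ) (n : ℕ) (v₀ : ℤ → ℂ) (J : Set ℝ) (v : ℝ → ℤ → ℂ) : Prop :=
  ContHdot s J v ∧ v 0 = v₀ ∧
    ∀ t ∈ J, ∀ k : ℤ, k ≠ 0 →
      IntervalIntegrable (fun τ => rhs n τ (v τ) k) volume 0 t ∧
      lhs n t (v t) k - lhs n 0 (v 0) k = -(Complex.I / 6) * ∫ τ in (0 : ℝ)..t, rhs n τ (v τ) k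

/-- `y ∈ C₀(J; Ḣ^s)` solves on `J` the equation for `y(t) = v(t) - v⁰` with the linear part
`y - (1/3) B₂(v⁰, y)` on the left-hand side. -/
def SolvesPerturbation (s : ℝ) (n : ℕ) (v₀ : ℤ → ℂ) (J : Set ℝ) (y : ℝ → ℤ → ℂ) : Prop :=
  ContHdot s J y ∧ y 0 = 0 ∧
    ∀ t ∈ J, ∀ k : ℤ, k ≠ 0 →
      IntervalIntegrable (fun τ => rhs n τ (y τ + v₀) k) volume 0 t ∧
      y t k - 1 / 3 * B2 t v₀ (y t) k =
        1 / 6 * B2 t (y t) (y t) k + 1 / 6 * (B2 t v₀ v₀ k - B2 0 v₀ v₀ k)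
          - 1 / 18 * (B30 n t (y t + v₀) (y t + v₀) (y t + v₀) k - B30 n 0 v₀ v₀ v₀ k)
          - Complex.I / 6 * ∫ τ in (0 : ℝ)..t, rhs n τ (y τ + v₀) k

end KdV

/-! Solutions turn out to be global, so `Tstar = 1` and `Tmax = ⊤` serve, and the blow-up
alternative holds trivially. Two facts carry the theorem: a global solution exists whose L₂ norm
never exceeds its initial value (`exists_global_solution`), and for n large in terms of an L₂ bound
for one solution there is no second one (`exists_uniqueness_threshold`).

All operators are treated alike. If the vanishing zero mode of u is replaced by 1 (`withUnit`),
forms of degree two and three become quadrilinear, and Cauchy–Schwarz on the kernels gives every ℓ²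
bound. Three properties matter: the forms on the right are bounded on ℓ² for each n (`coRhs_bound`);
the forms added to v on the left gain a full derivative (`coLhs_smoothing`); and B₃₀ has norm O(1/n)
(`coB30_bound`).

Existence. The Galerkin system conserves the L₂ norm, and both differentiations by parts remain
exact for it, with the cutoff appearing as a multiplier on inner frequencies (`hasDerivAt_third`).
Gronwall's inequality for v plus the smoothing terms then bounds weighted norms independently of the
truncation. With the weight |k|^s min(1, |k|/M), whose linear slope M^(s-1) tends to 0 when s < 1,
this makes the high-frequency tails uniformly small (`GalerkinLimit.tight`). Modewise convergence of
a subsequence thereby becomes ℓ² convergence, and the integrated third form passes to the limit for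
all n at once.

Uniqueness. If two solutions agree at t₀, their difference d satisfies d - (1/3) B₂(v(t₀), d) =
remainder. The operator on the left is bounded below uniformly in time and on balls
(`exists_lower_bound`). Conjugation by the free evolution reduces this to time 0; there injectivity
is a periodic linear first-order ODE solved by an integrating factor, and compactness of B₂ gives
the quantitative bound. The remainder consists of a term quadratic in d, a term with the small
increment of v since t₀, the O(1/n) contribution of B₃₀, and a short time integral. So d vanishes
just after t₀. The required n does not change with t₀, because the L₂ norm of the constructed
solution does not grow. -/

namespace KdV

open scoped ENNReal NNReal

/-! ### The `ℓ²` norm with values in `[0, ∞]` -/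

/-- The `ℓ²(ℤ)` norm as an extended nonnegative real. -/
noncomputable def l2 {ε : Type*} [ENorm ε] (u : ℤ → ε) : ℝ≥0∞ := eLpNorm u 2 Measure.count

theorem l2_sq {ε : Type*} [ENorm ε] (u : ℤ → ε) : l2 u ^ 2 = ∑' k, ‖u k‖ₑ ^ 2 := by
  unfold l2
  rw [eLpNorm_eq_lintegral_rpow_enorm_toReal (by norm_num) (by norm_num), lintegral_count,
    ← ENNReal.rpow_natCast, ← ENNReal.rpow_mul]
  norm_num

theorem l2_mono {ε ε' : Type*} [ENorm ε] [ENorm ε'] {u : ℤ → ε} {v : ℤ → ε'}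
    (h : ∀ k, ‖u k‖ₑ ≤ ‖v k‖ₑ) : l2 u ≤ l2 v := eLpNorm_mono_enorm h

theorem l2_congr {ε ε' : Type*} [ENorm ε] [ENorm ε'] {u : ℤ → ε} {v : ℤ → ε'}
    (h : ∀ k, ‖u k‖ₑ = ‖v k‖ₑ) : l2 u = l2 v :=
  le_antisymm (l2_mono fun k => (h k).le) (l2_mono fun k => (h k).ge)

theorem l2_enorm {ε : Type*} [ENorm ε] (u : ℤ → ε) : l2 (fun k => ‖u k‖ₑ) = l2 u :=
  eLpNorm_enorm u

theorem l2_add_le {ε : Type*} [TopologicalSpace ε] [ESeminormedAddMonoid ε]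
    [SecondCountableTopologyEither ℤ ε] [TopologicalSpace.PseudoMetrizableSpace ε]
    (u v : ℤ → ε) : l2 (fun k => u k + v k) ≤ l2 u + l2 v :=
  eLpNorm_add_le (f := u) (g := v) (StronglyMeasurable.of_discrete.aestronglyMeasurable)
    (StronglyMeasurable.of_discrete.aestronglyMeasurable) (by norm_num)

theorem l2_add_le_ennreal (u v : ℤ → ℝ≥0∞) : l2 (fun k => u k + v k) ≤ l2 u + l2 v :=
  l2_add_le u v

theorem l2_sub_le (u v : ℤ → ℂ) : l2 (fun k => u k - v k) ≤ l2 u + l2 v :=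
  eLpNorm_sub_le (f := u) (g := v) (StronglyMeasurable.of_discrete.aestronglyMeasurable)
    (StronglyMeasurable.of_discrete.aestronglyMeasurable) (by norm_num)

theorem enorm_le_l2 {ε : Type*} [ENorm ε] (u : ℤ → ε) (k : ℤ) : ‖u k‖ₑ ≤ l2 u := by
  rw [← ENNReal.pow_le_pow_left_iff (n := 2) (by norm_num), l2_sq]
  exact ENNReal.le_tsum (f := fun k => ‖u k‖ₑ ^ 2) k

theorem l2_const_mul (c : ℂ) (u : ℤ → ℂ) : l2 (fun k => c * u k) = ‖c‖ₑ * l2 u :=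
  eLpNorm_const_smul c u 2 _

theorem l2_const_mul_ennreal (c : ℝ≥0∞) (u : ℤ → ℝ≥0∞) :
    l2 (fun k => c * u k) = c * l2 u := by
  refine (ENNReal.pow_right_strictMono (n := 2) (by norm_num)).injective ?_
  simp only [mul_pow, l2_sq, enorm_eq_self, ENNReal.tsum_mul_left]

theorem l2_le_of_sq_le {ε : Type*} [ENorm ε] {u : ℤ → ε} {C : ℝ≥0∞}
    (h : ∑' k, ‖u k‖ₑ ^ 2 ≤ C ^ 2) : l2 u ≤ C := by
  rwa [← l2_sq, ENNReal.pow_le_pow_left_iff (by norm_num)] at h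

theorem l2_zero_iff {u : ℤ → ℂ} : l2 u = 0 ↔ u = 0 := by
  constructor
  · intro h
    ext k
    have := enorm_le_l2 u k
    rw [h] at this
    simpa using this
  · rintro rfl
    exact eLpNorm_zero

/-- Fatou's lemma for counting measure: each finite partial sum passes to the limit, so a modewise
limit inherits an ℓ² bound. -/
theorem l2_le_of_tendsto {ι : Type*} {F : Filter ι} [F.NeBot] {f : ι → ℤ → ℂ} {g : ℤ → ℂ}
    {C : ℝ≥0∞} (hf : ∀ᶠ i in F, l2 (f i) ≤ C) (h : ∀ k, Tendsto (fun i => f i k) F (𝓝 (g k))) :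
    l2 g ≤ C := by
  apply l2_le_of_sq_le
  rw [ENNReal.tsum_eq_iSup_sum]
  refine iSup_le fun s => ?_
  have h1 : Tendsto (fun i => ∑ k ∈ s, ‖f i k‖ₑ ^ 2) F (𝓝 (∑ k ∈ s, ‖g k‖ₑ ^ 2)) :=
    tendsto_finsetSum _ fun k _ => ((ENNReal.continuous_pow 2).tendsto _).comp
      ((continuous_enorm.tendsto _).comp (h k))
  refine le_of_tendsto h1 ?_
  filter_upwards [hf] with i hi
  calc _ ≤ ∑' k, ‖f i k‖ₑ ^ 2 := ENNReal.sum_le_tsum s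
    _ = l2 (f i) ^ 2 := (l2_sq _).symm
    _ ≤ C ^ 2 := by gcongr

theorem tsum_mul_sq_le {ι : Type*} (f g : ι → ℝ≥0∞) :
    (∑' i, f i * g i) ^ 2 ≤ (∑' i, f i ^ 2) * ∑' i, g i ^ 2 := by
  let _ : MeasurableSpace ι := ⊤
  have h := ENNReal.lintegral_mul_le_Lp_mul_Lq (Measure.count : Measure ι)
    (Real.HolderConjugate.two_two) (f := f) (g := g) (by fun_prop) (by fun_prop)
  simp only [lintegral_count, Pi.mul_apply] at h
  calc _ ≤ ((∑' i, f i ^ (2 : ℝ)) ^ (1 / 2 : ℝ) * (∑' i, g i ^ (2 : ℝ)) ^ (1 / 2 : ℝ)) ^ 2 := by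
        gcongr
    _ = _ := by
      rw [mul_pow, ← ENNReal.rpow_natCast, ← ENNReal.rpow_natCast, ← ENNReal.rpow_mul,
        ← ENNReal.rpow_mul]
      norm_num

/-! ### Quadrilinear forms with nonnegative kernels -/

/-- The quadrilinear form with nonnegative kernel `K`: the sum of
`K k₁ k₂ k₃ k₄ a_{k₁} b_{k₂} c_{k₃} d_{k₄}` over `k₁ + k₂ + k₃ + k₄ = k`. -/
noncomputable def posForm (K : ℤ → ℤ → ℤ → ℤ → ℝ≥0∞) (a b c d : ℤ → ℝ≥0∞) (k : ℤ) : ℝ≥0∞ :=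
  ∑' q : ℤ × ℤ × ℤ, K q.1 q.2.1 q.2.2 (k - q.1 - q.2.1 - q.2.2) *
    (a q.1 * b q.2.1 * c q.2.2 * d (k - q.1 - q.2.1 - q.2.2))

/-- The form with kernel `K` maps `ℓ² × ℓ² × ℓ² × ℓ²` to `ℓ²` with norm at most `C`. -/
def KernelBound (K : ℤ → ℤ → ℤ → ℤ → ℝ≥0∞) (C : ℝ≥0∞) : Prop :=
  ∀ a b c d : ℤ → ℝ≥0∞, l2 (posForm K a b c d) ≤ C * (l2 a * l2 b * l2 c * l2 d)

theorem tsum_shift (d : ℤ → ℝ≥0∞) (m : ℤ) : ∑' w, d (m - w) = ∑' w, d w :=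
  (Equiv.subLeft m).tsum_eq d

/-- For fixed k₁, k₂, k₃ the fourth index runs through ℤ together with the output k, so summing over
all outputs removes the constraint. -/
theorem tsum_total (F : ℤ → ℤ → ℤ → ℤ → ℝ≥0∞) :
    ∑' k, ∑' q : ℤ × ℤ × ℤ, F q.1 q.2.1 q.2.2 (k - q.1 - q.2.1 - q.2.2) =
      ∑' q : ℤ × ℤ × ℤ, ∑' w, F q.1 q.2.1 q.2.2 w := by
  rw [ENNReal.tsum_comm]
  refine tsum_congr fun q => ?_
  rw [← (Equiv.subRight (q.1 + q.2.1 + q.2.2)).tsum_eq (F q.1 q.2.1 q.2.2)]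
  simp [sub_sub]

theorem tsum_prod3 (F : ℤ → ℤ → ℤ → ℝ≥0∞) :
    ∑' q : ℤ × ℤ × ℤ, F q.1 q.2.1 q.2.2 = ∑' x, ∑' y, ∑' z, F x y z := by
  rw [ENNReal.tsum_prod (f := fun x (q : ℤ × ℤ) => F x q.1 q.2)]
  refine tsum_congr fun x => ?_
  rw [ENNReal.tsum_prod (f := fun y z => F x y z)]

/-- Cauchy–Schwarz at a fixed output, with the kernel on one side and the product of the four
sequences on the other. Summing over outputs frees the fourth index and the squared product
factorises. -/
theorem KernelBound.of_output {K : ℤ → ℤ → ℤ → ℤ → ℝ≥0∞} {C : ℝ≥0∞}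
    (h : ∀ k, ∑' q : ℤ × ℤ × ℤ, K q.1 q.2.1 q.2.2 (k - q.1 - q.2.1 - q.2.2) ^ 2 ≤ C ^ 2) :
    KernelBound K C := by
  intro a b c d
  apply l2_le_of_sq_le
  simp only [enorm_eq_self]
  calc ∑' k, posForm K a b c d k ^ 2
      ≤ ∑' k, C ^ 2 * ∑' q : ℤ × ℤ × ℤ, (fun x y z w => (a x * b y * c z * d w) ^ 2)
          q.1 q.2.1 q.2.2 (k - q.1 - q.2.1 - q.2.2) := by
        refine ENNReal.tsum_le_tsum fun k => (tsum_mul_sq_le _ _).trans ?_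
        gcongr
        exact h k
    _ = _ := by
        rw [ENNReal.tsum_mul_left, tsum_total (fun x y z w => (a x * b y * c z * d w) ^ 2),
          tsum_prod3 (fun x y z => ∑' w, (a x * b y * c z * d w) ^ 2)]
        simp only [mul_pow, ENNReal.tsum_mul_left, ENNReal.tsum_mul_right, l2_sq, enorm_eq_self]

/-- Cauchy–Schwarz with `K * c` against `a * b * d`. At a fixed output the third index merely shifts
`d`, so the second square sum factorises; the first, summed over outputs, is controlled by freezing
the third index. This covers kernels, such as those of B₄₀, that are not square-summable at a fixed
output. -/
theorem KernelBound.of_third {K : ℤ → ℤ → ℤ → ℤ → ℝ≥0∞} {C : ℝ≥0∞}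
    (h : ∀ z, ∑' q : ℤ × ℤ × ℤ, K q.1 q.2.1 z q.2.2 ^ 2 ≤ C ^ 2) :
    KernelBound K C := by
  intro a b c d
  apply l2_le_of_sq_le
  simp only [enorm_eq_self]
  have h1 : ∀ k, ∑' q : ℤ × ℤ × ℤ, (a q.1 * b q.2.1 * d (k - q.1 - q.2.1 - q.2.2)) ^ 2 =
      l2 a ^ 2 * l2 b ^ 2 * l2 d ^ 2 := by
    intro k
    rw [tsum_prod3 (fun x y z => (a x * b y * d (k - x - y - z)) ^ 2)]
    simp only [mul_pow, ENNReal.tsum_mul_left, ENNReal.tsum_mul_right, l2_sq, enorm_eq_self,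
      tsum_shift (fun w => d w ^ 2)]
  calc ∑' k, posForm K a b c d k ^ 2
      ≤ ∑' k, (∑' q : ℤ × ℤ × ℤ, (fun x y z w => (K x y z w * c z) ^ 2)
          q.1 q.2.1 q.2.2 (k - q.1 - q.2.1 - q.2.2)) * (l2 a ^ 2 * l2 b ^ 2 * l2 d ^ 2) := by
        refine ENNReal.tsum_le_tsum fun k => ?_
        rw [← h1 k]
        refine le_trans (le_of_eq ?_) (tsum_mul_sq_le _ _)
        unfold posForm
        congr 1
        refine tsum_congr fun q => ?_
        ring
    _ ≤ (C ^ 2 * l2 c ^ 2) * (l2 a ^ 2 * l2 b ^ 2 * l2 d ^ 2) := by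
        rw [ENNReal.tsum_mul_right, tsum_total (fun x y z w => (K x y z w * c z) ^ 2)]
        gcongr
        rw [tsum_prod3 (fun x y z => ∑' w, (K x y z w * c z) ^ 2)]
        simp only [mul_pow, ENNReal.tsum_mul_right]
        rw [l2_sq, ← ENNReal.tsum_mul_left]
        have h2 : ∀ x, ∑' y, ∑' z, (∑' w, K x y z w ^ 2) * c z ^ 2 =
            ∑' z, ∑' y, (∑' w, K x y z w ^ 2) * c z ^ 2 := fun x => ENNReal.tsum_comm
        simp only [h2]
        rw [ENNReal.tsum_comm]
        refine ENNReal.tsum_le_tsum fun z => ?_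
        simp only [ENNReal.tsum_mul_right, enorm_eq_self]
        gcongr
        rw [← tsum_prod3 (fun x y w => K x y z w ^ 2)]
        exact h z
    _ = _ := by ring

theorem KernelBound.mono {K L : ℤ → ℤ → ℤ → ℤ → ℝ≥0∞} {C : ℝ≥0∞} (hL : KernelBound L C)
    (h : ∀ x y z w, K x y z w ≤ L x y z w) : KernelBound K C := by
  intro a b c d
  refine le_trans (l2_mono fun k => ?_) (hL a b c d)
  simp only [enorm_eq_self]
  exact ENNReal.tsum_le_tsum fun q => by gcongr; apply h

theorem KernelBound.add {K L : ℤ → ℤ → ℤ → ℤ → ℝ≥0∞} {C D : ℝ≥0∞} (hK : KernelBound K C)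
    (hL : KernelBound L D) : KernelBound (fun x y z w => K x y z w + L x y z w) (C + D) := by
  intro a b c d
  rw [add_mul]
  refine le_trans ?_ ((l2_add_le_ennreal _ _).trans (add_le_add (hK a b c d) (hL a b c d)))
  refine l2_mono fun k => ?_
  simp only [enorm_eq_self, posForm]
  rw [← ENNReal.tsum_add]
  exact (tsum_congr fun q => by ring).le

theorem KernelBound.const_mul {K : ℤ → ℤ → ℤ → ℤ → ℝ≥0∞} {C : ℝ≥0∞} (hK : KernelBound K C)
    (e : ℝ≥0∞) : KernelBound (fun x y z w => e * K x y z w) (e * C) := by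
  intro a b c d
  rw [mul_assoc]
  refine le_trans (le_of_eq ?_) (mul_le_mul_right (hK a b c d) e)
  rw [← l2_const_mul_ennreal]
  congr 1
  ext k
  simp only [posForm]
  rw [← ENNReal.tsum_mul_left]
  exact tsum_congr fun q => by ring

section Forms

/-! ### Quadrilinear forms with complex coefficients -/

/-- The quadrilinear form with coefficients `c`: the sum of
`c k₁ k₂ k₃ k₄ (u₁)_{k₁} (u₂)_{k₂} (u₃)_{k₃} (u₄)_{k₄}` over `k₁ + k₂ + k₃ + k₄ = k`. -/
noncomputable def quadForm (c : ℤ → ℤ → ℤ → ℤ → ℂ) (u₁ u₂ u₃ u₄ : ℤ → ℂ) (k : ℤ) : ℂ :=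
  ∑' q : ℤ × ℤ × ℤ, c q.1 q.2.1 q.2.2 (k - q.1 - q.2.1 - q.2.2) *
    (u₁ q.1 * u₂ q.2.1 * u₃ q.2.2 * u₄ (k - q.1 - q.2.1 - q.2.2))

/-- The form with coefficients `|c|` is bounded on `ℓ²` with norm at most `C`. -/
def CoeffBound (c : ℤ → ℤ → ℤ → ℤ → ℂ) (C : ℝ≥0∞) : Prop :=
  KernelBound (fun x y z w => ‖c x y z w‖ₑ) C

variable {c c' : ℤ → ℤ → ℤ → ℤ → ℂ} {C C' : ℝ≥0∞}

theorem CoeffBound.mono (h : CoeffBound c C)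
    (hc : ∀ x y z w, ‖c' x y z w‖ ≤ ‖c x y z w‖) : CoeffBound c' C :=
  KernelBound.mono h fun x y z w => enorm_le_iff_norm_le.2 (hc x y z w)

theorem CoeffBound.add (h : CoeffBound c C) (h' : CoeffBound c' C') :
    CoeffBound (fun x y z w => c x y z w + c' x y z w) (C + C') :=
  (KernelBound.add h h').mono fun _ _ _ _ => enorm_add_le _ _

theorem CoeffBound.const_mul (h : CoeffBound c C) (e : ℂ) :
    CoeffBound (fun x y z w => e * c x y z w) (‖e‖ₑ * C) :=
  (KernelBound.const_mul h ‖e‖ₑ).mono fun _ _ _ _ => (enorm_mul _ _).le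

theorem enorm_quadForm_le (c : ℤ → ℤ → ℤ → ℤ → ℂ) (u₁ u₂ u₃ u₄ : ℤ → ℂ) (k : ℤ) :
    ‖quadForm c u₁ u₂ u₃ u₄ k‖ₑ ≤ posForm (fun x y z w => ‖c x y z w‖ₑ) (fun k => ‖u₁ k‖ₑ)
      (fun k => ‖u₂ k‖ₑ) (fun k => ‖u₃ k‖ₑ) (fun k => ‖u₄ k‖ₑ) k := by
  refine enorm_tsum_le_tsum_enorm.trans (le_of_eq ?_)
  simp only [enorm_mul, posForm]

theorem CoeffBound.l2_quadForm_le (h : CoeffBound c C) (u₁ u₂ u₃ u₄ : ℤ → ℂ) :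
    l2 (quadForm c u₁ u₂ u₃ u₄) ≤ C * (l2 u₁ * l2 u₂ * l2 u₃ * l2 u₄) := by
  refine (l2_mono fun k => ?_).trans ((h (fun k => ‖u₁ k‖ₑ)
      (fun k => ‖u₂ k‖ₑ) (fun k => ‖u₃ k‖ₑ) (fun k => ‖u₄ k‖ₑ)).trans (by simp only [l2_enorm, le_refl]))
  simpa using enorm_quadForm_le c u₁ u₂ u₃ u₄ k

theorem CoeffBound.summable (h : CoeffBound c C) (hC : C ≠ ⊤) {u₁ u₂ u₃ u₄ : ℤ → ℂ}
    (h₁ : l2 u₁ ≠ ⊤) (h₂ : l2 u₂ ≠ ⊤) (h₃ : l2 u₃ ≠ ⊤) (h₄ : l2 u₄ ≠ ⊤) (k : ℤ) :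
    Summable fun q : ℤ × ℤ × ℤ => c q.1 q.2.1 q.2.2 (k - q.1 - q.2.1 - q.2.2) *
      (u₁ q.1 * u₂ q.2.1 * u₃ q.2.2 * u₄ (k - q.1 - q.2.1 - q.2.2)) := by
  apply Summable.of_enorm
  have h5 : posForm (fun x y z w => ‖c x y z w‖ₑ) (fun k => ‖u₁ k‖ₑ)
      (fun k => ‖u₂ k‖ₑ) (fun k => ‖u₃ k‖ₑ) (fun k => ‖u₄ k‖ₑ) k ≤ _ :=
    (enorm_le_l2 (ε := ℝ≥0∞) _ k).trans (h _ _ _ _)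
  simp only [l2_enorm] at h5
  have h6 : C * (l2 u₁ * l2 u₂ * l2 u₃ * l2 u₄) ≠ ⊤ := by finiteness
  simpa only [enorm_mul, posForm] using ne_top_of_le_ne_top h6 h5

theorem CoeffBound.quadForm_add_coeff (h : CoeffBound c C) (hC : C ≠ ⊤) (h' : CoeffBound c' C')
    (hC' : C' ≠ ⊤) {u₁ u₂ u₃ u₄ : ℤ → ℂ}
    (h₁ : l2 u₁ ≠ ⊤) (h₂ : l2 u₂ ≠ ⊤) (h₃ : l2 u₃ ≠ ⊤) (h₄ : l2 u₄ ≠ ⊤) (k : ℤ) :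
    quadForm (fun x y z w => c x y z w + c' x y z w) u₁ u₂ u₃ u₄ k =
      quadForm c u₁ u₂ u₃ u₄ k + quadForm c' u₁ u₂ u₃ u₄ k := by
  unfold quadForm
  rw [← (h.summable hC h₁ h₂ h₃ h₄ k).tsum_add (h'.summable hC' h₁ h₂ h₃ h₄ k)]
  simp only [add_mul]

theorem quadForm_const_mul_coeff (e : ℂ) (c : ℤ → ℤ → ℤ → ℤ → ℂ) (u₁ u₂ u₃ u₄ : ℤ → ℂ) (k : ℤ) :
    quadForm (fun x y z w => e * c x y z w) u₁ u₂ u₃ u₄ k = e * quadForm c u₁ u₂ u₃ u₄ k := by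
  unfold quadForm
  rw [← tsum_mul_left]
  simp only [mul_assoc]

theorem l2_sub_ne_top {u v : ℤ → ℂ} (hu : l2 u ≠ ⊤) (hv : l2 v ≠ ⊤) :
    l2 (fun k => u k - v k) ≠ ⊤ :=
  ne_top_of_le_ne_top (by finiteness) (l2_sub_le u v)

theorem CoeffBound.quadForm_sub (h : CoeffBound c C) (hC : C ≠ ⊤) {u v : ℤ → ℂ}
    (hu : l2 u ≠ ⊤) (hv : l2 v ≠ ⊤) (k : ℤ) :
    quadForm c u u u u k - quadForm c v v v v k =
      quadForm c (fun k => u k - v k) u u u k + quadForm c v (fun k => u k - v k) u u k +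
      quadForm c v v (fun k => u k - v k) u k + quadForm c v v v (fun k => u k - v k) k := by
  have hd := l2_sub_ne_top hu hv
  unfold quadForm
  rw [← (h.summable hC hu hu hu hu k).tsum_sub (h.summable hC hv hv hv hv k),
    ← (h.summable hC hd hu hu hu k).tsum_add (h.summable hC hv hd hu hu k),
    ← ((h.summable hC hd hu hu hu k).add (h.summable hC hv hd hu hu k)).tsum_add
      (h.summable hC hv hv hd hu k),
    ← (((h.summable hC hd hu hu hu k).add (h.summable hC hv hd hu hu k)).add
      (h.summable hC hv hv hd hu k)).tsum_add (h.summable hC hv hv hv hd k)]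
  exact tsum_congr fun q => by ring

theorem CoeffBound.l2_quadForm_sub_le (h : CoeffBound c C) (hC : C ≠ ⊤) {u v : ℤ → ℂ}
    {M : ℝ≥0∞} (hM : M ≠ ⊤) (hu : l2 u ≤ M) (hv : l2 v ≤ M) :
    l2 (fun k => quadForm c u u u u k - quadForm c v v v v k) ≤
      4 * C * M ^ 3 * l2 (fun k => u k - v k) := by
  have hu' := ne_top_of_le_ne_top hM hu
  have hv' := ne_top_of_le_ne_top hM hv
  simp only [h.quadForm_sub hC hu' hv']
  set d := fun k => u k - v k
  calc _ ≤ l2 (quadForm c d u u u) + l2 (quadForm c v d u u) + l2 (quadForm c v v d u) +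
        l2 (quadForm c v v v d) :=
        (l2_add_le _ _).trans (by gcongr; exact (l2_add_le _ _).trans (by
          gcongr; exact l2_add_le _ _))
    _ ≤ C * (l2 d * M * M * M) + C * (M * l2 d * M * M) + C * (M * M * l2 d * M) +
        C * (M * M * M * l2 d) := by
        gcongr
        · exact (h.l2_quadForm_le _ _ _ _).trans (by gcongr)
        · exact (h.l2_quadForm_le _ _ _ _).trans (by gcongr)
        · exact (h.l2_quadForm_le _ _ _ _).trans (by gcongr)
        · exact (h.l2_quadForm_le _ _ _ _).trans (by gcongr)
    _ = _ := by ring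

/-- The weight of the output is distributed over the four inputs, and the plain bound applies to
each resulting form. The estimate is linear in the weighted norm, as Gronwall's inequality requires.
-/
theorem CoeffBound.l2_weight_le (h : CoeffBound c C) {ω : ℤ → ℝ≥0∞} {D : ℝ≥0∞}
    (hω : ∀ x y z w, ω (x + y + z + w) ≤ D * (ω x + ω y + ω z + ω w)) (u : ℤ → ℂ) :
    l2 (fun k => ω k * ‖quadForm c u u u u k‖ₑ) ≤
      4 * D * C * l2 u ^ 3 * l2 (fun k => ω k * ‖u k‖ₑ) := by
  set a : ℤ → ℝ≥0∞ := fun k => ‖u k‖ₑ with ha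
  set b : ℤ → ℝ≥0∞ := fun k => ω k * ‖u k‖ₑ with hb
  set K : ℤ → ℤ → ℤ → ℤ → ℝ≥0∞ := fun x y z w => ‖c x y z w‖ₑ
  have h1 : ∀ k, ω k * ‖quadForm c u u u u k‖ₑ ≤
      D * (posForm K b a a a k + posForm K a b a a k + posForm K a a b a k +
        posForm K a a a b k) := by
    intro k
    refine (mul_le_mul_right (enorm_quadForm_le c u u u u k) _).trans ?_
    unfold posForm
    rw [← ENNReal.tsum_add, ← ENNReal.tsum_add, ← ENNReal.tsum_add, ← ENNReal.tsum_mul_left,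
      ← ENNReal.tsum_mul_left]
    refine ENNReal.tsum_le_tsum fun q => ?_
    have h2 := hω q.1 q.2.1 q.2.2 (k - q.1 - q.2.1 - q.2.2)
    rw [show q.1 + q.2.1 + q.2.2 + (k - q.1 - q.2.1 - q.2.2) = k by ring] at h2
    refine (mul_le_mul_left h2 _).trans (le_of_eq ?_)
    simp only [ha, hb, K]
    ring
  have la : l2 a = l2 u := l2_enorm u
  calc _ ≤ l2 (fun k => D * (posForm K b a a a k + posForm K a b a a k + posForm K a a b a k +
        posForm K a a a b k)) := l2_mono fun k => by simpa using h1 k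
    _ ≤ D * (l2 (posForm K b a a a) + l2 (posForm K a b a a) + l2 (posForm K a a b a) +
        l2 (posForm K a a a b)) := by
        rw [l2_const_mul_ennreal]
        gcongr
        exact (l2_add_le_ennreal _ _).trans (by gcongr; exact (l2_add_le_ennreal _ _).trans (by
          gcongr; exact l2_add_le_ennreal _ _))
    _ ≤ D * (C * (l2 b * l2 a * l2 a * l2 a) + C * (l2 a * l2 b * l2 a * l2 a) +
        C * (l2 a * l2 a * l2 b * l2 a) + C * (l2 a * l2 a * l2 a * l2 b)) := by
        gcongr
        all_goals exact h _ _ _ _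
    _ = _ := by rw [la]; ring

/-- Here the kernel itself absorbs the weight, so unweighted norms control the weighted output.
Smoothing is used in this form. -/
theorem KernelBound.l2_weight_quadForm_le {ω : ℤ → ℝ≥0∞}
    (h : KernelBound (fun x y z w => ω (x + y + z + w) * ‖c x y z w‖ₑ) C) (u₁ u₂ u₃ u₄ : ℤ → ℂ) :
    l2 (fun k => ω k * ‖quadForm c u₁ u₂ u₃ u₄ k‖ₑ) ≤ C * (l2 u₁ * l2 u₂ * l2 u₃ * l2 u₄) := by
  refine (l2_mono fun k => ?_).trans ((h (fun k => ‖u₁ k‖ₑ)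
      (fun k => ‖u₂ k‖ₑ) (fun k => ‖u₃ k‖ₑ) (fun k => ‖u₄ k‖ₑ)).trans (le_of_eq ?_))
  · simp only [enorm_eq_self]
    refine (mul_le_mul_right (enorm_quadForm_le c u₁ u₂ u₃ u₄ k) _).trans ?_
    unfold posForm
    rw [← ENNReal.tsum_mul_left]
    refine ENNReal.tsum_le_tsum fun q => le_of_eq ?_
    have h1 : q.1 + q.2.1 + q.2.2 + (k - q.1 - q.2.1 - q.2.2) = k := by ring
    simp only [h1]
    ring
  · simp only [l2_enorm]

/-- Two limits are separated: for frozen `u'` the coefficients converge under the summable majorant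
given by `c`, while replacing `u'` by `u i` costs a Lipschitz constant on the ball of radius `l2 u'
+ 1` that is uniform over all coefficients dominated by `c`. -/
theorem CoeffBound.tendsto_quadForm {ι : Type*} {F : Filter ι}
    (h : CoeffBound c C) (hC : C ≠ ⊤) {b : ι → ℤ → ℤ → ℤ → ℤ → ℂ} {b' : ℤ → ℤ → ℤ → ℤ → ℂ}
    (hb : ∀ i x y z w, ‖b i x y z w‖ ≤ ‖c x y z w‖)
    (hbb : ∀ x y z w, Tendsto (fun i => b i x y z w) F (𝓝 (b' x y z w)))
    {u : ι → ℤ → ℂ} {u' : ℤ → ℂ} (hu' : l2 u' ≠ ⊤)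
    (hu : Tendsto (fun i => l2 (fun k => u i k - u' k)) F (𝓝 0)) (k : ℤ) :
    Tendsto (fun i => quadForm (b i) (u i) (u i) (u i) (u i) k) F
      (𝓝 (quadForm b' u' u' u' u' k)) := by
  have h1 : Tendsto (fun i => quadForm (b i) u' u' u' u' k) F (𝓝 (quadForm b' u' u' u' u' k)) := by
    refine tendsto_tsum_of_dominated_convergence
      ((h.summable hC hu' hu' hu' hu' k).norm) (fun q => ?_) (.of_forall fun i q => ?_)
    · exact (hbb _ _ _ _).mul_const _
    · rw [norm_mul]
      simp only [norm_mul (c _ _ _ _)]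
      exact mul_le_mul_of_nonneg_right (hb _ _ _ _ _) (norm_nonneg _)
  have h2 : Tendsto (fun i => quadForm (b i) (u i) (u i) (u i) (u i) k -
      quadForm (b i) u' u' u' u' k) F (𝓝 0) := by
    rw [tendsto_zero_iff_enorm_tendsto_zero]
    have h3 : Tendsto (fun i => 4 * C * (l2 u' + 1) ^ 3 * l2 (fun k => u i k - u' k)) F
        (𝓝 (4 * C * (l2 u' + 1) ^ 3 * 0)) :=
      ENNReal.Tendsto.const_mul hu (Or.inr (by finiteness))
    rw [mul_zero] at h3
    refine tendsto_of_tendsto_of_tendsto_of_le_of_le' tendsto_const_nhds h3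
      (.of_forall fun _ => zero_le) ?_
    filter_upwards [hu.eventually_le_const (zero_lt_one)] with i hi
    have h4 : l2 (u i) ≤ l2 u' + 1 := by
      calc l2 (u i) = l2 (fun k => u' k + (u i k - u' k)) := by simp
        _ ≤ l2 u' + l2 (fun k => u i k - u' k) := l2_add_le _ _
        _ ≤ _ := by gcongr
    exact (enorm_le_l2 (fun k => quadForm (b i) (u i) (u i) (u i) (u i) k -
      quadForm (b i) u' u' u' u' k) k).trans
      ((h.mono (hb i)).l2_quadForm_sub_le hC (by finiteness) h4 le_self_add)
  simpa using h2.add h1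

/-! ### The unit at the zero mode -/

/-- `u` with the coefficient at `0` replaced by `1`. Forms of lower degree in functions of mean
value zero are quadrilinear forms in this sequence. -/
noncomputable def withUnit (u : ℤ → ℂ) : ℤ → ℂ := fun k => if k = 0 then 1 else u k

theorem withUnit_zero (u : ℤ → ℂ) : withUnit u 0 = 1 := if_pos rfl

theorem withUnit_of_ne (u : ℤ → ℂ) {k : ℤ} (hk : k ≠ 0) : withUnit u k = u k := if_neg hk

theorem l2_withUnit_le (u : ℤ → ℂ) : l2 (withUnit u) ≤ l2 u + 1 := by
  have h1 : l2 (fun k : ℤ => if k = 0 then (1 : ℂ) else 0) = 1 := by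
    rw [← (ENNReal.pow_right_strictMono (n := 2) (by norm_num)).injective.eq_iff, l2_sq,
      tsum_eq_single 0]
    · simp
    · intro k hk; simp [hk]
  rw [← h1]
  calc l2 (withUnit u) ≤ l2 (fun k => ‖u k‖ₑ + ‖(if k = 0 then (1 : ℂ) else 0)‖ₑ) :=
        l2_mono fun k => by
          by_cases hk : k = 0 <;> simp [withUnit, hk]
    _ ≤ l2 (fun k => ‖u k‖ₑ) + l2 (fun k : ℤ => ‖(if k = 0 then (1 : ℂ) else 0)‖ₑ) :=
        l2_add_le_ennreal _ _
    _ = _ := by rw [l2_enorm, l2_enorm]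

theorem withUnit_sub {u v : ℤ → ℂ} (hu : u 0 = 0) (hv : v 0 = 0) (k : ℤ) :
    withUnit u k - withUnit v k = u k - v k := by
  by_cases hk : k = 0 <;> simp [withUnit, hk, hu, hv]

/-- A weight vanishing at the origin does not see the artificial unit, so weighted estimates acquire
no additive constant. -/
theorem weight_withUnit {ω : ℤ → ℝ≥0∞} (hω : ω 0 = 0) (u : ℤ → ℂ) (k : ℤ) :
    ω k * ‖withUnit u k‖ₑ = ω k * ‖u k‖ₑ := by
  by_cases hk : k = 0 <;> simp [withUnit, hk, hω]

end Forms

/-! ### Elementary kernels -/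

theorem norm_osc (m : ℤ) (t : ℝ) : ‖osc m t‖ = 1 := by
  have : Complex.I * (m : ℂ) * (t : ℂ) = ((m * t : ℝ) : ℂ) * Complex.I := by push_cast; ring
  rw [osc, this, Complex.norm_exp_ofReal_mul_I]

theorem osc_zero_left (t : ℝ) : osc 0 t = 1 := by simp [osc]

theorem osc_add (m m' : ℤ) (t : ℝ) : osc (m + m') t = osc m t * osc m' t := by
  simp only [osc, ← Complex.exp_add]; congr 1; push_cast; ring

theorem hasDerivAt_osc (m : ℤ) (t : ℝ) :
    HasDerivAt (fun τ => osc m τ) (Complex.I * m * osc m t) t := by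
  have h : HasDerivAt (fun τ : ℝ => Complex.I * (m : ℂ) * (τ : ℂ)) (Complex.I * m) t := by
    simpa using (Complex.ofRealCLM.hasDerivAt (x := t)).const_mul (Complex.I * (m : ℂ))
  simpa [osc, mul_comm] using h.cexp

theorem continuous_osc (m : ℤ) : Continuous (osc m) := by
  unfold osc; fun_prop

/-- `1 / |m|`, with value `0` at `m = 0`. -/
noncomputable def recip (m : ℤ) : ℝ≥0∞ := ‖((m : ℂ))⁻¹‖ₑ

theorem recip_le_one (m : ℤ) : recip m ≤ 1 := by
  have : ‖((m : ℂ))⁻¹‖ₑ ≤ ‖(1 : ℂ)‖ₑ := by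
    rw [enorm_le_iff_norm_le, norm_inv, norm_one, Complex.norm_intCast]
    rcases eq_or_ne m 0 with rfl | hm
    · simp
    · exact inv_le_one_of_one_le₀ (by exact_mod_cast Int.one_le_abs hm)
  simpa [recip] using this

theorem l2_recip_ne_top : l2 recip ≠ ⊤ := by
  have h : l2 recip ^ 2 ≠ ⊤ := by
    rw [l2_sq]
    have h1 := Real.summable_one_div_int_pow (p := 2) |>.2 (by norm_num)
    have h2 := h1.tsum_ofReal_ne_top
    convert h2 using 3 with m
    rw [enorm_eq_self, recip, ← ofReal_norm, ← ENNReal.ofReal_pow (norm_nonneg _)]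
    congr 1
    rw [norm_inv, Complex.norm_intCast, inv_pow, sq_abs, one_div]
  intro h1
  exact h (by rw [h1]; rfl)

/-- The indicator of the origin. -/
noncomputable def origin (m : ℤ) : ℝ≥0∞ := if m = 0 then 1 else 0

theorem l2_origin : l2 origin = 1 := by
  refine (ENNReal.pow_right_strictMono (n := 2) (by norm_num)).injective ?_
  simp only [l2_sq, enorm_eq_self]
  rw [tsum_eq_single 0]
  · simp [origin]
  · intro k hk; simp [origin, hk]

/-- The indicator of the modes `|m| ≤ n`. -/
noncomputable def lowInd (n : ℕ) (m : ℤ) : ℝ≥0∞ := if |m| ≤ (n : ℤ) then 1 else 0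

theorem l2_lowInd_ne_top (n : ℕ) : l2 (lowInd n) ≠ ⊤ := by
  have h : l2 (lowInd n) ^ 2 ≠ ⊤ := by
    rw [l2_sq, tsum_eq_sum (s := Finset.Icc (-(n : ℤ)) n)]
    · refine ENNReal.sum_ne_top.2 fun m _ => ?_
      by_cases hm : |m| ≤ (n : ℤ) <;> simp [lowInd, hm]
    · intro m hm
      have : ¬ |m| ≤ (n : ℤ) := fun h => hm (by simpa [abs_le] using h)
      simp [lowInd, this]
  intro h1
  exact h (by rw [h1]; rfl)

/-! ### Criteria for kernels that are products of functions of linear forms -/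

theorem tsum_le_of_injective (f g h : ℤ → ℝ≥0∞) {l : ℤ × ℤ × ℤ → ℤ × ℤ × ℤ}
    (hl : Function.Injective l) :
    ∑' q, (f (l q).1 * g (l q).2.1 * h (l q).2.2) ^ 2 ≤ (l2 f * l2 g * l2 h) ^ 2 := by
  refine (ENNReal.tsum_comp_le_tsum_of_injective hl
    fun q => (f q.1 * g q.2.1 * h q.2.2) ^ 2).trans (le_of_eq ?_)
  rw [tsum_prod3 (fun x y z => (f x * g y * h z) ^ 2)]
  simp only [mul_pow, ENNReal.tsum_mul_left, ENNReal.tsum_mul_right, l2_sq, enorm_eq_self]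

/-- In applications `l` lists three linear forms that are independent once the output is fixed; a
factor `origin` pins an index that a form of lower degree does not use and costs nothing, since `l2
origin = 1`. -/
theorem KernelBound.of_output_factors {K : ℤ → ℤ → ℤ → ℤ → ℝ≥0∞} (f g h : ℤ → ℝ≥0∞)
    (l : ℤ → ℤ → ℤ → ℤ → ℤ × ℤ × ℤ)
    (hl : ∀ k, Function.Injective fun q : ℤ × ℤ × ℤ =>
      l q.1 q.2.1 q.2.2 (k - q.1 - q.2.1 - q.2.2))
    (hK : ∀ x y z w, K x y z w ≤ f (l x y z w).1 * g (l x y z w).2.1 * h (l x y z w).2.2) :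
    KernelBound K (l2 f * l2 g * l2 h) :=
  .of_output fun k => (ENNReal.tsum_le_tsum fun q => by gcongr; exact hK _ _ _ _).trans
    (tsum_le_of_injective f g h (hl k))

theorem KernelBound.of_third_factors {K : ℤ → ℤ → ℤ → ℤ → ℝ≥0∞} (f g h : ℤ → ℝ≥0∞)
    (l : ℤ → ℤ → ℤ → ℤ → ℤ × ℤ × ℤ)
    (hl : ∀ z, Function.Injective fun q : ℤ × ℤ × ℤ => l q.1 q.2.1 z q.2.2)
    (hK : ∀ x y z w, K x y z w ≤ f (l x y z w).1 * g (l x y z w).2.1 * h (l x y z w).2.2) :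
    KernelBound K (l2 f * l2 g * l2 h) :=
  .of_third fun z => (ENNReal.tsum_le_tsum fun q => by gcongr; exact hK _ _ _ _).trans
    (tsum_le_of_injective f g h (hl z))

/-! ### The coefficients of the operators -/

/-- Coefficients of `B₂`. -/
noncomputable def coB2 (t : ℝ) (x y z w : ℤ) : ℂ :=
  if z = 0 ∧ w = 0 ∧ x + y ≠ 0 then
    osc (3 * (x + y) * x * y) t * ((x : ℂ)⁻¹ * (y : ℂ)⁻¹) else 0

/-- Coefficients of `B₃₀`, with a multiplier `χ` acting on the inner product. -/
noncomputable def coB30 (χ : ℤ → ℂ) (n : ℕ) (t : ℝ) (x y z w : ℤ) : ℂ :=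
  if w = 0 ∧ x + y + z ≠ 0 ∧ (n : ℤ) < |y| ∧ (n : ℤ) < |z| then
    χ (y + z) * osc (3 * res3 (x, y, z)) t * ((x : ℂ)⁻¹ * (res3 (x, y, z) : ℂ)⁻¹) else 0

/-- Coefficients of `R_{3res} + R_{3nres1}`, with a multiplier `χ` acting on the inner product. -/
noncomputable def coR3 (χ : ℤ → ℂ) (n : ℕ) (t : ℝ) (x y z w : ℤ) : ℂ :=
  if w = 0 ∧ x + y + z ≠ 0 ∧ y ≠ 0 ∧ z ≠ 0 ∧ y + z ≠ 0 ∧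
      (res3 (x, y, z) = 0 ∨ ¬((n : ℤ) < |y| ∧ (n : ℤ) < |z|)) then
    χ (y + z) * osc (3 * res3 (x, y, z)) t * (x : ℂ)⁻¹ else 0

/-- The denominator `σ`. -/
def sigma4 (x y z w : ℤ) : ℤ := (x + y) * (x + z + w) * (y + z + w)

/-- Coefficients of `B₄₀¹`, with multipliers `χ` acting on the inner products. -/
noncomputable def coB401 (χ : ℤ → ℂ) (n : ℕ) (t : ℝ) (x y z w : ℤ) : ℂ :=
  if x + y + z + w ≠ 0 ∧ z ≠ 0 ∧ w ≠ 0 ∧ z + w ≠ 0 ∧ (n : ℤ) < |x| ∧ (n : ℤ) < |y| then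
    χ (x + y) * χ (z + w) * osc (phase4 x y z w) t * (sigma4 x y z w : ℂ)⁻¹ else 0

/-- Coefficients of `B₄₀²`, with multipliers `χ` acting on the inner products. -/
noncomputable def coB402 (χ : ℤ → ℂ) (n : ℕ) (t : ℝ) (x y z w : ℤ) : ℂ :=
  if x + y + z + w ≠ 0 ∧ z ≠ 0 ∧ w ≠ 0 ∧ (n : ℤ) < |z + w| ∧ (n : ℤ) < |y| then
    χ (y + z + w) * χ (z + w) * osc (phase4 x y z w) t *
      (((z + w : ℤ) : ℂ) * ((x : ℂ)⁻¹ * (sigma4 x y z w : ℂ)⁻¹)) else 0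

/-- Coefficients of `R_{3res} + R_{3nres1} - ⅓ B₄₀`. -/
noncomputable def coRhs (χ : ℤ → ℂ) (n : ℕ) (t : ℝ) (x y z w : ℤ) : ℂ :=
  coR3 χ n t x y z w + (-1 / 3) * (1 / 2 * coB401 χ n t x y z w + coB402 χ n t x y z w)

/-- Coefficients of `-(1/6) B₂ + (1/18) B₃₀`. -/
noncomputable def coLhs (χ : ℤ → ℂ) (n : ℕ) (t : ℝ) (x y z w : ℤ) : ℂ :=
  (-1 / 6) * coB2 t x y z w + 1 / 18 * coB30 χ n t x y z w

section Bounds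

variable {χ : ℤ → ℂ}

theorem enorm_osc (m : ℤ) (t : ℝ) : ‖osc m t‖ₑ = 1 := by
  rw [← ofReal_norm, norm_osc, ENNReal.ofReal_one]

theorem enorm_multiplier_le (hχ : ∀ m, ‖χ m‖ ≤ 1) (m : ℤ) : ‖χ m‖ₑ ≤ 1 := by
  simpa using (enorm_le_iff_norm_le (y := (1 : ℂ))).2 (by simpa using hχ m)

theorem recip_mul (x y : ℤ) : recip (x * y) = recip x * recip y := by
  simp [recip, mul_comm]

theorem recip_neg (x : ℤ) : recip (-x) = recip x := by
  rw [recip, recip, Int.cast_neg, inv_neg, enorm_neg]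

/-- Partial fractions, (x + y)/(xy) = 1/x + 1/y, with `recip 0 = 0` taking care of zero indices. Two
denominators thus pay for one derivative. -/
theorem enorm_add_mul_recip_le (x y : ℤ) :
    ‖((x + y : ℤ) : ℂ)‖ₑ * (recip x * recip y) ≤ recip x + recip y := by
  rcases eq_or_ne x 0 with rfl | hx
  · simp [recip]
  rcases eq_or_ne y 0 with rfl | hy
  · simp [recip]
  have hx' : (x : ℂ) ≠ 0 := by exact_mod_cast hx
  have hy' : (y : ℂ) ≠ 0 := by exact_mod_cast hy
  simp only [recip, ← enorm_mul]
  rw [show ((x + y : ℤ) : ℂ) * ((x : ℂ)⁻¹ * (y : ℂ)⁻¹) = (x : ℂ)⁻¹ + (y : ℂ)⁻¹ by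
    push_cast; field_simp; ring]
  exact enorm_add_le _ _

/-- B₂ gains one derivative: the output frequency x + y against 1/(xy) leaves 1/|x| + 1/|y|, and
each summand is square-summable at a fixed output because z and w are pinned to 0. -/
theorem coB2_smoothing (t : ℝ) :
    KernelBound (fun x y z w => ‖((x + y + z + w : ℤ) : ℂ)‖ₑ * ‖coB2 t x y z w‖ₑ)
      (2 * l2 recip) := by
  have h1 : KernelBound (fun x y z w => recip x * origin z * origin w) (l2 recip) := by
    have := KernelBound.of_output_factors (K := fun x y z w => recip x * origin z * origin w)
      recip origin origin (fun x y z w => (x, z, w))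
      (fun k => by rintro ⟨x, y, z⟩ ⟨x', y', z'⟩ h; simp only [Prod.mk.injEq] at h ⊢; omega)
      (fun x y z w => le_rfl)
    simpa [l2_origin] using this
  have h2 : KernelBound (fun x y z w => recip y * origin z * origin w) (l2 recip) := by
    have := KernelBound.of_output_factors (K := fun x y z w => recip y * origin z * origin w)
      recip origin origin (fun x y z w => (y, z, w))
      (fun k => by rintro ⟨x, y, z⟩ ⟨x', y', z'⟩ h; simp only [Prod.mk.injEq] at h ⊢; omega)
      (fun x y z w => le_rfl)
    simpa [l2_origin] using this
  rw [two_mul]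
  refine (h1.add h2).mono fun x y z w => ?_
  unfold coB2
  split_ifs with h
  · obtain ⟨rfl, rfl, h⟩ := h
    simpa [enorm_osc, origin, enorm_mul, recip] using enorm_add_mul_recip_le x y
  · simp

/-- The output frequency x + (y + z) is spent on 1/x and 1/(y + z). What remains, 1/((x + y)(z +
x)), is square-summable at a fixed output, with a constant independent of n. -/
theorem coB30_smoothing (hχ : ∀ m, ‖χ m‖ ≤ 1) (n : ℕ) (t : ℝ) :
    KernelBound (fun x y z w => ‖((x + y + z + w : ℤ) : ℂ)‖ₑ * ‖coB30 χ n t x y z w‖ₑ)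
      (2 * (l2 recip * l2 recip)) := by
  have h1 : KernelBound (fun x y z w => recip (x + y) * recip (z + x) * origin w)
      (l2 recip * l2 recip) := by
    have := KernelBound.of_output_factors
      (K := fun x y z w => recip (x + y) * recip (z + x) * origin w)
      recip recip origin (fun x y z w => (x + y, z + x, w))
      (fun k => by rintro ⟨x, y, z⟩ ⟨x', y', z'⟩ h; simp only [Prod.mk.injEq] at h ⊢; omega)
      (fun x y z w => le_rfl)
    simpa [l2_origin] using this
  refine (h1.const_mul 2).mono fun x y z w => ?_
  unfold coB30
  split_ifs with h
  · obtain ⟨rfl, h⟩ := h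
    simp only [enorm_mul, enorm_osc, origin, if_true, mul_one, add_zero]
    rw [show ‖((x : ℂ))⁻¹‖ₑ = recip x from rfl,
      show ‖((res3 (x, y, z) : ℤ) : ℂ)⁻¹‖ₑ = recip (res3 (x, y, z)) from rfl, res3, recip_mul,
      recip_mul]
    calc _ = ‖χ (y + z)‖ₑ * (‖((x + (y + z) : ℤ) : ℂ)‖ₑ * (recip x * recip (y + z))) *
          (recip (x + y) * recip (z + x)) := by rw [← add_assoc]; ring
      _ ≤ 1 * (1 + 1) * (recip (x + y) * recip (z + x)) := by
          gcongr
          · exact enorm_multiplier_le hχ _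
          · exact (enorm_add_mul_recip_le x (y + z)).trans
              (add_le_add (recip_le_one _) (recip_le_one _))
      _ = _ := by rw [one_mul, one_add_one_eq_two]
  · simp

theorem recip_anti {n : ℕ} {y : ℤ} (hn : n ≠ 0) (h : (n : ℤ) < |y|) : recip y ≤ recip n := by
  unfold recip
  rw [enorm_le_iff_norm_le, norm_inv, norm_inv, Complex.norm_intCast, Complex.norm_intCast]
  have h1 : (0 : ℝ) < |((n : ℤ) : ℝ)| := by simpa using Nat.pos_of_ne_zero hn
  refine inv_anti₀ h1 ?_
  rw [abs_of_nonneg (a := ((n : ℤ) : ℝ)) (by positivity)]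
  exact_mod_cast h.le

/-- Writing y = -x + (x + y) gives 1/(|x| |x + y|) ≤ 2/|y|, which is below 2/n because y is a high
mode; 1/((y + z)(z + x)) is left for the summation. This decay in n is what the uniqueness threshold
rests on. -/
theorem coB30_bound (hχ : ∀ m, ‖χ m‖ ≤ 1) {n : ℕ} (hn : n ≠ 0) (t : ℝ) :
    CoeffBound (coB30 χ n t) (2 * recip n * (l2 recip * l2 recip)) := by
  have h1 : KernelBound (fun x y z w => recip (y + z) * recip (z + x) * origin w)
      (l2 recip * l2 recip) := by
    have := KernelBound.of_output_factors
      (K := fun x y z w => recip (y + z) * recip (z + x) * origin w)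
      recip recip origin (fun x y z w => (y + z, z + x, w))
      (fun k => by rintro ⟨x, y, z⟩ ⟨x', y', z'⟩ h; simp only [Prod.mk.injEq] at h ⊢; omega)
      (fun x y z w => le_rfl)
    simpa [l2_origin] using this
  refine (h1.const_mul (2 * recip n)).mono fun x y z w => ?_
  unfold coB30
  split_ifs with h
  · obtain ⟨rfl, h, hy, hz⟩ := h
    simp only [enorm_mul, enorm_osc, origin, if_true, mul_one]
    rw [show ‖((x : ℂ))⁻¹‖ₑ = recip x from rfl,
      show ‖((res3 (x, y, z) : ℤ) : ℂ)⁻¹‖ₑ = recip (res3 (x, y, z)) from rfl, res3, recip_mul,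
      recip_mul]
    have hy0 : y ≠ 0 := by rintro rfl; simp at hy; omega
    have hy1 : recip y * ‖(y : ℂ)‖ₑ = 1 := by
      rw [recip, ← enorm_mul, inv_mul_cancel₀ (by exact_mod_cast hy0)]; simp
    have h3 : recip x * recip (x + y) ≤ 2 * recip n := by
      calc recip x * recip (x + y) =
          recip y * (‖((-x + (x + y) : ℤ) : ℂ)‖ₑ * (recip (-x) * recip (x + y))) := by
            rw [recip_neg, neg_add_cancel_left, ← mul_assoc, hy1, one_mul]
        _ ≤ recip n * (1 + 1) := by
            gcongr
            · exact recip_anti hn hy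
            · exact (enorm_add_mul_recip_le _ _).trans
                (add_le_add (recip_le_one _) (recip_le_one _))
        _ = _ := by rw [one_add_one_eq_two, mul_comm]
    calc _ = ‖χ (y + z)‖ₑ * (recip x * recip (x + y)) * (recip (y + z) * recip (z + x)) := by ring
      _ ≤ 1 * (2 * recip n) * (recip (y + z) * recip (z + x)) := by
          gcongr
          exact enorm_multiplier_le hχ _
      _ = _ := by rw [one_mul]
  · simp

/-- Since y + z ≠ 0, resonance means x + y = 0 or z + x = 0, and otherwise y or z is a low mode. In
each case 1/|x| times the corresponding indicator is square-summable at a fixed output. The constant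
depends on n and need not be small. -/
theorem coR3_bound (hχ : ∀ m, ‖χ m‖ ≤ 1) (n : ℕ) (t : ℝ) :
    CoeffBound (coR3 χ n t) (2 * l2 recip + 2 * (l2 recip * l2 (lowInd n))) := by
  have h1 : KernelBound (fun x y z w => recip x * origin (x + y) * origin w) (l2 recip) := by
    have := KernelBound.of_output_factors
      (K := fun x y z w => recip x * origin (x + y) * origin w)
      recip origin origin (fun x y z w => (x, x + y, w))
      (fun k => by rintro ⟨x, y, z⟩ ⟨x', y', z'⟩ h; simp only [Prod.mk.injEq] at h ⊢; omega)
      (fun x y z w => le_rfl)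
    simpa [l2_origin] using this
  have h2 : KernelBound (fun x y z w => recip x * origin (z + x) * origin w) (l2 recip) := by
    have := KernelBound.of_output_factors
      (K := fun x y z w => recip x * origin (z + x) * origin w)
      recip origin origin (fun x y z w => (x, z + x, w))
      (fun k => by rintro ⟨x, y, z⟩ ⟨x', y', z'⟩ h; simp only [Prod.mk.injEq] at h ⊢; omega)
      (fun x y z w => le_rfl)
    simpa [l2_origin] using this
  have h3 : KernelBound (fun x y z w => recip x * lowInd n y * origin w)
      (l2 recip * l2 (lowInd n)) := by
    have := KernelBound.of_output_factors
      (K := fun x y z w => recip x * lowInd n y * origin w)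
      recip (lowInd n) origin (fun x y z w => (x, y, w))
      (fun k => by rintro ⟨x, y, z⟩ ⟨x', y', z'⟩ h; simp only [Prod.mk.injEq] at h ⊢; omega)
      (fun x y z w => le_rfl)
    simpa [l2_origin] using this
  have h4 : KernelBound (fun x y z w => recip x * lowInd n z * origin w)
      (l2 recip * l2 (lowInd n)) := by
    have := KernelBound.of_output_factors
      (K := fun x y z w => recip x * lowInd n z * origin w)
      recip (lowInd n) origin (fun x y z w => (x, z, w))
      (fun k => by rintro ⟨x, y, z⟩ ⟨x', y', z'⟩ h; simp only [Prod.mk.injEq] at h ⊢; omega)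
      (fun x y z w => le_rfl)
    simpa [l2_origin] using this
  rw [two_mul, two_mul]
  refine ((h1.add h2).add (h3.add h4)).mono fun x y z w => ?_
  unfold coR3
  split_ifs with h
  · obtain ⟨rfl, -, -, -, hyz, h⟩ := h
    simp only [enorm_mul, enorm_osc, mul_one]
    rw [show ‖((x : ℂ))⁻¹‖ₑ = recip x from rfl]
    have h5 : (1 : ℝ≥0∞) ≤ origin (x + y) + origin (z + x) + (lowInd n y + lowInd n z) := by
      by_cases ha : x + y = 0
      · simp [origin, ha, add_assoc]
      by_cases hb : z + x = 0
      · rw [add_right_comm, add_comm]; simp [origin, hb]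
      have hc : res3 (x, y, z) ≠ 0 := mul_ne_zero (mul_ne_zero ha hyz) hb
      by_cases hd : |y| ≤ (n : ℤ)
      · rw [add_left_comm]; simp [lowInd, hd]
      have he : |z| ≤ (n : ℤ) := by
        by_contra h'
        exact (h.resolve_left hc) ⟨by omega, by omega⟩
      rw [← add_assoc, add_comm]; simp [lowInd, he]
    calc ‖χ (y + z)‖ₑ * recip x ≤ 1 * recip x := by gcongr; exact enorm_multiplier_le hχ _
      _ = recip x * 1 := mul_comm _ _
      _ ≤ recip x * (origin (x + y) + origin (z + x) + (lowInd n y + lowInd n z)) := by gcongr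
      _ = _ := by simp only [origin, if_true]; ring
  · simp

/-- At a fixed output the three factors of σ involve only k₁ and k₂, so the sum over k₃ would
diverge. With k₃ fixed they determine the other three indices. -/
theorem coB401_bound (hχ : ∀ m, ‖χ m‖ ≤ 1) (n : ℕ) (t : ℝ) :
    CoeffBound (coB401 χ n t) (l2 recip * l2 recip * l2 recip) := by
  refine KernelBound.of_third_factors recip recip recip
    (fun x y z w => (x + y, x + z + w, y + z + w))
    (fun z => by rintro ⟨x, y, w⟩ ⟨x', y', w'⟩ h; simp only [Prod.mk.injEq] at h ⊢; omega)
    fun x y z w => ?_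
  unfold coB401
  split_ifs with h
  · simp only [enorm_mul, enorm_osc, mul_one]
    rw [show ‖((sigma4 x y z w : ℤ) : ℂ)⁻¹‖ₑ = recip (sigma4 x y z w) from rfl, sigma4, recip_mul,
      recip_mul]
    calc _ ≤ 1 * 1 * (recip (x + y) * recip (x + z + w) * recip (y + z + w)) := by
          gcongr <;> exact enorm_multiplier_le hχ _
      _ = _ := by rw [one_mul, one_mul]
  · simp

/-- The numerator z + w = -x + (x + z + w) is removed by partial fractions against 1/x and 1/(x + z
+ w). Two kernels with three denominators remain, both square-summable at a fixed third index. -/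
theorem coB402_bound (hχ : ∀ m, ‖χ m‖ ≤ 1) (n : ℕ) (t : ℝ) :
    CoeffBound (coB402 χ n t) (2 * (l2 recip * l2 recip * l2 recip)) := by
  have h1 : KernelBound (fun x y z w => recip x * recip (x + y) * recip (y + z + w))
      (l2 recip * l2 recip * l2 recip) :=
    KernelBound.of_third_factors recip recip recip
      (fun x y z w => (x, x + y, y + z + w))
      (fun z => by rintro ⟨x, y, w⟩ ⟨x', y', w'⟩ h; simp only [Prod.mk.injEq] at h ⊢; omega)
      (fun x y z w => le_rfl)
  have h2 : KernelBound (fun x y z w => recip (x + z + w) * recip (x + y) * recip (y + z + w))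
      (l2 recip * l2 recip * l2 recip) :=
    KernelBound.of_third_factors recip recip recip
      (fun x y z w => (x + z + w, x + y, y + z + w))
      (fun z => by rintro ⟨x, y, w⟩ ⟨x', y', w'⟩ h; simp only [Prod.mk.injEq] at h ⊢; omega)
      (fun x y z w => le_rfl)
  rw [two_mul]
  refine (h1.add h2).mono fun x y z w => ?_
  unfold coB402
  split_ifs with h
  · simp only [enorm_mul, enorm_osc, mul_one]
    rw [show ‖((sigma4 x y z w : ℤ) : ℂ)⁻¹‖ₑ = recip (sigma4 x y z w) from rfl, sigma4, recip_mul,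
      recip_mul, show ‖((x : ℂ))⁻¹‖ₑ = recip x from rfl]
    calc _ = ‖χ (y + z + w)‖ₑ * ‖χ (z + w)‖ₑ *
          (‖((-x + (x + z + w) : ℤ) : ℂ)‖ₑ * (recip (-x) * recip (x + z + w))) *
          (recip (x + y) * recip (y + z + w)) := by
          rw [recip_neg, show -x + (x + z + w) = z + w by ring]; ring
      _ ≤ 1 * 1 * (recip (-x) + recip (x + z + w)) * (recip (x + y) * recip (y + z + w)) := by
          gcongr
          · exact enorm_multiplier_le hχ _
          · exact enorm_multiplier_le hχ _
          · exact enorm_add_mul_recip_le _ _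
      _ = _ := by rw [recip_neg]; ring
  · simp

end Bounds

/-! ### The operators as quadrilinear forms -/

theorem projHigh_apply (n : ℕ) (u : ℤ → ℂ) (k : ℤ) :
    projHigh n u k = if (n : ℤ) < |k| then u k else 0 := by
  by_cases h : |k| ≤ (n : ℤ)
  · simp [projHigh, projLow, h, not_lt.2 h]
  · simp [projHigh, projLow, h, not_le.1 h]

/-- Only the coefficients at 0 of the last two sequences enter. The conditions that the first two
indices be nonzero need not be imposed on `coB2`, because inverses of 0 vanish. -/
theorem quadForm_coB2 {k : ℤ} (hk : k ≠ 0) (t : ℝ) (u v : ℤ → ℂ) {u₃ u₄ : ℤ → ℂ} (h₃ : u₃ 0 = 1)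
    (h₄ : u₄ 0 = 1) : quadForm (coB2 t) u v u₃ u₄ k = B2 t u v k := by
  unfold B2 quadForm
  have hinj : Function.Injective fun p : pairs k => ((p.1.1, p.1.2, 0) : ℤ × ℤ × ℤ) := by
    rintro ⟨⟨a, b⟩, h⟩ ⟨⟨a', b'⟩, h'⟩ e
    simpa using e
  rw [← hinj.tsum_eq]
  · refine tsum_congr fun p => ?_
    obtain ⟨⟨a, b⟩, ha, hb, hab⟩ := p
    simp only at ha hb hab
    subst hab
    simp [coB2, hk, h₃, h₄]
    ring
  · rintro ⟨x, y, z⟩ hq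
    simp only [Function.mem_support, ne_eq, mul_eq_zero, not_or, coB2, ite_eq_right_iff,
      not_forall, inv_eq_zero, Int.cast_eq_zero] at hq
    obtain ⟨⟨⟨rfl, h1, h2⟩, -, h3, h4⟩, -⟩ := hq
    exact ⟨⟨(x, y), h3, h4, by simp only; omega⟩, rfl⟩

theorem quadForm_coB2_withUnit {k : ℤ} (hk : k ≠ 0) (t : ℝ) (u : ℤ → ℂ) :
    quadForm (coB2 t) (withUnit u) (withUnit u) (withUnit u) (withUnit u) k = B2 t u u k := by
  rw [quadForm_coB2 hk t _ _ (withUnit_zero u) (withUnit_zero u)]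
  refine tsum_congr fun p => ?_
  rw [withUnit_of_ne u p.2.1, withUnit_of_ne u p.2.2.1]

theorem quadForm_coB30 {k : ℤ} (hk : k ≠ 0) (n : ℕ) (t : ℝ) (u : ℤ → ℂ) :
    quadForm (coB30 1 n t) (withUnit u) (withUnit u) (withUnit u) (withUnit u) k =
      B30 n t u u u k := by
  unfold B30 quadForm
  have hinj : Function.Injective fun p : nonresTriples k => (p.1 : ℤ × ℤ × ℤ) :=
    Subtype.val_injective
  rw [← hinj.tsum_eq]
  · refine tsum_congr fun p => ?_
    obtain ⟨⟨x, y, z⟩, ⟨hx, hy, hz, hyz, hs⟩, hr⟩ := p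
    simp only at hx hy hz hyz hs hr
    have h0 : k - x - y - z = 0 := by omega
    simp only [h0, withUnit_zero, withUnit_of_ne u hx, withUnit_of_ne u hy, withUnit_of_ne u hz,
      coB30, hs, projHigh_apply]
    by_cases h1 : (n : ℤ) < |y|
    · by_cases h2 : (n : ℤ) < |z|
      · rw [if_pos ⟨trivial, hk, h1, h2⟩, if_pos h1, if_pos h2, Pi.one_apply, div_eq_mul_inv,
          mul_inv]
        ring
      · simp [h2]
    · simp [h1]
  · rintro ⟨x, y, z⟩ hq
    simp only [Function.mem_support, ne_eq, mul_eq_zero, not_or, coB30, ite_eq_right_iff,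
      not_forall, inv_eq_zero, Int.cast_eq_zero] at hq
    obtain ⟨⟨⟨h0, h1, h2, h3⟩, -, h4, h5⟩, -⟩ := hq
    refine ⟨⟨(x, y, z), ⟨h4, ?_, ?_, ?_, by simp only; omega⟩, h5⟩, rfl⟩
    · rintro rfl; simp at h2; omega
    · rintro rfl; simp at h3; omega
    · intro h; exact h5 (by simp only at h; simp [res3, h])

theorem quadForm_coB401 {k : ℤ} (hk : k ≠ 0) (n : ℕ) (t : ℝ) (u : ℤ → ℂ) :
    quadForm (coB401 1 n t) (withUnit u) (withUnit u) (withUnit u) (withUnit u) k =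
      B401 n t u u u u k := by
  unfold B401 quadForm
  have hinj : Function.Injective fun p : nonresQuads k =>
      ((p.1.1, p.1.2.1, p.1.2.2.1) : ℤ × ℤ × ℤ) := by
    rintro ⟨⟨a, b, c, d⟩, h⟩ ⟨⟨a', b', c', d'⟩, h'⟩ e
    have e1 := h.2.2.2.2.2.1
    have e2 := h'.2.2.2.2.2.1
    simp only [Prod.mk.injEq, Subtype.mk.injEq] at e e1 e2 ⊢
    omega
  rw [← hinj.tsum_eq]
  · refine tsum_congr fun p => ?_
    obtain ⟨⟨x, y, z, w⟩, hx, hy, hz, hw, hzw, hs, h1, h2, h3⟩ := p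
    simp only at hx hy hz hw hzw hs h1 h2 h3
    have h0 : k - x - y - z = w := by omega
    simp only [h0, withUnit_of_ne u hx, withUnit_of_ne u hy, withUnit_of_ne u hz,
      withUnit_of_ne u hw, coB401, hs, projHigh_apply, sigma4]
    by_cases h1 : (n : ℤ) < |x|
    · by_cases h2 : (n : ℤ) < |y|
      · rw [if_pos ⟨hk, hz, hw, hzw, h1, h2⟩, if_pos h1, if_pos h2, Pi.one_apply, Pi.one_apply,
          div_eq_mul_inv]
        ring
      · simp [h2]
    · simp [h1]
  · rintro ⟨x, y, z⟩ hq
    simp only [Function.mem_support, ne_eq, mul_eq_zero, not_or, coB401, ite_eq_right_iff,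
      not_forall, inv_eq_zero, Int.cast_eq_zero] at hq
    obtain ⟨⟨⟨h0, h1, h2, h3, h4, h5⟩, -, h6⟩, -⟩ := hq
    simp only [sigma4, mul_eq_zero, not_or] at h6
    refine ⟨⟨(x, y, z, k - x - y - z), ?_, ?_, h1, h2, h3, by simp only; omega, h6.1.1,
      h6.1.2, h6.2⟩, rfl⟩
    · rintro rfl; simp at h4; omega
    · rintro rfl; simp at h5; omega

theorem quadForm_coB402 {k : ℤ} (hk : k ≠ 0) (n : ℕ) (t : ℝ) (u : ℤ → ℂ) :
    quadForm (coB402 1 n t) (withUnit u) (withUnit u) (withUnit u) (withUnit u) k =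
      B402 n t u u u u k := by
  unfold B402 quadForm
  have hinj : Function.Injective fun p : nonresQuads k =>
      ((p.1.1, p.1.2.1, p.1.2.2.1) : ℤ × ℤ × ℤ) := by
    rintro ⟨⟨a, b, c, d⟩, h⟩ ⟨⟨a', b', c', d'⟩, h'⟩ e
    have e1 := h.2.2.2.2.2.1
    have e2 := h'.2.2.2.2.2.1
    simp only [Prod.mk.injEq, Subtype.mk.injEq] at e e1 e2 ⊢
    omega
  rw [← hinj.tsum_eq]
  · refine tsum_congr fun p => ?_
    obtain ⟨⟨x, y, z, w⟩, hx, hy, hz, hw, hzw, hs, h1, h2, h3⟩ := p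
    simp only at hx hy hz hw hzw hs h1 h2 h3
    have h0 : k - x - y - z = w := by omega
    simp only [h0, withUnit_of_ne u hx, withUnit_of_ne u hy, withUnit_of_ne u hz,
      withUnit_of_ne u hw, coB402, hs, projHigh_apply, sigma4]
    by_cases h1 : (n : ℤ) < |z + w|
    · by_cases h2 : (n : ℤ) < |y|
      · rw [if_pos ⟨hk, hz, hw, h1, h2⟩, if_pos h1, if_pos h2, Pi.one_apply, Pi.one_apply,
          div_eq_mul_inv, mul_assoc x, mul_assoc x, Int.cast_mul x, mul_inv]
        ring
      · simp [h2]
    · simp [h1]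
  · rintro ⟨x, y, z⟩ hq
    simp only [Function.mem_support, ne_eq, mul_eq_zero, not_or, coB402, ite_eq_right_iff,
      not_forall, inv_eq_zero, Int.cast_eq_zero] at hq
    obtain ⟨⟨⟨h0, h1, h2, h3, h4⟩, -, h5, h6, h7⟩, -⟩ := hq
    simp only [sigma4, mul_eq_zero, not_or] at h7
    refine ⟨⟨(x, y, z, k - x - y - z), h6, ?_, h1, h2, h5, by simp only; omega, h7.1.1,
      h7.1.2, h7.2⟩, rfl⟩
    rintro rfl; simp at h4; omega

theorem one_multiplier (m : ℤ) : ‖(1 : ℤ → ℂ) m‖ ≤ 1 := by simp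

theorem coR3_const_ne_top (n : ℕ) :
    2 * l2 recip + 2 * (l2 recip * l2 (lowInd n)) ≠ ⊤ := by
  have := l2_recip_ne_top
  have := l2_lowInd_ne_top n
  finiteness

theorem l2_withUnit_ne_top {u : ℤ → ℂ} (hu : l2 u ≠ ⊤) : l2 (withUnit u) ≠ ⊤ :=
  ne_top_of_le_ne_top (by finiteness) (l2_withUnit_le u)

theorem projSign_apply (n : ℕ) (b : Bool) (u : ℤ → ℂ) (k : ℤ) :
    projSign n b u k = if b = true ↔ |k| ≤ (n : ℤ) then u k else 0 := by
  cases b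
  · simp [projSign, projHigh_apply]
  · simp [projSign, projLow]

/-- The full product of the three sums, with the contribution of second and third sign both -1
removed. -/
theorem sum_signs (f g h : Bool → ℂ) :
    ∑ ζ ∈ (Finset.univ : Finset (Bool × Bool × Bool)).filter (fun ζ => ζ.2 ≠ (false, false)),
      f ζ.1 * g ζ.2.1 * h ζ.2.2 =
    (f true + f false) * ((g true + g false) * (h true + h false) - g false * h false) := by
  rw [Finset.sum_filter]
  simp only [Fintype.sum_prod_type, Fintype.sum_bool]
  simp
  ring

theorem sum_projSign (n : ℕ) (u : ℤ → ℂ) (k : ℤ) :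
    projSign n true u k + projSign n false u k = u k := by
  by_cases h : |k| ≤ (n : ℤ) <;> simp [projSign_apply, h]

theorem norm_projSign_le (n : ℕ) (b : Bool) (u : ℤ → ℂ) (k : ℤ) :
    ‖projSign n b u k‖ ≤ ‖u k‖ := by
  rw [projSign_apply]; split_ifs <;> simp

/-- The six sign triples together reproduce exactly the non-resonant triples in which k₂ or k₃ is
low. To split the series into its resonant part and these six pieces, each piece is shown to be
dominated term by term by the whole series, which converges absolutely. -/
theorem quadForm_coR3 {k : ℤ} (hk : k ≠ 0) (n : ℕ) (t : ℝ) {u : ℤ → ℂ} (hu : l2 u ≠ ⊤) :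
    quadForm (coR3 1 n t) (withUnit u) (withUnit u) (withUnit u) (withUnit u) k =
      R3res u u u k + R3nres1 n t u u u k := by
  have hu' := l2_withUnit_ne_top hu
  set G : ℤ × ℤ × ℤ → ℂ := fun q => coR3 1 n t q.1 q.2.1 q.2.2 (k - q.1 - q.2.1 - q.2.2) *
      (withUnit u q.1 * withUnit u q.2.1 * withUnit u q.2.2 *
        withUnit u (k - q.1 - q.2.1 - q.2.2)) with hG
  have hsum : Summable G :=
    (coR3_bound one_multiplier n t).summable (coR3_const_ne_top n) hu' hu' hu' hu' k
  set fres : ℤ × ℤ × ℤ → ℂ := (resTriples k).indicator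
    fun p => u p.1 * u p.2.1 * u p.2.2 / (p.1 : ℂ) with hfres
  set fnr : Bool × Bool × Bool → ℤ × ℤ × ℤ → ℂ := fun ζ => (nonresTriples k).indicator
    fun p => osc (3 * res3 p) t / (p.1 : ℂ) *
      (projSign n ζ.1 u p.1 * projSign n ζ.2.1 u p.2.1 * projSign n ζ.2.2 u p.2.2) with hfnr
  set Z := (Finset.univ : Finset (Bool × Bool × Bool)).filter (fun ζ => ζ.2 ≠ (false, false))
  have key : ∀ q, G q = fres q + ∑ ζ ∈ Z, fnr ζ q ∧ ‖fres q‖ ≤ ‖G q‖ ∧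
      ∀ ζ ∈ Z, ‖fnr ζ q‖ ≤ ‖G q‖ := by
    rintro ⟨x, y, z⟩
    by_cases hT : (x, y, z) ∈ triples k
    · obtain ⟨hx, hy, hz, hyz, hs⟩ := id hT
      simp only at hx hy hz hyz hs
      have h0 : k - x - y - z = 0 := by omega
      by_cases hr : res3 (x, y, z) = 0
      · have m1 : (x, y, z) ∈ resTriples k := ⟨hT, hr⟩
        have m2 : (x, y, z) ∉ nonresTriples k := fun h => h.2 hr
        have e : G (x, y, z) = fres (x, y, z) := by
          simp only [hG, hfres, Set.indicator_of_mem m1, coR3, h0, withUnit_zero,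
            withUnit_of_ne u hx, withUnit_of_ne u hy, withUnit_of_ne u hz, hr]
          simp [hs, hk, hy, hz, hyz, osc_zero_left]
          ring
        have e2 : ∀ ζ, fnr ζ (x, y, z) = 0 := fun ζ => Set.indicator_of_notMem m2 _
        simp [e, e2]
      · have m1 : (x, y, z) ∉ resTriples k := fun h => hr h.2
        have m2 : (x, y, z) ∈ nonresTriples k := ⟨hT, hr⟩
        have e1 : fres (x, y, z) = 0 := Set.indicator_of_notMem m1 _
        have e2 : ∀ ζ, fnr ζ (x, y, z) = _ := fun ζ => Set.indicator_of_mem m2 _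
        have e : G (x, y, z) = if (n : ℤ) < |y| ∧ (n : ℤ) < |z| then 0 else
            osc (3 * res3 (x, y, z)) t / (x : ℂ) * (u x * u y * u z) := by
          simp only [hG, coR3, h0, withUnit_zero,
            withUnit_of_ne u hx, withUnit_of_ne u hy, withUnit_of_ne u hz, hr, hs]
          by_cases h : (n : ℤ) < |y| ∧ (n : ℤ) < |z|
          · simp [h]
          · rw [if_neg h, if_pos ⟨trivial, hk, hy, hz, hyz, Or.inr h⟩, Pi.one_apply]
            ring
        refine ⟨?_, by simp [e1], fun ζ hζ => ?_⟩
        · simp only [e1, e2, e, ← Finset.mul_sum, Z, zero_add]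
          rw [sum_signs (fun b => projSign n b u x) (fun b => projSign n b u y)
            (fun b => projSign n b u z)]
          simp only [sum_projSign]
          by_cases h : (n : ℤ) < |y| ∧ (n : ℤ) < |z|
          · simp [h, projSign_apply]
          · rw [if_neg h]
            have : projSign n false u y * projSign n false u z = 0 := by
              rw [projSign_apply, projSign_apply, mul_eq_zero]
              rcases not_and_or.1 h with h | h
              · left; simpa using fun h' => absurd h' h
              · right; simpa using fun h' => absurd h' h
            rw [this]; ring
        · rw [e2, e]
          by_cases h : (n : ℤ) < |y| ∧ (n : ℤ) < |z|
          · have : projSign n ζ.2.1 u y * projSign n ζ.2.2 u z = 0 := by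
              rw [projSign_apply, projSign_apply, mul_eq_zero]
              have h1 := (Finset.mem_filter.1 hζ).2
              obtain ⟨a, b, c⟩ := ζ
              cases b <;> cases c <;> simp_all
            simp only [mul_assoc, this]
            simp
          · rw [if_neg h, norm_mul, norm_mul (osc _ _ / _), norm_mul, norm_mul, norm_mul (u x * u y),
              norm_mul (u x)]
            gcongr <;> exact norm_projSign_le _ _ _ _
    · have m1 : (x, y, z) ∉ resTriples k := fun h => hT h.1
      have m2 : (x, y, z) ∉ nonresTriples k := fun h => hT h.1
      have e1 : fres (x, y, z) = 0 := Set.indicator_of_notMem m1 _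
      have e2 : ∀ ζ, fnr ζ (x, y, z) = 0 := fun ζ => Set.indicator_of_notMem m2 _
      have e : G (x, y, z) = 0 := by
        simp only [hG, coR3]
        by_cases hx : x = 0
        · simp [hx]
        · rw [if_neg, zero_mul]
          rintro ⟨h0, h1, h2, h3, h4, -⟩
          exact hT ⟨hx, h2, h3, h4, by simp only; omega⟩
      simp [e, e1, e2]
  have s1 : Summable fres := Summable.of_norm_bounded hsum.norm fun q => (key q).2.1
  have s2 : ∀ ζ ∈ Z, Summable (fnr ζ) := fun ζ hζ =>
    Summable.of_norm_bounded hsum.norm fun q => (key q).2.2 ζ hζ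
  have h1 : R3res u u u k = ∑' q, fres q :=
    tsum_subtype (resTriples k) fun p : ℤ × ℤ × ℤ => u p.1 * u p.2.1 * u p.2.2 / (p.1 : ℂ)
  have h2 : R3nres1 n t u u u k = ∑' q, ∑ ζ ∈ Z, fnr ζ q := by
    rw [Summable.tsum_finsetSum s2]
    exact Finset.sum_congr rfl fun ζ _ => tsum_subtype (nonresTriples k)
      fun p : ℤ × ℤ × ℤ => osc (3 * res3 p) t / (p.1 : ℂ) * (projSign n ζ.1 u p.1 *
        projSign n ζ.2.1 u p.2.1 * projSign n ζ.2.2 u p.2.2)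
  rw [h1, h2, ← s1.tsum_add (summable_sum s2)]
  exact tsum_congr fun q => (key q).1

/-- A bound for the form with coefficients `coRhs`. -/
noncomputable def rhsConst (n : ℕ) : ℝ≥0∞ :=
  2 * l2 recip + 2 * (l2 recip * l2 (lowInd n)) +
    ‖(-1 / 3 : ℂ)‖ₑ * (‖(1 / 2 : ℂ)‖ₑ * (l2 recip * l2 recip * l2 recip) +
      2 * (l2 recip * l2 recip * l2 recip))

theorem rhsConst_ne_top (n : ℕ) : rhsConst n ≠ ⊤ := by
  have := l2_recip_ne_top
  have := l2_lowInd_ne_top n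
  unfold rhsConst
  finiteness

theorem coRhs_bound {χ : ℤ → ℂ} (hχ : ∀ m, ‖χ m‖ ≤ 1) (n : ℕ) (t : ℝ) :
    CoeffBound (coRhs χ n t) (rhsConst n) :=
  (coR3_bound hχ n t).add ((((coB401_bound hχ n t).const_mul _).add
    (coB402_bound hχ n t)).const_mul _)

theorem quadForm_coRhs {k : ℤ} (hk : k ≠ 0) (n : ℕ) (t : ℝ) {u : ℤ → ℂ} (hu : l2 u ≠ ⊤) :
    quadForm (coRhs 1 n t) (withUnit u) (withUnit u) (withUnit u) (withUnit u) k =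
      rhs n t u k := by
  have hu' := l2_withUnit_ne_top hu
  have h1 := coB401_bound one_multiplier n t
  have h2 := coB402_bound one_multiplier n t
  have h3 := h1.const_mul (1 / 2)
  have hH := l2_recip_ne_top
  have hc := coR3_const_ne_top n
  unfold coRhs
  rw [(coR3_bound one_multiplier n t).quadForm_add_coeff (coR3_const_ne_top n)
    ((h3.add h2).const_mul (-1 / 3)) (by finiteness) hu' hu' hu' hu', quadForm_const_mul_coeff,
    h3.quadForm_add_coeff (by finiteness) h2 (by finiteness) hu' hu' hu' hu',
    quadForm_const_mul_coeff, quadForm_coR3 hk n t hu, quadForm_coB401 hk, quadForm_coB402 hk, rhs,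
    B40]
  ring

/-- A nonzero output frequency is at least 1 in modulus, so a smoothing bound is in particular a
plain bound once outputs at 0 carry no coefficient. -/
theorem coeff_of_smoothing {c : ℤ → ℤ → ℤ → ℤ → ℂ} {C : ℝ≥0∞}
    (h : KernelBound (fun x y z w => ‖((x + y + z + w : ℤ) : ℂ)‖ₑ * ‖c x y z w‖ₑ) C)
    (h0 : ∀ x y z w, x + y + z + w = 0 → c x y z w = 0) : CoeffBound c C := by
  refine h.mono fun x y z w => ?_
  by_cases hs : x + y + z + w = 0
  · simp [h0 x y z w hs]
  · have : (1 : ℝ≥0∞) ≤ ‖((x + y + z + w : ℤ) : ℂ)‖ₑ := by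
      have h1 : ‖(1 : ℂ)‖ₑ ≤ ‖((x + y + z + w : ℤ) : ℂ)‖ₑ := by
        rw [enorm_le_iff_norm_le, norm_one, Complex.norm_intCast]
        exact_mod_cast Int.one_le_abs hs
      simpa using h1
    exact le_mul_of_one_le_left zero_le this

theorem coB2_zero_sum (t : ℝ) (x y z w : ℤ) (h : x + y + z + w = 0) : coB2 t x y z w = 0 := by
  rw [coB2, if_neg]; rintro ⟨rfl, rfl, h'⟩; omega

theorem coB30_zero_sum (χ : ℤ → ℂ) (n : ℕ) (t : ℝ) (x y z w : ℤ) (h : x + y + z + w = 0) :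
    coB30 χ n t x y z w = 0 := by
  rw [coB30, if_neg]; rintro ⟨rfl, h', -⟩; omega

theorem coB2_bound (t : ℝ) : CoeffBound (coB2 t) (2 * l2 recip) :=
  coeff_of_smoothing (coB2_smoothing t) (coB2_zero_sum t)

/-- A bound for the smoothing form with coefficients `coLhs`. -/
noncomputable def lhsConst : ℝ≥0∞ :=
  ‖(-1 / 6 : ℂ)‖ₑ * (2 * l2 recip) + ‖(1 / 18 : ℂ)‖ₑ * (2 * (l2 recip * l2 recip))

theorem lhsConst_ne_top : lhsConst ≠ ⊤ := by
  have := l2_recip_ne_top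
  unfold lhsConst
  finiteness

theorem coLhs_smoothing {χ : ℤ → ℂ} (hχ : ∀ m, ‖χ m‖ ≤ 1) (n : ℕ) (t : ℝ) :
    KernelBound (fun x y z w => ‖((x + y + z + w : ℤ) : ℂ)‖ₑ * ‖coLhs χ n t x y z w‖ₑ)
      lhsConst := by
  refine (((coB2_smoothing t).const_mul ‖(-1 / 6 : ℂ)‖ₑ).add
    ((coB30_smoothing hχ n t).const_mul ‖(1 / 18 : ℂ)‖ₑ)).mono fun x y z w => ?_
  rw [coLhs]
  calc _ ≤ ‖((x + y + z + w : ℤ) : ℂ)‖ₑ * (‖(-1 / 6) * coB2 t x y z w‖ₑ +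
        ‖1 / 18 * coB30 χ n t x y z w‖ₑ) := by gcongr; exact enorm_add_le _ _
    _ = _ := by rw [enorm_mul, enorm_mul]; ring

theorem quadForm_coLhs {k : ℤ} (hk : k ≠ 0) (n : ℕ) (t : ℝ) {u : ℤ → ℂ} (hu : l2 u ≠ ⊤) :
    u k + quadForm (coLhs 1 n t) (withUnit u) (withUnit u) (withUnit u) (withUnit u) k =
      lhs n t u k := by
  have hu' := l2_withUnit_ne_top hu
  have hH := l2_recip_ne_top
  have h1 := (coB2_bound t).const_mul (-1 / 6)
  have h2 := (coeff_of_smoothing (coB30_smoothing one_multiplier n t)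
    (coB30_zero_sum 1 n t)).const_mul (1 / 18)
  unfold coLhs
  rw [h1.quadForm_add_coeff (by finiteness) h2 (by finiteness) hu' hu' hu' hu',
    quadForm_const_mul_coeff, quadForm_const_mul_coeff, quadForm_coB2_withUnit hk,
    quadForm_coB30 hk, lhs]
  ring

/-! ### Galerkin truncations and differentiation by parts -/

/-- The modes `|k| ≤ N`. -/
noncomputable def modes (N : ℕ) : Finset ℤ := Finset.Icc (-(N : ℤ)) N

theorem mem_modes {N : ℕ} {k : ℤ} : k ∈ modes N ↔ |k| ≤ (N : ℤ) := by
  simp [modes, abs_le]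

/-- The indicator of the modes `|k| ≤ N` as a multiplier. -/
noncomputable def cutoff (N : ℕ) (k : ℤ) : ℂ := if |k| ≤ (N : ℤ) then 1 else 0

theorem norm_cutoff_le (N : ℕ) (k : ℤ) : ‖cutoff N k‖ ≤ 1 := by
  unfold cutoff; split_ifs <;> simp

/-- `u` has mean value zero and no modes beyond `N`. -/
def SuppModes (N : ℕ) (u : ℤ → ℂ) : Prop := u 0 = 0 ∧ ∀ k, k ∉ modes N → u k = 0

/-- The right-hand side of the Galerkin system. -/
noncomputable def galerkin (N : ℕ) (t : ℝ) (u : ℤ → ℂ) (k : ℤ) : ℂ :=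
  Complex.I * k / 2 * cutoff N k * ∑ a ∈ modes N, ∑ b ∈ modes N,
    if a + b = k then osc (3 * k * a * b) t * (u a * u b) else 0

theorem l2_ne_top_of_suppModes {N : ℕ} {u : ℤ → ℂ} (hu : SuppModes N u) : l2 u ≠ ⊤ := by
  have h : l2 u ^ 2 ≠ ⊤ := by
    rw [l2_sq, tsum_eq_sum (s := modes N)]
    · exact ENNReal.sum_ne_top.2 fun m _ => by finiteness
    · intro m hm; simp [hu.2 m hm]
  intro h1
  exact h (by rw [h1]; rfl)

section FiniteSums

variable {N : ℕ} {u : ℤ → ℂ} {k : ℤ}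

theorem zero_mem_modes (N : ℕ) : (0 : ℤ) ∈ modes N := by simp [mem_modes]

theorem withUnit_eq_zero (hu : SuppModes N u) {x : ℤ} (hx : x ∉ modes N) : withUnit u x = 0 := by
  rw [withUnit_of_ne, hu.2 x hx]
  rintro rfl
  exact hx (zero_mem_modes N)

/-- For truncated u the series are finite sums, so differentiation and rearrangement raise no
convergence questions. -/
theorem quadForm_eq_sum (hu : SuppModes N u) (c : ℤ → ℤ → ℤ → ℤ → ℂ) :
    quadForm c (withUnit u) (withUnit u) (withUnit u) (withUnit u) k =
      ∑ x ∈ modes N, ∑ y ∈ modes N, ∑ z ∈ modes N, c x y z (k - x - y - z) *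
        (withUnit u x * withUnit u y * withUnit u z * withUnit u (k - x - y - z)) := by
  unfold quadForm
  rw [tsum_eq_sum (s := modes N ×ˢ modes N ×ˢ modes N)]
  · simp only [Finset.sum_product]
  · rintro ⟨x, y, z⟩ hq
    simp only [Finset.mem_product, not_and_or] at hq
    rcases hq with h | h | h <;> simp [withUnit_eq_zero hu h]

theorem quadForm_eq_sum_two (hu : SuppModes N u) {c : ℤ → ℤ → ℤ → ℤ → ℂ}
    (hc : ∀ x y z w, c x y z w ≠ 0 → z = 0 ∧ w = 0 ∧ x ≠ 0 ∧ y ≠ 0) :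
    quadForm c (withUnit u) (withUnit u) (withUnit u) (withUnit u) k =
      ∑ x ∈ modes N, ∑ y ∈ modes N, if x + y = k then c x y 0 0 * (u x * u y) else 0 := by
  rw [quadForm_eq_sum hu]
  refine Finset.sum_congr rfl fun x _ => Finset.sum_congr rfl fun y _ => ?_
  rw [Finset.sum_eq_single 0]
  · split_ifs with h
    · rw [show k - x - y - 0 = 0 by omega]
      by_cases h0 : c x y 0 0 = 0
      · simp [h0]
      · obtain ⟨-, -, h1, h2⟩ := hc _ _ _ _ h0
        simp [withUnit_zero, withUnit_of_ne u h1, withUnit_of_ne u h2]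
    · have : c x y 0 (k - x - y - 0) = 0 := by
        by_contra h0
        have := hc _ _ _ _ h0
        omega
      rw [this, zero_mul]
  · intro z _ hz
    have : c x y z (k - x - y - z) = 0 := by
      by_contra h0
      exact hz (hc _ _ _ _ h0).1
    simp [this]
  · intro h; exact absurd (zero_mem_modes N) h

theorem quadForm_eq_sum_three (hu : SuppModes N u) {c : ℤ → ℤ → ℤ → ℤ → ℂ}
    (hc : ∀ x y z w, c x y z w ≠ 0 → w = 0 ∧ x ≠ 0 ∧ y ≠ 0 ∧ z ≠ 0) :
    quadForm c (withUnit u) (withUnit u) (withUnit u) (withUnit u) k =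
      ∑ x ∈ modes N, ∑ y ∈ modes N, ∑ z ∈ modes N,
        if x + y + z = k then c x y z 0 * (u x * u y * u z) else 0 := by
  rw [quadForm_eq_sum hu]
  refine Finset.sum_congr rfl fun x _ => Finset.sum_congr rfl fun y _ =>
    Finset.sum_congr rfl fun z _ => ?_
  split_ifs with h
  · rw [show k - x - y - z = 0 by omega]
    by_cases h0 : c x y z 0 = 0
    · simp [h0]
    · obtain ⟨-, h1, h2, h3⟩ := hc _ _ _ _ h0
      simp [withUnit_zero, withUnit_of_ne u h1, withUnit_of_ne u h2, withUnit_of_ne u h3]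
  · have : c x y z (k - x - y - z) = 0 := by
      by_contra h0
      have := hc _ _ _ _ h0
      omega
    simp [this]

theorem quadForm_eq_sum_four (hu : SuppModes N u) {c : ℤ → ℤ → ℤ → ℤ → ℂ}
    (hc : ∀ x y z w, c x y z w ≠ 0 → x ≠ 0 ∧ y ≠ 0 ∧ z ≠ 0 ∧ w ≠ 0) :
    quadForm c (withUnit u) (withUnit u) (withUnit u) (withUnit u) k =
      ∑ x ∈ modes N, ∑ y ∈ modes N, ∑ z ∈ modes N, ∑ w ∈ modes N,
        if x + y + z + w = k then c x y z w * (u x * u y * u z * u w) else 0 := by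
  rw [quadForm_eq_sum hu]
  refine Finset.sum_congr rfl fun x _ => Finset.sum_congr rfl fun y _ =>
    Finset.sum_congr rfl fun z _ => ?_
  rw [Finset.sum_congr rfl fun w _ => if_congr (show x + y + z + w = k ↔ k - x - y - z = w by omega)
    rfl rfl, Finset.sum_ite_eq]
  split_ifs with h
  · by_cases h0 : c x y z (k - x - y - z) = 0
    · simp [h0]
    · obtain ⟨h1, h2, h3, h4⟩ := hc _ _ _ _ h0
      simp [withUnit_of_ne u h1, withUnit_of_ne u h2, withUnit_of_ne u h3, withUnit_of_ne u h4]
  · simp [withUnit_eq_zero hu h]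

/-- Inserting the equation for an inner frequency b collapses the sum over b to b = c + d. The
truncation survives as the multiplier `cutoff N (c + d)`, which is why the coefficients carry a
general χ. -/
theorem sum_mul_galerkin (t : ℝ) (Y : ℤ → ℂ) :
    ∑ b ∈ modes N, Y b * galerkin N t u b =
      ∑ c ∈ modes N, ∑ d ∈ modes N, Y (c + d) * (Complex.I * ((c + d : ℤ) : ℂ) / 2 *
        cutoff N (c + d)) * (osc (3 * (c + d) * c * d) t * (u c * u d)) := by
  have h1 : ∀ b ∈ modes N, Y b * galerkin N t u b = ∑ c ∈ modes N, ∑ d ∈ modes N,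
      if c + d = b then Y b * (Complex.I * (b : ℂ) / 2 * cutoff N b) *
        (osc (3 * b * c * d) t * (u c * u d)) else 0 := by
    intro b _
    rw [galerkin, ← mul_assoc, Finset.mul_sum]
    refine Finset.sum_congr rfl fun c _ => ?_
    rw [Finset.mul_sum]
    refine Finset.sum_congr rfl fun d _ => ?_
    rw [mul_ite, mul_zero]
  rw [Finset.sum_congr rfl h1, Finset.sum_comm]
  refine Finset.sum_congr rfl fun c _ => ?_
  rw [Finset.sum_comm]
  refine Finset.sum_congr rfl fun d _ => ?_
  rw [Finset.sum_ite_eq]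
  split_ifs with h
  · rfl
  · have : cutoff N (c + d) = 0 := if_neg fun h' => h (mem_modes.2 h')
    simp [this]

end FiniteSums

/-! ### Differentiation by parts for solutions of the Galerkin system -/

section Derivation

variable {N : ℕ} {v : ℝ → ℤ → ℂ} {t : ℝ} {k : ℤ}

/-- The full cubic coefficient of the second form, with the inner cutoff. -/
noncomputable def coCubic (N : ℕ) (t : ℝ) (x y z : ℤ) : ℂ :=
  if y + z ≠ 0 then cutoff N (y + z) * osc (3 * res3 (x, y, z)) t * (x : ℂ)⁻¹ else 0

/-- The non-resonant cubic coefficient with both inner modes high. -/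
noncomputable def coHigh (N n : ℕ) (t : ℝ) (x y z : ℤ) : ℂ :=
  if res3 (x, y, z) ≠ 0 ∧ (n : ℤ) < |y| ∧ (n : ℤ) < |z| then
    cutoff N (y + z) * osc (3 * res3 (x, y, z)) t * (x : ℂ)⁻¹ else 0

theorem coB2_support {t : ℝ} {x y z w : ℤ} (h : coB2 t x y z w ≠ 0) :
    z = 0 ∧ w = 0 ∧ x ≠ 0 ∧ y ≠ 0 := by
  simp only [coB2, ne_eq, ite_eq_right_iff, not_forall, mul_eq_zero, not_or, inv_eq_zero,
    Int.cast_eq_zero] at h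
  tauto

theorem coB30_support {χ : ℤ → ℂ} {n : ℕ} {t : ℝ} {x y z w : ℤ} (h : coB30 χ n t x y z w ≠ 0) :
    w = 0 ∧ x ≠ 0 ∧ y ≠ 0 ∧ z ≠ 0 := by
  simp only [coB30, ne_eq, ite_eq_right_iff, not_forall, mul_eq_zero, not_or, inv_eq_zero,
    Int.cast_eq_zero] at h
  obtain ⟨⟨h0, h1, h2, h3⟩, h4, h5, h6⟩ := h
  refine ⟨h0, h5, ?_, ?_⟩
  · rintro rfl; simp at h2; omega
  · rintro rfl; simp at h3; omega

theorem coR3_support {χ : ℤ → ℂ} {n : ℕ} {t : ℝ} {x y z w : ℤ} (h : coR3 χ n t x y z w ≠ 0) :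
    w = 0 ∧ x ≠ 0 ∧ y ≠ 0 ∧ z ≠ 0 := by
  simp only [coR3, ne_eq, ite_eq_right_iff, not_forall, mul_eq_zero, not_or, inv_eq_zero,
    Int.cast_eq_zero] at h
  tauto

theorem coB401_support {χ : ℤ → ℂ} {n : ℕ} {t : ℝ} {x y z w : ℤ}
    (h : coB401 χ n t x y z w ≠ 0) : x ≠ 0 ∧ y ≠ 0 ∧ z ≠ 0 ∧ w ≠ 0 := by
  simp only [coB401, ne_eq, ite_eq_right_iff, not_forall] at h
  obtain ⟨⟨h0, h1, h2, h3, h4, h5⟩, -⟩ := h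
  refine ⟨?_, ?_, h1, h2⟩
  · rintro rfl; simp at h4; omega
  · rintro rfl; simp at h5; omega

theorem coB402_support {χ : ℤ → ℂ} {n : ℕ} {t : ℝ} {x y z w : ℤ}
    (h : coB402 χ n t x y z w ≠ 0) : x ≠ 0 ∧ y ≠ 0 ∧ z ≠ 0 ∧ w ≠ 0 := by
  simp only [coB402, ne_eq, ite_eq_right_iff, not_forall, mul_eq_zero, not_or, inv_eq_zero,
    Int.cast_eq_zero] at h
  obtain ⟨⟨h0, h1, h2, h3, h4⟩, h5, h6, h7, h8⟩ := h
  refine ⟨h7, ?_, h1, h2⟩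
  rintro rfl; simp at h4; omega

/-- Differentiation by parts of the quadratic nonlinearity. -/
theorem hasDerivAt_first (hv : ∀ τ, SuppModes N (v τ))
    (hd : ∀ k, HasDerivAt (fun τ => v τ k) (galerkin N t (v t) k) t) (hk : k ≠ 0)
    (hkN : k ∈ modes N) :
    HasDerivAt (fun τ => quadForm (coB2 τ) (withUnit (v τ)) (withUnit (v τ)) (withUnit (v τ))
        (withUnit (v τ)) k)
      (6 * galerkin N t (v t) k + Complex.I * ∑ x ∈ modes N, ∑ y ∈ modes N, ∑ z ∈ modes N,
        if x + y + z = k then coCubic N t x y z * (v t x * v t y * v t z) else 0) t := by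
  have h1 : (fun τ => quadForm (coB2 τ) (withUnit (v τ)) (withUnit (v τ)) (withUnit (v τ))
        (withUnit (v τ)) k) = fun τ => ∑ x ∈ modes N, ∑ y ∈ modes N,
          if x + y = k then osc (3 * k * x * y) τ * ((x : ℂ)⁻¹ * (y : ℂ)⁻¹) *
            (v τ x * v τ y) else 0 := by
    ext τ
    rw [quadForm_eq_sum_two (hv τ) fun x y z w => coB2_support]
    refine Finset.sum_congr rfl fun x _ => Finset.sum_congr rfl fun y _ => ?_
    split_ifs with h
    · rw [coB2, if_pos ⟨rfl, rfl, by rwa [h]⟩, h]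
    · rfl
  rw [h1]
  set g := galerkin N t (v t) with hg
  set A : ℤ → ℤ → ℂ := fun x y => osc (3 * k * x * y) t * ((x : ℂ)⁻¹ * (y : ℂ)⁻¹) with hA
  have h2 : HasDerivAt (fun τ => ∑ x ∈ modes N, ∑ y ∈ modes N,
          if x + y = k then osc (3 * k * x * y) τ * ((x : ℂ)⁻¹ * (y : ℂ)⁻¹) *
            (v τ x * v τ y) else 0) (∑ x ∈ modes N, ∑ y ∈ modes N,
          if x + y = k then (Complex.I * ((3 * k * x * y : ℤ) : ℂ) * A x y * (v t x * v t y) +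
            A x y * (g x * v t y + v t x * g y)) else 0) t := by
    refine HasDerivAt.fun_sum fun x _ => HasDerivAt.fun_sum fun y _ => ?_
    split_ifs with h
    · refine (((hasDerivAt_osc (3 * k * x * y) t).mul_const
        ((x : ℂ)⁻¹ * (y : ℂ)⁻¹)).fun_mul ((hd x).fun_mul (hd y))).congr_deriv ?_
      simp only [hA]; ring
    · exact hasDerivAt_const _ _
  refine h2.congr_deriv ?_
  have h3 : ∑ x ∈ modes N, ∑ y ∈ modes N, (if x + y = k then
      (Complex.I * ((3 * k * x * y : ℤ) : ℂ) * A x y * (v t x * v t y) +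
            A x y * (g x * v t y + v t x * g y)) else 0) =
      (∑ x ∈ modes N, ∑ y ∈ modes N, (if x + y = k then
        Complex.I * ((3 * k * x * y : ℤ) : ℂ) * A x y * (v t x * v t y) else 0)) +
      ((∑ x ∈ modes N, ∑ y ∈ modes N, (if x + y = k then A x y * (g x * v t y) else 0)) +
      ∑ x ∈ modes N, ∑ y ∈ modes N, (if x + y = k then A x y * (v t x * g y) else 0)) := by
    simp only [← Finset.sum_add_distrib]
    refine Finset.sum_congr rfl fun x _ => Finset.sum_congr rfl fun y _ => ?_
    split_ifs <;> ring
  -- The derivative of the phase supplies 3ik·xy, which cancels the denominators and leaves 3ik =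
  -- 6·(ik/2): six times the nonlinearity.
  have h4 : ∑ x ∈ modes N, ∑ y ∈ modes N, (if x + y = k then
        Complex.I * ((3 * k * x * y : ℤ) : ℂ) * A x y * (v t x * v t y) else 0) = 6 * g k := by
    rw [hg, galerkin, cutoff, if_pos (mem_modes.1 hkN), ← mul_assoc, Finset.mul_sum]
    refine Finset.sum_congr rfl fun x _ => ?_
    rw [Finset.mul_sum]
    refine Finset.sum_congr rfl fun y _ => ?_
    split_ifs with h
    · rcases eq_or_ne x 0 with rfl | hx
      · simp [(hv t).1]
      rcases eq_or_ne y 0 with rfl | hy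
      · simp [(hv t).1]
      have hx' : (x : ℂ) ≠ 0 := by exact_mod_cast hx
      have hy' : (y : ℂ) ≠ 0 := by exact_mod_cast hy
      simp only [hA]; push_cast; field_simp; ring
    · simp
  have h5 : ∑ x ∈ modes N, ∑ y ∈ modes N, (if x + y = k then A x y * (g x * v t y) else 0) =
      ∑ x ∈ modes N, ∑ y ∈ modes N, (if x + y = k then A x y * (v t x * g y) else 0) := by
    rw [Finset.sum_comm]
    refine Finset.sum_congr rfl fun x _ => Finset.sum_congr rfl fun y _ => ?_
    rw [add_comm x y]
    refine if_congr Iff.rfl ?_ rfl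
    simp only [hA, show 3 * k * y * x = 3 * k * x * y by ring]
    ring
  -- Inserting the equation at y = c + d cancels the denominator y. The phases combine because x(x +
  -- c + d) + cd = (x + c)(x + d).
  have h6 : ∑ x ∈ modes N, ∑ y ∈ modes N, (if x + y = k then A x y * (v t x * g y) else 0) =
      Complex.I / 2 * ∑ x ∈ modes N, ∑ y ∈ modes N, ∑ z ∈ modes N,
        if x + y + z = k then coCubic N t x y z * (v t x * v t y * v t z) else 0 := by
    rw [Finset.mul_sum]
    refine Finset.sum_congr rfl fun x _ => ?_
    have h7 : ∀ y ∈ modes N, (if x + y = k then A x y * (v t x * g y) else 0) =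
        (if x + y = k then A x y * v t x else 0) * g y := fun y _ => by
      split_ifs <;> ring
    rw [Finset.sum_congr rfl h7, hg,
      sum_mul_galerkin t (fun y => if x + y = k then A x y * v t x else 0), Finset.mul_sum]
    refine Finset.sum_congr rfl fun c _ => ?_
    rw [Finset.mul_sum]
    refine Finset.sum_congr rfl fun d _ => ?_
    rw [← add_assoc]
    split_ifs with h
    · rw [coCubic]
      split_ifs with h8
      · have h9 : ((c + d : ℤ) : ℂ) ≠ 0 := by exact_mod_cast h8
        have h10 : osc (3 * res3 (x, c, d)) t =
            osc (3 * k * x * (c + d)) t * osc (3 * (c + d) * c * d) t := by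
          rw [← osc_add, ← h]; congr 1; simp only [res3]; ring
        rw [h10]
        simp only [hA]
        field_simp
      · rw [not_not] at h8
        simp [h8]
    · simp
  rw [h3, h4, h5, h6]
  ring

/-- Differentiation by parts of the high-high non-resonant part. -/
theorem hasDerivAt_second (n : ℕ) (hv : ∀ τ, SuppModes N (v τ))
    (hd : ∀ k, HasDerivAt (fun τ => v τ k) (galerkin N t (v t) k) t) (hk : k ≠ 0) :
    HasDerivAt (fun τ => quadForm (coB30 (cutoff N) n τ) (withUnit (v τ)) (withUnit (v τ))
        (withUnit (v τ)) (withUnit (v τ)) k)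
      (3 * Complex.I * (∑ x ∈ modes N, ∑ y ∈ modes N, ∑ z ∈ modes N,
        if x + y + z = k then coHigh N n t x y z * (v t x * v t y * v t z) else 0) +
        (Complex.I / 2 * quadForm (coB401 (cutoff N) n t) (withUnit (v t)) (withUnit (v t))
          (withUnit (v t)) (withUnit (v t)) k +
        Complex.I * quadForm (coB402 (cutoff N) n t) (withUnit (v t)) (withUnit (v t))
          (withUnit (v t)) (withUnit (v t)) k)) t := by
  set γ : ℤ → ℤ → ℤ → ℂ := fun x y z => if (n : ℤ) < |y| ∧ (n : ℤ) < |z| then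
    cutoff N (y + z) * ((x : ℂ)⁻¹ * (res3 (x, y, z) : ℂ)⁻¹) else 0 with hγ
  have h1 : (fun τ => quadForm (coB30 (cutoff N) n τ) (withUnit (v τ)) (withUnit (v τ))
        (withUnit (v τ)) (withUnit (v τ)) k) = fun τ => ∑ x ∈ modes N, ∑ y ∈ modes N,
        ∑ z ∈ modes N, if x + y + z = k then γ x y z * osc (3 * res3 (x, y, z)) τ *
            (v τ x * v τ y * v τ z) else 0 := by
    ext τ
    rw [quadForm_eq_sum_three (hv τ) fun x y z w => coB30_support]
    refine Finset.sum_congr rfl fun x _ => Finset.sum_congr rfl fun y _ =>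
      Finset.sum_congr rfl fun z _ => ?_
    split_ifs with h
    · simp only [coB30, hγ]
      by_cases h' : (n : ℤ) < |y| ∧ (n : ℤ) < |z|
      · rw [if_pos ⟨trivial, by rwa [h], h'⟩, if_pos h']; ring
      · rw [if_neg fun h'' => h' h''.2.2, if_neg h', zero_mul, zero_mul, zero_mul]
    · rfl
  rw [h1]
  set g := galerkin N t (v t) with hg
  set A : ℤ → ℤ → ℤ → ℂ := fun x y z => γ x y z * osc (3 * res3 (x, y, z)) t with hA
  have h2 : HasDerivAt (fun τ => ∑ x ∈ modes N, ∑ y ∈ modes N,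
        ∑ z ∈ modes N, if x + y + z = k then γ x y z * osc (3 * res3 (x, y, z)) τ *
            (v τ x * v τ y * v τ z) else 0) (∑ x ∈ modes N, ∑ y ∈ modes N, ∑ z ∈ modes N,
          if x + y + z = k then (Complex.I * ((3 * res3 (x, y, z) : ℤ) : ℂ) * A x y z *
            (v t x * v t y * v t z) +
            A x y z * ((g x * v t y + v t x * g y) * v t z + v t x * v t y * g z)) else 0) t := by
    refine HasDerivAt.fun_sum fun x _ => HasDerivAt.fun_sum fun y _ =>
      HasDerivAt.fun_sum fun z _ => ?_
    split_ifs with h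
    · refine (((hasDerivAt_osc (3 * res3 (x, y, z)) t).const_mul (γ x y z)).fun_mul
        (((hd x).fun_mul (hd y)).fun_mul (hd z))).congr_deriv ?_
      simp only [hA]; ring
    · exact hasDerivAt_const _ _
  refine h2.congr_deriv ?_
  have h3 : ∑ x ∈ modes N, ∑ y ∈ modes N, ∑ z ∈ modes N, (if x + y + z = k then
      (Complex.I * ((3 * res3 (x, y, z) : ℤ) : ℂ) * A x y z * (v t x * v t y * v t z) +
            A x y z * ((g x * v t y + v t x * g y) * v t z + v t x * v t y * g z)) else 0) =
      (∑ x ∈ modes N, ∑ y ∈ modes N, ∑ z ∈ modes N, (if x + y + z = k then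
        Complex.I * ((3 * res3 (x, y, z) : ℤ) : ℂ) * A x y z * (v t x * v t y * v t z) else 0)) +
      ((∑ x ∈ modes N, ∑ y ∈ modes N, ∑ z ∈ modes N,
        (if x + y + z = k then A x y z * (g x * v t y * v t z) else 0)) +
      ((∑ x ∈ modes N, ∑ y ∈ modes N, ∑ z ∈ modes N,
        (if x + y + z = k then A x y z * (v t x * g y * v t z) else 0)) +
      ∑ x ∈ modes N, ∑ y ∈ modes N, ∑ z ∈ modes N,
        (if x + y + z = k then A x y z * (v t x * v t y * g z) else 0))) := by
    simp only [← Finset.sum_add_distrib]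
    refine Finset.sum_congr rfl fun x _ => Finset.sum_congr rfl fun y _ =>
      Finset.sum_congr rfl fun z _ => ?_
    split_ifs <;> ring
  -- The phase derivative 3i·ρ cancels the denominator ρ and restores the non-resonant cubic term
  -- with both inner modes high.
  have h4 : ∑ x ∈ modes N, ∑ y ∈ modes N, ∑ z ∈ modes N, (if x + y + z = k then
        Complex.I * ((3 * res3 (x, y, z) : ℤ) : ℂ) * A x y z * (v t x * v t y * v t z) else 0) =
      3 * Complex.I * (∑ x ∈ modes N, ∑ y ∈ modes N, ∑ z ∈ modes N,
        if x + y + z = k then coHigh N n t x y z * (v t x * v t y * v t z) else 0) := by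
    simp only [Finset.mul_sum]
    refine Finset.sum_congr rfl fun x _ => Finset.sum_congr rfl fun y _ =>
      Finset.sum_congr rfl fun z _ => ?_
    split_ifs with h
    · simp only [hA, hγ, coHigh]
      by_cases h' : (n : ℤ) < |y| ∧ (n : ℤ) < |z|
      · by_cases h'' : res3 (x, y, z) = 0
        · simp [h'']
        · have : (res3 (x, y, z) : ℂ) ≠ 0 := by exact_mod_cast h''
          rw [if_pos h', if_pos ⟨h'', h'⟩]
          push_cast
          field_simp
      · rw [if_neg h', if_neg fun h'' => h' h''.2]; simp
    · simp
  have h5 : ∑ x ∈ modes N, ∑ y ∈ modes N, ∑ z ∈ modes N,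
        (if x + y + z = k then A x y z * (v t x * g y * v t z) else 0) =
      ∑ x ∈ modes N, ∑ y ∈ modes N, ∑ z ∈ modes N,
        (if x + y + z = k then A x y z * (v t x * v t y * g z) else 0) := by
    refine Finset.sum_congr rfl fun x _ => ?_
    rw [Finset.sum_comm]
    refine Finset.sum_congr rfl fun y _ => Finset.sum_congr rfl fun z _ => ?_
    rw [add_right_comm x z y]
    refine if_congr Iff.rfl ?_ rfl
    have : res3 (x, z, y) = res3 (x, y, z) := by simp only [res3]; ring
    simp only [hA, hγ, this, add_comm z y, and_comm]
    ring
  -- Inserting the equation at z = c + d leaves the factor c + d in the numerator and keeps the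
  -- condition that c + d is high. By the symmetry just shown the same contribution arises from y,
  -- which doubles the factor i/2.
  have h6 : ∑ x ∈ modes N, ∑ y ∈ modes N, ∑ z ∈ modes N,
        (if x + y + z = k then A x y z * (v t x * v t y * g z) else 0) =
      Complex.I / 2 * quadForm (coB402 (cutoff N) n t) (withUnit (v t)) (withUnit (v t))
          (withUnit (v t)) (withUnit (v t)) k := by
    rw [quadForm_eq_sum_four (hv t) fun x y z w => coB402_support, Finset.mul_sum]
    refine Finset.sum_congr rfl fun x _ => ?_
    rw [Finset.mul_sum]
    refine Finset.sum_congr rfl fun y _ => ?_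
    have h7 : ∀ z ∈ modes N, (if x + y + z = k then A x y z * (v t x * v t y * g z) else 0) =
        (if x + y + z = k then A x y z * (v t x * v t y) else 0) * g z := fun z _ => by
      split_ifs <;> ring
    rw [Finset.sum_congr rfl h7, hg, sum_mul_galerkin t
      (fun z => if x + y + z = k then A x y z * (v t x * v t y) else 0), Finset.mul_sum]
    refine Finset.sum_congr rfl fun c _ => ?_
    rw [Finset.mul_sum]
    refine Finset.sum_congr rfl fun d _ => ?_
    rw [← add_assoc]
    split_ifs with h
    · rcases eq_or_ne c 0 with rfl | hc
      · simp [(hv t).1]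
      rcases eq_or_ne d 0 with rfl | hd'
      · simp [(hv t).1]
      have h8 : osc (phase4 x y c d) t = osc (3 * res3 (x, y, c + d)) t *
          osc (3 * (c + d) * c * d) t := by
        rw [← osc_add]; congr 1; simp only [res3, phase4]; ring
      have h9 : sigma4 x y c d = res3 (x, y, c + d) := by simp only [sigma4, res3]; ring
      simp only [hA, hγ, coB402, h8, h9]
      by_cases h' : (n : ℤ) < |y| ∧ (n : ℤ) < |c + d|
      · rw [if_pos h', if_pos ⟨by rwa [h], hc, hd', h'.2, h'.1⟩, ← add_assoc]
        ring
      · rw [if_neg h', if_neg fun h'' => h' ⟨h''.2.2.2.2, h''.2.2.2.1⟩]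
        simp
    · simp
  -- Inserting the equation at x = c + d cancels 1/x, so only σ remains below; the two high modes
  -- become the first two arguments of B₄₀¹.
  have h7 : ∑ x ∈ modes N, ∑ y ∈ modes N, ∑ z ∈ modes N,
        (if x + y + z = k then A x y z * (g x * v t y * v t z) else 0) =
      Complex.I / 2 * quadForm (coB401 (cutoff N) n t) (withUnit (v t)) (withUnit (v t))
          (withUnit (v t)) (withUnit (v t)) k := by
    rw [quadForm_eq_sum_four (hv t) fun x y z w => coB401_support, Finset.sum_comm,
      Finset.mul_sum]
    refine Finset.sum_congr rfl fun y _ => ?_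
    rw [Finset.sum_comm, Finset.mul_sum]
    refine Finset.sum_congr rfl fun z _ => ?_
    have h7 : ∀ x ∈ modes N, (if x + y + z = k then A x y z * (g x * v t y * v t z) else 0) =
        (if x + y + z = k then A x y z * (v t y * v t z) else 0) * g x := fun z _ => by
      split_ifs <;> ring
    rw [Finset.sum_congr rfl h7, hg, sum_mul_galerkin t
      (fun x => if x + y + z = k then A x y z * (v t y * v t z) else 0), Finset.mul_sum]
    refine Finset.sum_congr rfl fun c _ => ?_
    rw [Finset.mul_sum]
    refine Finset.sum_congr rfl fun d _ => ?_
    rw [show c + d + y + z = y + z + c + d by ring]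
    split_ifs with h
    · rcases eq_or_ne c 0 with rfl | hc
      · simp [(hv t).1]
      rcases eq_or_ne d 0 with rfl | hd'
      · simp [(hv t).1]
      have h8 : osc (phase4 y z c d) t = osc (3 * res3 (c + d, y, z)) t *
          osc (3 * (c + d) * c * d) t := by
        rw [← osc_add]; congr 1; simp only [res3, phase4]; ring
      have h9 : sigma4 y z c d = res3 (c + d, y, z) := by simp only [sigma4, res3]; ring
      simp only [hA, hγ, coB401, h8, h9]
      by_cases h' : (n : ℤ) < |y| ∧ (n : ℤ) < |z|
      · by_cases hcd : c + d = 0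
        · simp [hcd]
        have hcd' : ((c + d : ℤ) : ℂ) ≠ 0 := by exact_mod_cast hcd
        rw [if_pos h', if_pos ⟨by rwa [h], hc, hd', hcd, h'⟩]
        field_simp
      · rw [if_neg h', if_neg fun h'' => h' h''.2.2.2.2]
        simp
    · simp
  rw [h3, h4, h5, h6, h7]
  ring

/-- The Galerkin solutions satisfy the truncated third form. -/
theorem hasDerivAt_third (n : ℕ) (hv : ∀ τ, SuppModes N (v τ))
    (hd : ∀ k, HasDerivAt (fun τ => v τ k) (galerkin N t (v t) k) t) (hk : k ≠ 0)
    (hkN : k ∈ modes N) :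
    HasDerivAt (fun τ => v τ k + quadForm (coLhs (cutoff N) n τ) (withUnit (v τ))
        (withUnit (v τ)) (withUnit (v τ)) (withUnit (v τ)) k)
      (-(Complex.I / 6) * quadForm (coRhs (cutoff N) n t) (withUnit (v t)) (withUnit (v t))
          (withUnit (v t)) (withUnit (v t)) k) t := by
  have hH := l2_recip_ne_top
  have hc := coR3_const_ne_top n
  have hl : ∀ τ, l2 (withUnit (v τ)) ≠ ⊤ := fun τ =>
    l2_withUnit_ne_top (l2_ne_top_of_suppModes (hv τ))
  have e1 : ∀ τ, quadForm (coLhs (cutoff N) n τ) (withUnit (v τ))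
        (withUnit (v τ)) (withUnit (v τ)) (withUnit (v τ)) k =
      (-1 / 6) * quadForm (coB2 τ) (withUnit (v τ))
        (withUnit (v τ)) (withUnit (v τ)) (withUnit (v τ)) k +
      1 / 18 * quadForm (coB30 (cutoff N) n τ) (withUnit (v τ))
        (withUnit (v τ)) (withUnit (v τ)) (withUnit (v τ)) k := by
    intro τ
    unfold coLhs
    rw [((coB2_bound τ).const_mul (-1 / 6)).quadForm_add_coeff (by finiteness)
      ((coeff_of_smoothing (coB30_smoothing (norm_cutoff_le N) n τ)
        (coB30_zero_sum (cutoff N) n τ)).const_mul (1 / 18)) (by finiteness)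
      (hl τ) (hl τ) (hl τ) (hl τ), quadForm_const_mul_coeff, quadForm_const_mul_coeff]
  have h1 := coB401_bound (norm_cutoff_le N) n t
  have h2 := coB402_bound (norm_cutoff_le N) n t
  have h3 := h1.const_mul (1 / 2)
  have e2 : quadForm (coRhs (cutoff N) n t) (withUnit (v t)) (withUnit (v t))
          (withUnit (v t)) (withUnit (v t)) k =
      quadForm (coR3 (cutoff N) n t) (withUnit (v t)) (withUnit (v t))
          (withUnit (v t)) (withUnit (v t)) k +
      (-1 / 3) * (1 / 2 * quadForm (coB401 (cutoff N) n t) (withUnit (v t)) (withUnit (v t))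
          (withUnit (v t)) (withUnit (v t)) k + quadForm (coB402 (cutoff N) n t)
          (withUnit (v t)) (withUnit (v t)) (withUnit (v t)) (withUnit (v t)) k) := by
    unfold coRhs
    rw [(coR3_bound (norm_cutoff_le N) n t).quadForm_add_coeff hc
      ((h3.add h2).const_mul (-1 / 3)) (by finiteness) (hl t) (hl t) (hl t) (hl t),
      quadForm_const_mul_coeff, h3.quadForm_add_coeff (by finiteness) h2 (by finiteness)
      (hl t) (hl t) (hl t) (hl t), quadForm_const_mul_coeff]
  -- The cubic term splits into the part kept on the right and the high-high part. The latter
  -- cancels in the final sum: -i/6 from B₂ against 3i/18 from B₃₀.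
  have e3 : (∑ x ∈ modes N, ∑ y ∈ modes N, ∑ z ∈ modes N,
        if x + y + z = k then coCubic N t x y z * (v t x * v t y * v t z) else 0) =
      quadForm (coR3 (cutoff N) n t) (withUnit (v t)) (withUnit (v t))
          (withUnit (v t)) (withUnit (v t)) k +
      ∑ x ∈ modes N, ∑ y ∈ modes N, ∑ z ∈ modes N,
        if x + y + z = k then coHigh N n t x y z * (v t x * v t y * v t z) else 0 := by
    rw [quadForm_eq_sum_three (hv t) fun x y z w => coR3_support]
    simp only [← Finset.sum_add_distrib]
    refine Finset.sum_congr rfl fun x _ => Finset.sum_congr rfl fun y _ =>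
      Finset.sum_congr rfl fun z _ => ?_
    split_ifs with h
    · rw [← add_mul]
      rcases eq_or_ne y 0 with rfl | hy
      · simp [(hv t).1]
      rcases eq_or_ne z 0 with rfl | hz
      · simp [(hv t).1]
      congr 1
      simp only [coCubic, coR3, coHigh]
      by_cases hyz : y + z = 0
      · have : res3 (x, y, z) = 0 := by simp [res3, hyz]
        simp [hyz, this]
      by_cases hr : res3 (x, y, z) = 0 <;> by_cases hh : (n : ℤ) < |y| ∧ (n : ℤ) < |z| <;>
        simp [hyz, hr, hh, hy, hz, h, hk]
    · simp
  simp only [e1, e2]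
  refine ((hd k).fun_add (((hasDerivAt_first hv hd hk hkN).const_mul (-1 / 6)).fun_add
    ((hasDerivAt_second n hv hd hk).const_mul (1 / 18)))).congr_deriv ?_
  rw [e3]
  ring

end Derivation

/-! ### Global solutions of the Galerkin system -/

section Galerkin

variable {N : ℕ}

/-- The positive modes up to `N`. -/
abbrev PosModes (N : ℕ) : Type := {k : ℤ // k ∈ Finset.Icc (1 : ℤ) N}

/-- The coefficient at `k` of the real function with given coefficients at the positive modes. -/
noncomputable def realExt (N : ℕ) (k : ℤ) : (PosModes N → ℂ) →L[ℝ] ℂ :=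
  if h : k ∈ Finset.Icc (1 : ℤ) N then
    (ContinuousLinearMap.proj (R := ℝ) (φ := fun _ : PosModes N => ℂ) ⟨k, h⟩)
  else if h : -k ∈ Finset.Icc (1 : ℤ) N then
    (Complex.conjCLE : ℂ →L[ℝ] ℂ) ∘L
      (ContinuousLinearMap.proj (R := ℝ) (φ := fun _ : PosModes N => ℂ) ⟨-k, h⟩)
  else 0

theorem realExt_pos (k : PosModes N) (x : PosModes N → ℂ) : realExt N k x = x k := by
  simp [realExt, k.2]

theorem realExt_neg (k : ℤ) (x : PosModes N → ℂ) :
    realExt N (-k) x = (starRingEnd ℂ) (realExt N k x) := by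
  unfold realExt
  by_cases h : k ∈ Finset.Icc (1 : ℤ) N
  · have h' : -k ∉ Finset.Icc (1 : ℤ) N := by simp at h ⊢; omega
    have h'' : - -k ∈ Finset.Icc (1 : ℤ) N := by simpa using h
    rw [dif_neg h', dif_pos h'', dif_pos h]
    simp
  · by_cases h' : -k ∈ Finset.Icc (1 : ℤ) N
    · rw [dif_pos h', dif_neg h, dif_pos h']
      simp
    · have h'' : - -k ∉ Finset.Icc (1 : ℤ) N := by simpa using h
      rw [dif_neg h', dif_neg h'', dif_neg h, dif_neg h']
      simp

theorem realExt_suppModes (x : PosModes N → ℂ) : SuppModes N fun k => realExt N k x := by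
  constructor
  · simp [realExt]
  · intro k hk
    rw [mem_modes, abs_le] at hk
    have h : k ∉ Finset.Icc (1 : ℤ) N := by simp; omega
    have h' : -k ∉ Finset.Icc (1 : ℤ) N := by simp; omega
    simp only [realExt, dif_neg h, dif_neg h']
    rfl

theorem sum_modes_neg (f : ℤ → ℂ) : ∑ k ∈ modes N, f (-k) = ∑ k ∈ modes N, f k :=
  Finset.sum_equiv (Equiv.neg ℤ) (fun k => by simp [mem_modes]) (fun k _ => rfl)

/-- The autonomous Galerkin vector field for the coefficients of the solution itself. -/
noncomputable def airyField (N : ℕ) (u : ℤ → ℂ) (k : ℤ) : ℂ :=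
  -(Complex.I * (k : ℂ) ^ 3) * u k + Complex.I * k / 2 *
    ∑ a ∈ modes N, ∑ b ∈ modes N, if a + b = k then u a * u b else 0

theorem airyField_neg {u : ℤ → ℂ} (hu : ∀ k, u (-k) = (starRingEnd ℂ) (u k)) (k : ℤ) :
    airyField N u (-k) = (starRingEnd ℂ) (airyField N u k) := by
  have h1 : ∑ a ∈ modes N, ∑ b ∈ modes N, (if a + b = -k then u a * u b else 0) =
      (starRingEnd ℂ) (∑ a ∈ modes N, ∑ b ∈ modes N, if a + b = k then u a * u b else 0) := by
    rw [← sum_modes_neg, map_sum]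
    refine Finset.sum_congr rfl fun a _ => ?_
    rw [← sum_modes_neg, map_sum]
    refine Finset.sum_congr rfl fun b _ => ?_
    rw [apply_ite (starRingEnd ℂ), map_mul, map_zero, hu, hu]
    exact if_congr (by omega) rfl rfl
  rw [airyField, airyField, h1, hu]
  simp only [map_add, map_mul, map_neg, map_div₀, map_pow, Complex.conj_I, map_intCast,
    Complex.conj_ofNat]
  push_cast
  ring

/-- The field respects conjugation and vanishes at the zero mode, so an equation for the positive
modes alone is an equation for all modes. -/
theorem realExt_airyField (x : PosModes N → ℂ) {k : ℤ} (hk : k ∈ modes N) :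
    realExt N k (fun j => airyField N (fun m => realExt N m x) j) =
      airyField N (fun m => realExt N m x) k := by
  by_cases h : k ∈ Finset.Icc (1 : ℤ) N
  · exact realExt_pos ⟨k, h⟩ _
  by_cases h' : -k ∈ Finset.Icc (1 : ℤ) N
  · have h1 := realExt_pos ⟨-k, h'⟩ (fun j : PosModes N => airyField N (fun m => realExt N m x) j)
    simp only at h1
    rw [realExt_neg, airyField_neg fun k => realExt_neg k x] at h1
    exact (starRingEnd ℂ).injective h1
  · have h0 : k = 0 := by
      rw [mem_modes, abs_le] at hk; simp at h h'; omega
    subst h0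
    have h1 := fun y => (realExt_suppModes (N := N) y).1
    simp only at h1
    rw [h1]
    simp [airyField]

/-- Conservation of the L₂ norm. The dispersive part is odd in k. The nonlinear part is a multiple
of the sum of c·u_a u_b u_c over a + b + c = 0; by symmetry it equals one third of the sum with c
replaced by a + b + c, hence vanishes. -/
theorem sum_airyField_mul {u : ℤ → ℂ} :
    ∑ k ∈ modes N, airyField N u k * u (-k) = 0 := by
  set f : ℤ → ℤ → ℤ → ℂ := fun a b c => if a + b + c = 0 then u a * u b * u c else 0 with hf
  have f1 : ∀ a b c, f a b c = f b a c := fun a b c => by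
    simp only [hf, add_comm a b, mul_comm (u a)]
  have f2 : ∀ a b c, f a b c = f c b a := fun a b c => by
    simp only [hf]; exact if_congr (by omega) (by ring) rfl
  set S := ∑ c ∈ modes N, ∑ a ∈ modes N, ∑ b ∈ modes N, (c : ℂ) * f a b c with hS
  have s1 : ∑ c ∈ modes N, ∑ a ∈ modes N, ∑ b ∈ modes N, (a : ℂ) * f a b c = S := by
    rw [hS, Finset.sum_comm]
    refine Finset.sum_congr rfl fun a _ => Finset.sum_congr rfl fun c _ =>
      Finset.sum_congr rfl fun b _ => ?_
    rw [f2 a b c]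
  have s2 : ∑ c ∈ modes N, ∑ a ∈ modes N, ∑ b ∈ modes N, (b : ℂ) * f a b c = S := by
    rw [← s1]
    refine Finset.sum_congr rfl fun c _ => ?_
    rw [Finset.sum_comm]
    refine Finset.sum_congr rfl fun a _ => Finset.sum_congr rfl fun b _ => ?_
    rw [f1]
  have s3 : S + S + S = 0 := by
    have : S + S + S = S + (∑ c ∈ modes N, ∑ a ∈ modes N, ∑ b ∈ modes N, (a : ℂ) * f a b c) +
        ∑ c ∈ modes N, ∑ a ∈ modes N, ∑ b ∈ modes N, (b : ℂ) * f a b c := by rw [s1, s2]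
    rw [this, hS]
    simp only [← Finset.sum_add_distrib]
    refine Finset.sum_eq_zero fun c _ => Finset.sum_eq_zero fun a _ =>
      Finset.sum_eq_zero fun b _ => ?_
    simp only [hf]
    split_ifs with h
    · have : (a : ℂ) + b + c = 0 := by exact_mod_cast h
      linear_combination (u a * u b * u c) * this
    · simp
  have s4 : S = 0 := by
    have : (3 : ℂ) * S = 0 := by rw [← s3]; ring
    simpa using this
  have e : ∑ k ∈ modes N, airyField N u k * u (-k) =
      -Complex.I * ∑ k ∈ modes N, (k : ℂ) ^ 3 * u k * u (-k) + -(Complex.I / 2) * S := by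
    rw [hS, ← sum_modes_neg (fun c => ∑ a ∈ modes N, ∑ b ∈ modes N, (c : ℂ) * f a b c),
      Finset.mul_sum, Finset.mul_sum, ← Finset.sum_add_distrib]
    refine Finset.sum_congr rfl fun k _ => ?_
    have : ∑ a ∈ modes N, ∑ b ∈ modes N, ((-k : ℤ) : ℂ) * f a b (-k) =
        -((k : ℂ) * u (-k) * ∑ a ∈ modes N, ∑ b ∈ modes N, if a + b = k then u a * u b else 0) := by
      simp only [Finset.mul_sum, ← Finset.sum_neg_distrib]
      refine Finset.sum_congr rfl fun a _ => Finset.sum_congr rfl fun b _ => ?_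
      simp only [hf]
      by_cases h : a + b = k
      · rw [if_pos h, if_pos (by omega)]; push_cast; ring
      · rw [if_neg h, if_neg (by omega)]; simp
    rw [this, airyField]
    ring
  have e2 : ∑ k ∈ modes N, (k : ℂ) ^ 3 * u k * u (-k) = 0 := by
    have h := sum_modes_neg (N := N) fun k => (k : ℂ) ^ 3 * u k * u (-k)
    have h' : ∑ k ∈ modes N, ((-k : ℤ) : ℂ) ^ 3 * u (-k) * u (- -k) =
        -∑ k ∈ modes N, (k : ℂ) ^ 3 * u k * u (-k) := by
      rw [← Finset.sum_neg_distrib]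
      refine Finset.sum_congr rfl fun k _ => ?_
      push_cast
      rw [neg_neg]
      ring
    rw [h'] at h
    exact CharZero.eq_neg_self_iff.1 h.symm
  rw [e, e2, s4]
  simp

theorem contDiff_airyField (N : ℕ) :
    ContDiff ℝ 1 fun (x : PosModes N → ℂ) (j : PosModes N) =>
      airyField N (fun m => realExt N m x) j := by
  rw [contDiff_pi]
  intro j
  unfold airyField
  refine ((realExt N j).contDiff.const_smul (-(Complex.I * ((j : ℤ) : ℂ) ^ 3))).add
    (ContDiff.mul contDiff_const (ContDiff.sum fun a _ => ContDiff.sum fun b _ => ?_))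
  split_ifs
  · exact (realExt N a).contDiff.mul (realExt N b).contDiff
  · exact contDiff_const

theorem enorm_sum_sq {u : ℤ → ℂ} (hs : SuppModes N u) (hu : ∀ k, u (-k) = (starRingEnd ℂ) (u k)) :
    l2 u ^ 2 = ‖∑ k ∈ modes N, u k * u (-k)‖ₑ := by
  have h1 : ∑ k ∈ modes N, u k * u (-k) = ((∑ k ∈ modes N, ‖u k‖ ^ 2 : ℝ) : ℂ) := by
    push_cast
    refine Finset.sum_congr rfl fun k _ => ?_
    rw [hu, Complex.mul_conj']
  rw [h1, l2_sq, tsum_eq_sum (s := modes N) fun m hm => by simp [hs.2 m hm], ← ofReal_norm,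
    Complex.norm_real, Real.norm_of_nonneg (by positivity),
    ENNReal.ofReal_sum_of_nonneg fun _ _ => by positivity]
  refine Finset.sum_congr rfl fun k _ => ?_
  rw [ENNReal.ofReal_pow (norm_nonneg _), ofReal_norm]

/-- Multiplying the field by a bump function makes it bounded and globally Lipschitz, so
Picard–Lindelöf reaches any T. The scalar factor does not disturb the conservation law, so each
coefficient stays bounded by the initial norm R, in the region where the bump equals 1 and the field
is the original one. -/
theorem exists_airy_solution (N : ℕ) (x₀ : PosModes N → ℂ) {T : ℝ} (hT : 0 ≤ T) :
    ∃ x : ℝ → PosModes N → ℂ, x 0 = x₀ ∧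
      (∀ t ∈ Icc 0 T, ∀ k ∈ modes N, HasDerivAt (fun τ => realExt N k (x τ))
        (airyField N (fun m => realExt N m (x t)) k) t) ∧
      ∀ t ∈ Icc 0 T, l2 (fun m => realExt N m (x t)) = l2 (fun m => realExt N m x₀) := by
  set R : ℝ := (l2 (fun m => realExt N m x₀)).toReal with hR
  have hR0 : 0 ≤ R := ENNReal.toReal_nonneg
  let f : ContDiffBump (0 : PosModes N → ℂ) := ⟨R + 1, R + 2, by linarith, by linarith⟩
  set G : (PosModes N → ℂ) → PosModes N → ℂ :=
    fun x j => airyField N (fun m => realExt N m x) j with hG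
  set F : (PosModes N → ℂ) → PosModes N → ℂ := fun x => f x • G x with hF
  have hFs : HasCompactSupport F := f.hasCompactSupport.smul_right
  have hFc : ContDiff ℝ 1 F := f.contDiff.smul (contDiff_airyField N)
  obtain ⟨K, hK⟩ := hFc.lipschitzWith_of_hasCompactSupport hFs (by norm_num)
  obtain ⟨L, hL⟩ := hFs.exists_bound_of_continuous hFc.continuous
  -- A larger time interval yields two-sided derivatives at both ends of [0, T].
  have h0 : (0 : ℝ) ∈ Icc (-1) (T + 1) := ⟨by linarith, by linarith⟩
  have hpl : IsPicardLindelof (fun _ => F) (tmin := -1) (tmax := T + 1) ⟨0, h0⟩ x₀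
      (L.toNNReal * (T + 1).toNNReal) 0 L.toNNReal K := by
    refine ⟨fun t _ => hK.lipschitzOnWith, fun x _ => continuousOn_const, fun t _ x _ =>
      (hL x).trans (Real.le_coe_toNNReal L), ?_⟩
    simp only [sub_zero, zero_sub, neg_neg, NNReal.coe_zero, NNReal.coe_mul]
    rw [max_eq_left (by linarith), Real.coe_toNNReal (T + 1) (by linarith)]
  obtain ⟨x, hx0, hx⟩ := hpl.exists_eq_forall_mem_Icc_hasDerivWithinAt (x := x₀) (by simp)
  simp only at hx0
  have hd : ∀ t ∈ Ioo (-1) (T + 1), ∀ k ∈ modes N, HasDerivAt (fun τ => realExt N k (x τ))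
      ((f (x t) : ℂ) * airyField N (fun m => realExt N m (x t)) k) t := by
    intro t ht k hk
    have h1 : HasDerivAt x (F (x t)) t :=
      (hx t (Ioo_subset_Icc_self ht)).hasDerivAt (Icc_mem_nhds ht.1 ht.2)
    have h2 := (realExt N k).hasFDerivAt.comp_hasDerivAt t h1
    refine h2.congr_deriv ?_
    rw [hF]
    simp only [map_smul]
    rw [hG, realExt_airyField _ hk, Complex.real_smul]
  have hconst : ∀ t ∈ Icc 0 T, l2 (fun m => realExt N m (x t)) =
      l2 (fun m => realExt N m x₀) := by
    intro t ht
    set e : ℝ → ℂ := fun τ => ∑ k ∈ modes N, realExt N k (x τ) * realExt N (-k) (x τ) with he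
    have he' : ∀ τ ∈ Ioo (-1) (T + 1), HasDerivAt e 0 τ := by
      intro τ hτ
      refine (HasDerivAt.fun_sum fun k hk => (hd τ hτ k hk).fun_mul (hd τ hτ (-k)
        (by simpa [mem_modes] using hk))).congr_deriv ?_
      rw [Finset.sum_add_distrib]
      have h1 := sum_airyField_mul (N := N) (u := fun m => realExt N m (x τ))
      have h2 := sum_modes_neg (N := N) fun k => realExt N (-k) (x τ) *
        (f (x τ) * airyField N (fun m => realExt N m (x τ)) k)
      simp only [neg_neg] at h2
      rw [h2, ← Finset.sum_add_distrib]
      calc _ = ∑ k ∈ modes N, 2 * (f (x τ) : ℂ) * (airyField N (fun m => realExt N m (x τ)) k *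
            realExt N (-k) (x τ)) := Finset.sum_congr rfl fun k _ => by ring
        _ = 0 := by rw [← Finset.mul_sum, h1, mul_zero]
    have hc : e t = e 0 := by
      refine constant_of_has_deriv_right_zero (a := 0) (b := T) (f := e) ?_ ?_ t ht
      · intro τ hτ
        exact (he' τ ⟨by linarith [hτ.1], by linarith [hτ.2]⟩).continuousAt.continuousWithinAt
      · intro τ hτ
        exact (he' τ ⟨by linarith [hτ.1], by linarith [hτ.2]⟩).hasDerivWithinAt
    refine (ENNReal.pow_right_strictMono (n := 2) (by norm_num)).injective ?_
    rw [enorm_sum_sq (realExt_suppModes (x t)) fun k => realExt_neg k _,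
      enorm_sum_sq (realExt_suppModes x₀) fun k => realExt_neg k _, ← hx0]
    exact congrArg _ hc
  refine ⟨x, hx0, fun t ht k hk => ?_, hconst⟩
  refine (hd t ⟨by linarith [ht.1], by linarith [ht.2]⟩ k hk).congr_deriv ?_
  have h1 : f (x t) = 1 := by
    apply f.one_of_mem_closedBall
    rw [mem_closedBall_zero_iff, pi_norm_le_iff_of_nonneg (by positivity)]
    intro j
    have h2 : ‖realExt N j (x t)‖ₑ ≤ l2 (fun m => realExt N m x₀) := by
      rw [← hconst t ht]
      exact enorm_le_l2 (fun m => realExt N m (x t)) j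
    rw [realExt_pos] at h2
    have h3 := ENNReal.toReal_mono (l2_ne_top_of_suppModes (realExt_suppModes x₀)) h2
    rw [toReal_enorm] at h3
    change ‖x t j‖ ≤ R + 1
    linarith
  rw [h1]
  simp

/-- The substitution v_k = e^{ik³t} u_k removes the dispersive term; (a + b)³ = 3(a + b)ab + a³ + b³
produces the phases, and unimodular factors leave the norm unchanged. -/
theorem exists_galerkin_solution (N : ℕ) {u₀ : ℤ → ℂ} (hs : SuppModes N u₀)
    (hu : ∀ k, u₀ (-k) = (starRingEnd ℂ) (u₀ k)) {T : ℝ} (hT : 0 ≤ T) :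
    ∃ v : ℝ → ℤ → ℂ, v 0 = u₀ ∧ (∀ t, SuppModes N (v t)) ∧
      (∀ t k, v t (-k) = (starRingEnd ℂ) (v t k)) ∧
      (∀ t ∈ Icc 0 T, ∀ k, HasDerivAt (fun τ => v τ k) (galerkin N t (v t) k) t) ∧
      ∀ t ∈ Icc 0 T, l2 (v t) = l2 u₀ := by
  have hr : (fun m => realExt N m (fun j : PosModes N => u₀ j)) = u₀ := by
    ext k
    by_cases h : k ∈ Finset.Icc (1 : ℤ) N
    · exact realExt_pos ⟨k, h⟩ _
    by_cases h' : -k ∈ Finset.Icc (1 : ℤ) N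
    · have h1 := realExt_pos ⟨-k, h'⟩ (fun j : PosModes N => u₀ j)
      simp only at h1
      rw [realExt_neg, hu] at h1
      exact (starRingEnd ℂ).injective h1
    · have h1 := realExt_suppModes fun j : PosModes N => u₀ j
      by_cases h0 : k = 0
      · subst h0; exact h1.1.trans hs.1.symm
      · have h2 : k ∉ modes N := by
          rw [mem_modes, abs_le]; simp at h h'; omega
        exact (h1.2 k h2).trans (hs.2 k h2).symm
  obtain ⟨x, hx0, hx, hl⟩ := exists_airy_solution N (fun j => u₀ j) hT
  rw [hr] at hl
  refine ⟨fun t k => osc (k ^ 3) t * realExt N k (x t), ?_, ?_, ?_, ?_, ?_⟩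
  · ext k
    change osc (k ^ 3) 0 * realExt N k (x 0) = u₀ k
    rw [hx0, congrFun hr k]
    simp [osc]
  · intro t
    have h := realExt_suppModes (x t)
    exact ⟨by simp only [h.1, mul_zero], fun k hk => by simp only [h.2 k hk, mul_zero]⟩
  · intro t k
    change osc ((-k) ^ 3) t * realExt N (-k) (x t) = (starRingEnd ℂ) (osc (k ^ 3) t *
      realExt N k (x t))
    rw [realExt_neg, map_mul]
    congr 1
    rw [osc, osc, ← Complex.exp_conj]
    congr 1
    simp only [map_mul, Complex.conj_I, Complex.conj_ofReal, map_intCast]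
    push_cast
    ring
  · intro t ht k
    by_cases hk : k ∈ modes N
    · refine ((hasDerivAt_osc (k ^ 3) t).fun_mul (hx t ht k hk)).congr_deriv ?_
      rw [airyField, galerkin, cutoff, if_pos (mem_modes.1 hk)]
      have : ∑ a ∈ modes N, ∑ b ∈ modes N, (if a + b = k then osc (3 * k * a * b) t *
          (osc (a ^ 3) t * realExt N a (x t) * (osc (b ^ 3) t * realExt N b (x t))) else 0) =
          osc (k ^ 3) t * ∑ a ∈ modes N, ∑ b ∈ modes N,
            if a + b = k then realExt N a (x t) * realExt N b (x t) else 0 := by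
        rw [Finset.mul_sum]
        refine Finset.sum_congr rfl fun a _ => ?_
        rw [Finset.mul_sum]
        refine Finset.sum_congr rfl fun b _ => ?_
        split_ifs with h
        · have : osc (k ^ 3) t = osc (3 * k * a * b) t * (osc (a ^ 3) t * osc (b ^ 3) t) := by
            rw [← osc_add, ← osc_add, ← h]; congr 1; ring
          rw [this]; ring
        · simp
      rw [this]
      push_cast
      ring
    · have h1 : (fun τ => osc (k ^ 3) τ * realExt N k (x τ)) = fun _ => 0 := by
        ext τ
        have := (realExt_suppModes (x τ)).2 k hk
        simp only at this
        rw [this, mul_zero]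
      rw [h1, galerkin, cutoff, if_neg fun h => hk (mem_modes.2 h)]
      simpa using hasDerivAt_const t (0 : ℂ)
  · intro t ht
    rw [← hl t ht]
    exact l2_congr fun k => by rw [enorm_mul, enorm_osc, one_mul]

end Galerkin

/-! ### Uniform weighted estimates for the Galerkin solutions -/

theorem enorm_toLp_modes (N : ℕ) (g : ℤ → ℂ) :
    ‖(WithLp.toLp 2 (fun k : modes N => g k) : EuclideanSpace ℂ (modes N))‖ₑ =
      l2 (fun k => if k ∈ modes N then g k else 0) := by
  refine (ENNReal.pow_right_strictMono (n := 2) (by norm_num)).injective ?_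
  simp only [l2_sq]
  rw [← ofReal_norm, ← ENNReal.ofReal_pow (norm_nonneg _), EuclideanSpace.norm_sq_eq,
    ENNReal.ofReal_sum_of_nonneg fun _ _ => by positivity,
    tsum_eq_sum (s := modes N) fun m hm => by simp [hm]]
  refine Eq.trans ?_ (Finset.sum_coe_sort (modes N)
    fun k => ‖if k ∈ modes N then g k else 0‖ₑ ^ 2)
  refine Finset.sum_congr rfl fun k _ => ?_
  rw [ENNReal.ofReal_pow (norm_nonneg _), ofReal_norm, if_pos k.2]

theorem enorm_weight_mul (ω : ℤ → ℝ≥0) (k : ℤ) (z : ℂ) :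
    ‖((ω k : ℝ) : ℂ) * z‖ₑ = ω k * ‖z‖ₑ := by
  rw [enorm_mul]
  congr 1
  rw [← ofReal_norm, Complex.norm_real, Real.norm_of_nonneg (ω k).coe_nonneg]
  exact ENNReal.ofReal_coe_nnreal

theorem enorm_toLp_weight_le (N : ℕ) (ω : ℤ → ℝ≥0) (g : ℤ → ℂ) :
    ‖(WithLp.toLp 2 (fun k : modes N => ((ω k : ℝ) : ℂ) * g k) : EuclideanSpace ℂ (modes N))‖ₑ ≤
      l2 (fun k => ω k * ‖g k‖ₑ) := by
  rw [enorm_toLp_modes N (fun k => ((ω k : ℝ) : ℂ) * g k)]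
  refine l2_mono fun k => ?_
  split_ifs
  · rw [enorm_weight_mul]; simp
  · simp

theorem enorm_toLp_weight_eq {N : ℕ} (ω : ℤ → ℝ≥0) {g : ℤ → ℂ} (hg : SuppModes N g) :
    ‖(WithLp.toLp 2 (fun k : modes N => ((ω k : ℝ) : ℂ) * g k) : EuclideanSpace ℂ (modes N))‖ₑ =
      l2 (fun k => ω k * ‖g k‖ₑ) := by
  rw [enorm_toLp_modes N (fun k => ((ω k : ℝ) : ℂ) * g k)]
  refine l2_congr fun k => ?_
  split_ifs with h
  · rw [enorm_weight_mul]; simp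
  · simp [hg.2 k h]

/-- The growth factor of weighted norms of Galerkin solutions on `[0, T]`. -/
noncomputable def growth (n : ℕ) (M : ℝ≥0) (T : ℝ) : ℝ≥0∞ :=
  ENNReal.ofReal (Real.exp (((64 * rhsConst n * M ^ 3).toReal + 1) * T)) *
    (1 + 2 * (lhsConst * M ^ 4))

theorem growth_ne_top (n : ℕ) (M : ℝ≥0) (T : ℝ) : growth n M T ≠ ⊤ := by
  have := lhsConst_ne_top
  unfold growth
  finiteness

/-- Weights that are subadditive up to a constant, vanish at the origin and are at most linear
with slope `κ`. -/
structure IsWeight (ω : ℤ → ℝ≥0) (κ : ℝ≥0) : Prop where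
  zero : ω 0 = 0
  sum_le : ∀ x y z w, ω (x + y + z + w) ≤ 16 * (ω x + ω y + ω z + ω w)
  le_linear : ∀ k : ℤ, (ω k : ℝ) ≤ κ * |(k : ℝ)|

theorem IsWeight.coe_le {ω : ℤ → ℝ≥0} {κ : ℝ≥0} (h : IsWeight ω κ) (k : ℤ) :
    (ω k : ℝ≥0∞) ≤ κ * ‖(k : ℂ)‖ₑ := by
  rw [← ofReal_norm, Complex.norm_intCast, ← ENNReal.ofReal_coe_nnreal (p := κ),
    ← ENNReal.ofReal_mul κ.coe_nonneg, ← ENNReal.ofReal_coe_nnreal]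
  exact ENNReal.ofReal_le_ofReal (h.le_linear k)

/-- The gained derivative absorbs the whole weight, so the bound contains the slope κ and no
weighted norm of u. -/
theorem IsWeight.lhs_le {ω : ℤ → ℝ≥0} {κ : ℝ≥0} (h : IsWeight ω κ) {χ : ℤ → ℂ}
    (hχ : ∀ m, ‖χ m‖ ≤ 1) (n : ℕ) (t : ℝ) {M : ℝ≥0} {u : ℤ → ℂ} (hu : l2 u + 1 ≤ M) :
    l2 (fun k => ω k * ‖quadForm (coLhs χ n t) (withUnit u) (withUnit u) (withUnit u)
      (withUnit u) k‖ₑ) ≤ κ * (lhsConst * M ^ 4) := by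
  have hs : KernelBound (fun x y z w => (ω (x + y + z + w) : ℝ≥0∞) * ‖coLhs χ n t x y z w‖ₑ)
      (κ * lhsConst) := by
    refine ((coLhs_smoothing hχ n t).const_mul κ).mono fun x y z w => ?_
    rw [← mul_assoc]
    gcongr
    exact h.coe_le _
  refine (hs.l2_weight_quadForm_le (ω := fun k => (ω k : ℝ≥0∞)) _ _ _ _).trans ?_
  rw [← pow_two, ← pow_succ, ← pow_succ]
  rw [mul_assoc]
  gcongr
  exact (l2_withUnit_le u).trans hu

/-- The factor 64 is 4·16: four positions for the weight times the constant of its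
near-subadditivity. -/
theorem IsWeight.rhs_le {ω : ℤ → ℝ≥0} {κ : ℝ≥0} (h : IsWeight ω κ) {χ : ℤ → ℂ}
    (hχ : ∀ m, ‖χ m‖ ≤ 1) (n : ℕ) (t : ℝ) {M : ℝ≥0} {u : ℤ → ℂ} (hu : l2 u + 1 ≤ M) :
    l2 (fun k => ω k * ‖quadForm (coRhs χ n t) (withUnit u) (withUnit u) (withUnit u)
      (withUnit u) k‖ₑ) ≤ 64 * rhsConst n * M ^ 3 * l2 (fun k => ω k * ‖u k‖ₑ) := by
  have h1 : ∀ x y z w : ℤ, (ω (x + y + z + w) : ℝ≥0∞) ≤ 16 * (ω x + ω y + ω z + ω w) :=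
    fun x y z w => by exact_mod_cast h.sum_le x y z w
  have h2 := (coRhs_bound hχ n t).l2_weight_le (ω := fun k => (ω k : ℝ≥0∞)) h1 (withUnit u)
  simp only [weight_withUnit (ω := fun k => (ω k : ℝ≥0∞)) (by simp [h.zero]) u] at h2
  refine h2.trans ?_
  calc _ = 64 * rhsConst n * l2 (withUnit u) ^ 3 * l2 (fun k => ω k * ‖u k‖ₑ) := by ring
    _ ≤ _ := by
      gcongr
      exact (l2_withUnit_le u).trans hu

/-- Gronwall's inequality applies to the weighted norm of v + Q, with Q the smoothing terms: its
derivative -(i/6)P is bounded linearly by the weighted norm of v, and Q itself by a multiple of κ.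
No constant depends on N, and the inhomogeneous part is proportional to κ. -/
theorem galerkin_weight_bound {N : ℕ} {v : ℝ → ℤ → ℂ} {T : ℝ} (n : ℕ) (hT : 0 ≤ T)
    (hv : ∀ τ, SuppModes N (v τ))
    (hd : ∀ t ∈ Icc 0 T, ∀ k, HasDerivAt (fun τ => v τ k) (galerkin N t (v t) k) t)
    {M : ℝ≥0} (hM : ∀ t ∈ Icc 0 T, l2 (v t) + 1 ≤ M) {ω : ℤ → ℝ≥0} {κ : ℝ≥0} (hω : IsWeight ω κ) :
    ∀ t ∈ Icc 0 T, l2 (fun k => ω k * ‖v t k‖ₑ) ≤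
      growth n M T * (l2 (fun k => ω k * ‖v 0 k‖ₑ) + κ) := by
  set χ := cutoff N
  set Q : ℝ → ℤ → ℂ := fun τ => quadForm (coLhs χ n τ) (withUnit (v τ)) (withUnit (v τ))
    (withUnit (v τ)) (withUnit (v τ)) with hQ
  set P : ℝ → ℤ → ℂ := fun τ => quadForm (coRhs χ n τ) (withUnit (v τ)) (withUnit (v τ))
    (withUnit (v τ)) (withUnit (v τ)) with hP
  let emb : (ℤ → ℂ) → EuclideanSpace ℂ (modes N) := fun g =>
    WithLp.toLp 2 (fun k : modes N => ((ω k : ℝ) : ℂ) * g k)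
  have emb_add : ∀ g g', emb (fun k => g k + g' k) = emb g + emb g' := fun g g' => by
    ext k; simp [emb, mul_add]
  set q : ℝ≥0∞ := κ * (lhsConst * M ^ 4) with hq
  have hqt : q ≠ ⊤ := by have := lhsConst_ne_top; finiteness
  set C : ℝ≥0∞ := 64 * rhsConst n * M ^ 3 with hC
  have hCt : C ≠ ⊤ := by have := rhsConst_ne_top n; finiteness
  -- The added 1 keeps the Gronwall constant nonzero, so that the closed formula dividing by it is
  -- available.
  set K : ℝ := C.toReal + 1 with hK
  have hK0 : 0 < K := by positivity
  have eQ : ∀ t ∈ Icc 0 T, ‖emb (Q t)‖ₑ ≤ q := fun t ht =>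
    (enorm_toLp_weight_le N ω (Q t)).trans (hω.lhs_le (norm_cutoff_le N) n t (hM t ht))
  have eP : ∀ t ∈ Icc 0 T, ‖emb (P t)‖ₑ ≤ C * ‖emb (v t)‖ₑ := fun t ht => by
    rw [enorm_toLp_weight_eq ω (hv t)]
    exact (enorm_toLp_weight_le N ω (P t)).trans (hω.rhs_le (norm_cutoff_le N) n t (hM t ht))
  set f : ℝ → EuclideanSpace ℂ (modes N) := fun t => emb (fun k => v t k + Q t k) with hf
  set f' : ℝ → EuclideanSpace ℂ (modes N) := fun t => emb (fun k => -(Complex.I / 6) * P t k)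
    with hf'
  have nQ : ∀ t ∈ Icc 0 T, ‖emb (Q t)‖ ≤ q.toReal := fun t ht => by
    rw [← toReal_enorm]; exact ENNReal.toReal_mono hqt (eQ t ht)
  have nP : ∀ t ∈ Icc 0 T, ‖emb (P t)‖ ≤ C.toReal * ‖emb (v t)‖ := fun t ht => by
    rw [← toReal_enorm, ← toReal_enorm, ← ENNReal.toReal_mul]
    exact ENNReal.toReal_mono (by finiteness) (eP t ht)
  have nv : ∀ t ∈ Icc 0 T, ‖emb (v t)‖ ≤ ‖f t‖ + q.toReal := fun t ht => by
    have h1 : emb (v t) = f t - emb (Q t) := by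
      rw [hf]; simp only; rw [emb_add (v t) (Q t), add_sub_cancel_right]
    rw [h1]
    exact (norm_sub_le _ _).trans (by gcongr; exact nQ t ht)
  have hderiv : ∀ t ∈ Icc 0 T, HasDerivAt f (f' t) t := by
    intro t ht
    have h1 : HasDerivAt (fun τ => fun k : modes N => ((ω k : ℝ) : ℂ) * (v τ k + Q τ k))
        (fun k : modes N => ((ω k : ℝ) : ℂ) * (-(Complex.I / 6) * P t k)) t := by
      rw [hasDerivAt_pi]
      rintro ⟨k, hk⟩
      -- The third form says nothing about the zero mode, but the weight vanishes there.
      by_cases hk0 : k = 0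
      · subst hk0
        simp only [hω.zero]
        simpa using hasDerivAt_const t (0 : ℂ)
      · exact (hasDerivAt_third n hv (hd t ht) hk0 hk).const_mul _
    exact ((PiLp.continuousLinearEquiv 2 ℝ (fun _ : modes N => ℂ)).symm :
      (modes N → ℂ) →L[ℝ] EuclideanSpace ℂ (modes N)).hasFDerivAt.comp_hasDerivAt t h1
  have hbound : ∀ t ∈ Icc 0 T, ‖f' t‖ ≤ K * ‖f t‖ + K * q.toReal := by
    intro t ht
    have h1 : f' t = (-(Complex.I / 6)) • emb (P t) := by
      ext k; simp only [hf', emb, PiLp.smul_apply, smul_eq_mul]; ring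
    have h2 : ‖-(Complex.I / 6)‖ ≤ 1 := by rw [norm_neg, norm_div]; norm_num
    rw [h1, norm_smul, ← mul_add]
    calc _ ≤ 1 * (C.toReal * (‖f t‖ + q.toReal)) := by
          gcongr
          exact (nP t ht).trans (by gcongr; exact nv t ht)
      _ ≤ K * (‖f t‖ + q.toReal) := by rw [one_mul]; gcongr; linarith
  have hgr := norm_le_gronwallBound_of_norm_deriv_right_le (f := f) (f' := f') (δ := ‖f 0‖)
    (K := K) (ε := K * q.toReal) (a := 0) (b := T)
    (fun t ht => (hderiv t ht).continuousAt.continuousWithinAt)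
    (fun t ht => (hderiv t (Ico_subset_Icc_self ht)).hasDerivWithinAt) le_rfl
    (fun t ht => hbound t (Ico_subset_Icc_self ht))
  have h0 : (0 : ℝ) ∈ Icc 0 T := ⟨le_rfl, hT⟩
  have hf0 : ‖f 0‖ ≤ ‖emb (v 0)‖ + q.toReal := by
    rw [hf]; simp only; rw [emb_add (v 0) (Q 0)]
    exact (norm_add_le _ _).trans (by gcongr; exact nQ 0 h0)
  intro t ht
  have h1 := hgr t ht
  rw [gronwallBound_of_K_ne_0 hK0.ne', sub_zero, mul_div_cancel_left₀ _ hK0.ne'] at h1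
  have hexp : Real.exp (K * t) ≤ Real.exp (K * T) := by
    gcongr; exact ht.2
  have h2 : ‖emb (v t)‖ ≤ Real.exp (K * T) * (‖emb (v 0)‖ + 2 * q.toReal) := by
    calc ‖emb (v t)‖ ≤ ‖f t‖ + q.toReal := nv t ht
      _ ≤ ‖f 0‖ * Real.exp (K * t) + q.toReal * (Real.exp (K * t) - 1) + q.toReal := by gcongr
      _ = Real.exp (K * t) * (‖f 0‖ + q.toReal) := by ring
      _ ≤ Real.exp (K * T) * ((‖emb (v 0)‖ + q.toReal) + q.toReal) := by gcongr
      _ = _ := by ring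
  rw [← enorm_toLp_weight_eq ω (hv t), ← enorm_toLp_weight_eq ω (hv 0)]
  change ‖emb (v t)‖ₑ ≤ growth n M T * (‖emb (v 0)‖ₑ + κ)
  calc ‖emb (v t)‖ₑ = ENNReal.ofReal ‖emb (v t)‖ := (ofReal_norm _).symm
    _ ≤ ENNReal.ofReal (Real.exp (K * T) * (‖emb (v 0)‖ + 2 * q.toReal)) :=
        ENNReal.ofReal_le_ofReal h2
    _ = ENNReal.ofReal (Real.exp (K * T)) * (‖emb (v 0)‖ₑ + 2 * q) := by
        rw [ENNReal.ofReal_mul (Real.exp_pos _).le, ENNReal.ofReal_add (norm_nonneg _)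
          (by positivity), ofReal_norm, ENNReal.ofReal_mul (by norm_num), ENNReal.ofReal_toReal hqt]
        norm_num
    _ ≤ ENNReal.ofReal (Real.exp (K * T)) * ((1 + 2 * (lhsConst * M ^ 4)) *
          (‖emb (v 0)‖ₑ + κ)) := by
        gcongr
        rw [hq]
        calc _ ≤ ‖emb (v 0)‖ₑ + 2 * (lhsConst * M ^ 4) * ‖emb (v 0)‖ₑ + κ +
              2 * (lhsConst * M ^ 4) * κ := by
              rw [show 2 * ((κ : ℝ≥0∞) * (lhsConst * M ^ 4)) = 2 * (lhsConst * M ^ 4) * κ by ring]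
              gcongr
              rw [add_assoc]
              exact le_self_add
          _ = _ := by ring
    _ = _ := by rw [growth, mul_assoc]

/-! ### Sobolev weights -/

/-- `|k|^s`. -/
noncomputable def sobWeight (s : ℝ) (k : ℤ) : ℝ≥0 := ⟨|(k : ℝ)| ^ s, by positivity⟩

/-- `|k|^s min(1, |k|/M)`: the weight `|k|^s` damped at the modes below `M`. -/
noncomputable def tailWeight (s : ℝ) (M : ℕ) (k : ℤ) : ℝ≥0 :=
  ⟨|(k : ℝ)| ^ s * min 1 (|(k : ℝ)| / M), by positivity⟩

/-- The weight is an increasing function φ of |k| with φ(4r) ≤ 16 φ(r): a factor 4 from 4^s ≤ 4 and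
another from the minimum. Since a sum of four integers has modulus at most four times the largest,
near-subadditivity follows. The slope M^(s-1) comes from scaling |k| = M b and b^s min(1, b) ≤ b;
for s < 1 it tends to 0. -/
theorem tailWeight_isWeight {s : ℝ} (h0 : 0 ≤ s) (h1 : s ≤ 1) {M : ℕ} (hM : M ≠ 0) :
    IsWeight (tailWeight s M) ⟨(M : ℝ) ^ (s - 1), by positivity⟩ where
  zero := by
    ext
    change |((0 : ℤ) : ℝ)| ^ s * min 1 (|((0 : ℤ) : ℝ)| / M) = 0
    simp
  sum_le x y z w := by
    set φ : ℝ → ℝ := fun r => r ^ s * min 1 (r / M) with hφ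
    have hnn : ∀ r, 0 ≤ r → 0 ≤ φ r := fun r hr => by positivity
    have hmono : ∀ a b, 0 ≤ a → a ≤ b → φ a ≤ φ b := fun a b ha hab => by
      have : 0 ≤ b := ha.trans hab
      simp only [hφ]; gcongr
    have h4 : ∀ r, 0 ≤ r → φ (4 * r) ≤ 16 * φ r := fun r hr => by
      have e1 : (4 * r) ^ s ≤ 4 * r ^ s := by
        rw [Real.mul_rpow (by norm_num) hr]
        gcongr
        calc (4 : ℝ) ^ s ≤ 4 ^ (1 : ℝ) := Real.rpow_le_rpow_of_exponent_le (by norm_num) h1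
          _ = 4 := Real.rpow_one 4
      have e2 : min 1 (4 * r / M) ≤ 4 * min 1 (r / M) := by
        have : 0 ≤ r / M := by positivity
        rw [mul_min_of_nonneg _ _ (by norm_num), mul_div_assoc]
        exact min_le_min (by norm_num) le_rfl
      calc φ (4 * r) ≤ (4 * r ^ s) * (4 * min 1 (r / M)) := by
            simp only [hφ]; gcongr
        _ = _ := by simp only [hφ]; ring
    obtain ⟨m, hm, hms⟩ : ∃ m : ℝ, (m = |(x : ℝ)| ∨ m = |(y : ℝ)| ∨ m = |(z : ℝ)| ∨ m = |(w : ℝ)|) ∧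
        |(x : ℝ)| ≤ m ∧ |(y : ℝ)| ≤ m ∧ |(z : ℝ)| ≤ m ∧ |(w : ℝ)| ≤ m := by
      refine ⟨max (max |(x : ℝ)| |(y : ℝ)|) (max |(z : ℝ)| |(w : ℝ)|), ?_, by simp, by simp,
        by simp, by simp⟩
      rcases max_choice (max |(x : ℝ)| |(y : ℝ)|) (max |(z : ℝ)| |(w : ℝ)|) with h | h <;> rw [h]
      · rcases max_choice |(x : ℝ)| |(y : ℝ)| with h | h <;> simp [h]
      · rcases max_choice |(z : ℝ)| |(w : ℝ)| with h | h <;> simp [h]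
    have hm0 : 0 ≤ m := (abs_nonneg _).trans hms.1
    have hsum : |((x + y + z + w : ℤ) : ℝ)| ≤ 4 * m := by
      push_cast
      calc _ ≤ |(x : ℝ)| + |(y : ℝ)| + |(z : ℝ)| + |(w : ℝ)| :=
            (abs_add_le _ _).trans (by
              gcongr; exact (abs_add_le _ _).trans (by gcongr; exact abs_add_le _ _))
        _ ≤ 4 * m := by linarith [hms.1, hms.2.1, hms.2.2.1, hms.2.2.2]
    rw [← NNReal.coe_le_coe]
    push_cast
    change φ _ ≤ 16 * (φ _ + φ _ + φ _ + φ _)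
    refine (hmono _ _ (abs_nonneg _) hsum).trans ((h4 m hm0).trans ?_)
    have a1 := hnn _ (abs_nonneg (x : ℝ))
    have a2 := hnn _ (abs_nonneg (y : ℝ))
    have a3 := hnn _ (abs_nonneg (z : ℝ))
    have a4 := hnn _ (abs_nonneg (w : ℝ))
    rcases hm with rfl | rfl | rfl | rfl <;> linarith
  le_linear k := by
    change |(k : ℝ)| ^ s * min 1 (|(k : ℝ)| / M) ≤ (M : ℝ) ^ (s - 1) * |(k : ℝ)|
    have hM' : (0 : ℝ) < M := by exact_mod_cast Nat.pos_of_ne_zero hM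
    set b := |(k : ℝ)| / M with hb
    have hb0 : 0 ≤ b := by positivity
    have hk : |(k : ℝ)| = M * b := by rw [hb]; field_simp
    rw [hk, Real.mul_rpow hM'.le hb0, Real.rpow_sub_one hM'.ne']
    have : b ^ s * min 1 b ≤ b := by
      rcases le_total b 1 with h | h
      · rw [min_eq_right h]
        exact mul_le_of_le_one_left hb0 (Real.rpow_le_one hb0 h h0)
      · rw [min_eq_left h, mul_one]
        calc b ^ s ≤ b ^ (1 : ℝ) := Real.rpow_le_rpow_of_exponent_le h h1
          _ = b := Real.rpow_one b
    calc (M : ℝ) ^ s * b ^ s * min 1 b = (M : ℝ) ^ s * (b ^ s * min 1 b) := by ring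
      _ ≤ (M : ℝ) ^ s * b := by gcongr
      _ = _ := by field_simp

theorem tailWeight_le (s : ℝ) (M : ℕ) (k : ℤ) : tailWeight s M k ≤ sobWeight s k := by
  rw [← NNReal.coe_le_coe]
  exact mul_le_of_le_one_right (by positivity) (min_le_left _ _)

theorem tailWeight_of_le (s : ℝ) {M : ℕ} (hM : M ≠ 0) {k : ℤ} (h : (M : ℤ) ≤ |k|) :
    tailWeight s M k = sobWeight s k := by
  ext
  have hM' : (0 : ℝ) < M := by exact_mod_cast Nat.pos_of_ne_zero hM
  have : 1 ≤ |(k : ℝ)| / M := by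
    rw [one_le_div hM']; exact_mod_cast h
  change |(k : ℝ)| ^ s * min 1 (|(k : ℝ)| / M) = |(k : ℝ)| ^ s
  rw [min_eq_left this, mul_one]

/-- Dominated convergence: for each mode the damping factor |k|/M tends to 0, and the undamped
weighted sequence is a majorant in ℓ². -/
theorem tendsto_l2_tailWeight {s : ℝ} {u : ℤ → ℂ}
    (hu : l2 (fun k => sobWeight s k * ‖u k‖ₑ) ≠ ⊤) :
    Tendsto (fun M : ℕ => l2 (fun k => tailWeight s M k * ‖u k‖ₑ)) atTop (𝓝 0) := by
  have h1 : Tendsto (fun M : ℕ => ∫⁻ k : ℤ, ((tailWeight s M k : ℝ≥0∞) * ‖u k‖ₑ) ^ 2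
      ∂Measure.count) atTop (𝓝 (∫⁻ _ : ℤ, 0 ∂Measure.count)) := by
    refine tendsto_lintegral_of_dominated_convergence
      (fun k : ℤ => ((sobWeight s k : ℝ≥0∞) * ‖u k‖ₑ) ^ 2) (fun M => by fun_prop)
      (fun M => .of_forall fun k => ?_) ?_ (.of_forall fun k => ?_)
    · refine pow_le_pow_left₀ zero_le (mul_le_mul_left ?_ _) 2
      exact_mod_cast tailWeight_le s M k
    · rw [lintegral_count]
      have := l2_sq (fun k => (sobWeight s k : ℝ≥0∞) * ‖u k‖ₑ)
      simp only [enorm_eq_self] at this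
      rw [← this]
      finiteness
    · have h2 : Tendsto (fun M : ℕ => tailWeight s M k) atTop (𝓝 0) := by
        rw [← NNReal.tendsto_coe]
        change Tendsto (fun M : ℕ => |(k : ℝ)| ^ s * min 1 (|(k : ℝ)| / M)) atTop (𝓝 0)
        have h3 : Tendsto (fun M : ℕ => |(k : ℝ)| / (M : ℝ)) atTop (𝓝 0) :=
          tendsto_const_div_atTop_nhds_zero_nat _
        simpa using ((tendsto_const_nhds (x := (1 : ℝ))).min h3).const_mul (|(k : ℝ)| ^ s)
      have h4 : Tendsto (fun M : ℕ => (tailWeight s M k : ℝ≥0∞) * ‖u k‖ₑ) atTop (𝓝 0) := by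
        simpa using ENNReal.Tendsto.mul_const (ENNReal.tendsto_coe.2 h2)
          (Or.inr (enorm_ne_top (x := u k)))
      simpa [Function.comp_def] using (ENNReal.continuous_pow 2).tendsto 0 |>.comp h4
  simp only [lintegral_count, lintegral_zero] at h1
  have h2 : Tendsto (fun M : ℕ => l2 (fun k => tailWeight s M k * ‖u k‖ₑ) ^ 2) atTop (𝓝 0) := by
    simp only [l2_sq, enorm_eq_self]
    exact h1
  have h3 := (ENNReal.continuous_rpow_const (y := (1 / 2 : ℝ))).tendsto 0 |>.comp h2
  rw [ENNReal.zero_rpow_of_pos (by norm_num)] at h3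
  refine h3.congr fun M => ?_
  simp only [Function.comp]
  rw [← ENNReal.rpow_natCast, ← ENNReal.rpow_mul]
  norm_num

/-! ### Pointwise convergence and uniform tails -/

/-- The part of `u` at the modes `|k| > M`. -/
noncomputable def tailPart {ε : Type*} [Zero ε] (M : ℕ) (u : ℤ → ε) (k : ℤ) : ε :=
  if (M : ℤ) < |k| then u k else 0

/-- Compactness criterion in ℓ²: finitely many low modes are handled by modewise convergence, the
rest by uniform smallness of tails. -/
theorem tendsto_l2_of_tails {ι : Type*} {F : Filter ι} {f : ι → ℤ → ℂ} {g : ℤ → ℂ}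
    (h : ∀ k, Tendsto (fun i => f i k) F (𝓝 (g k)))
    (ht : ∀ ε : ℝ≥0∞, 0 < ε → ∃ M : ℕ, l2 (tailPart M g) ≤ ε ∧
      ∀ᶠ i in F, l2 (tailPart M (f i)) ≤ ε) :
    Tendsto (fun i => l2 (fun k => f i k - g k)) F (𝓝 0) := by
  rw [ENNReal.tendsto_nhds_zero]
  intro ε hε
  obtain ⟨M, hg, hf⟩ := ht (ε / 4) (ENNReal.div_pos hε.ne' (by norm_num))
  have h1 : Tendsto (fun i => ∑ k ∈ modes M, ‖f i k - g k‖ₑ) F (𝓝 0) := by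
    have : Tendsto (fun i => ∑ k ∈ modes M, ‖f i k - g k‖ₑ) F (𝓝 (∑ k ∈ modes M, 0)) := by
      refine tendsto_finsetSum _ fun k _ => ?_
      rw [← tendsto_zero_iff_enorm_tendsto_zero, ← sub_self (g k)]
      exact (h k).sub_const _
    simpa using this
  have h2 : ∀ i, l2 (fun k => if k ∈ modes M then f i k - g k else 0) ≤
      ∑ k ∈ modes M, ‖f i k - g k‖ₑ := by
    intro i
    apply l2_le_of_sq_le
    rw [tsum_eq_sum (s := modes M) fun m hm => by simp [hm], sq, Finset.sum_mul]
    refine Finset.sum_le_sum fun k hk => ?_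
    rw [if_pos hk, sq]
    gcongr
    exact Finset.single_le_sum (f := fun k => ‖f i k - g k‖ₑ) (fun _ _ => zero_le) hk
  filter_upwards [hf, h1.eventually_le_const
    (ENNReal.div_pos hε.ne' (by norm_num) : 0 < ε / 2)] with i hi hi'
  calc l2 (fun k => f i k - g k) ≤ l2 (fun k => (if k ∈ modes M then f i k - g k else 0) +
        (tailPart M (f i) k - tailPart M g k)) := by
        refine l2_mono fun k => le_of_eq ?_
        by_cases hk : k ∈ modes M
        · have : ¬ (M : ℤ) < |k| := not_lt.2 (mem_modes.1 hk)
          simp [tailPart, hk, this]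
        · have : (M : ℤ) < |k| := not_le.1 fun h => hk (mem_modes.2 h)
          simp [tailPart, hk, this]
    _ ≤ ε / 2 + (ε / 4 + ε / 4) :=
        (l2_add_le _ _).trans (add_le_add ((h2 i).trans hi')
          ((l2_sub_le _ _).trans (add_le_add hi hg)))
    _ = ε := by
        have : ε / 4 + ε / 4 = ε / 2 := by
          rw [← two_mul, ← mul_div_assoc, ENNReal.div_eq_div_iff (by norm_num) (by norm_num)
            (by norm_num) (by norm_num)]
          ring
        rw [this, ENNReal.add_halves]

theorem l2_tailPart_le (s : ℝ) {M : ℕ} (hM : M ≠ 0) (u : ℤ → ℂ) :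
    l2 (tailPart M fun k => ((sobWeight s k : ℝ) : ℂ) * u k) ≤
      l2 (fun k => tailWeight s M k * ‖u k‖ₑ) := by
  refine l2_mono fun k => ?_
  unfold tailPart
  split_ifs with h
  · rw [enorm_weight_mul, tailWeight_of_le s hM h.le]; simp
  · simp

/-! ### Majorants and continuity of the forms -/

theorem CoeffBound.add_norm {c c' : ℤ → ℤ → ℤ → ℤ → ℂ} {C C' : ℝ≥0∞} (h : CoeffBound c C)
    (h' : CoeffBound c' C') :
    CoeffBound (fun x y z w => ((‖c x y z w‖ + ‖c' x y z w‖ : ℝ) : ℂ)) (C + C') := by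
  refine (KernelBound.add h h').mono fun x y z w => ?_
  rw [← ofReal_norm, Complex.norm_real, Real.norm_of_nonneg (by positivity),
    ENNReal.ofReal_add (norm_nonneg _) (norm_nonneg _), ofReal_norm, ofReal_norm]

/-- A majorant of `coLhs χ n t` independent of `χ` and `t`. -/
noncomputable def lhsMajorant (n : ℕ) (x y z w : ℤ) : ℂ :=
  ((‖(-1 / 6) * coB2 0 x y z w‖ + ‖1 / 18 * coB30 1 n 0 x y z w‖ : ℝ) : ℂ)

/-- A majorant of `coRhs χ n t` independent of `χ` and `t`. -/
noncomputable def rhsMajorant (n : ℕ) (x y z w : ℤ) : ℂ :=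
  ((‖coR3 1 n 0 x y z w‖ + ‖(-1 / 3 : ℂ) * ((‖1 / 2 * coB401 1 n 0 x y z w‖ +
    ‖coB402 1 n 0 x y z w‖ : ℝ) : ℂ)‖ : ℝ) : ℂ)

theorem lhsMajorant_bound (n : ℕ) : CoeffBound (lhsMajorant n) lhsConst :=
  ((coB2_bound 0).const_mul _).add_norm ((coeff_of_smoothing (coB30_smoothing one_multiplier n 0)
    (coB30_zero_sum 1 n 0)).const_mul _)

theorem rhsMajorant_bound (n : ℕ) : CoeffBound (rhsMajorant n) (rhsConst n) :=
  (coR3_bound one_multiplier n 0).add_norm ((((coB401_bound one_multiplier n 0).const_mul _).add_norm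
    (coB402_bound one_multiplier n 0)).const_mul _)

section Majorant

variable {χ : ℤ → ℂ}

theorem norm_coB2_eq (t : ℝ) (x y z w : ℤ) : ‖coB2 t x y z w‖ = ‖coB2 0 x y z w‖ := by
  unfold coB2; split_ifs <;> simp [norm_osc]

theorem norm_coB30_le (hχ : ∀ m, ‖χ m‖ ≤ 1) (n : ℕ) (t : ℝ) (x y z w : ℤ) :
    ‖coB30 χ n t x y z w‖ ≤ ‖coB30 1 n 0 x y z w‖ := by
  unfold coB30
  split_ifs
  · simp only [norm_mul, norm_osc, Pi.one_apply, norm_one]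
    gcongr
    exact hχ _
  · simp

theorem norm_coR3_le (hχ : ∀ m, ‖χ m‖ ≤ 1) (n : ℕ) (t : ℝ) (x y z w : ℤ) :
    ‖coR3 χ n t x y z w‖ ≤ ‖coR3 1 n 0 x y z w‖ := by
  unfold coR3
  split_ifs
  · simp only [norm_mul, norm_osc, Pi.one_apply, norm_one]
    gcongr
    exact hχ _
  · simp

theorem norm_coB401_le (hχ : ∀ m, ‖χ m‖ ≤ 1) (n : ℕ) (t : ℝ) (x y z w : ℤ) :
    ‖coB401 χ n t x y z w‖ ≤ ‖coB401 1 n 0 x y z w‖ := by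
  unfold coB401
  split_ifs
  · simp only [norm_mul, norm_osc, Pi.one_apply, norm_one]
    gcongr <;> exact hχ _
  · simp

theorem norm_coB402_le (hχ : ∀ m, ‖χ m‖ ≤ 1) (n : ℕ) (t : ℝ) (x y z w : ℤ) :
    ‖coB402 χ n t x y z w‖ ≤ ‖coB402 1 n 0 x y z w‖ := by
  unfold coB402
  split_ifs
  · simp only [norm_mul, norm_osc, Pi.one_apply, norm_one]
    gcongr <;> exact hχ _
  · simp

theorem norm_coLhs_le (hχ : ∀ m, ‖χ m‖ ≤ 1) (n : ℕ) (t : ℝ) (x y z w : ℤ) :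
    ‖coLhs χ n t x y z w‖ ≤ ‖lhsMajorant n x y z w‖ := by
  rw [lhsMajorant, Complex.norm_real, Real.norm_of_nonneg (by positivity), coLhs]
  refine (norm_add_le _ _).trans ?_
  rw [norm_mul, norm_mul, norm_mul, norm_mul, norm_coB2_eq]
  gcongr
  exact norm_coB30_le hχ n t x y z w

theorem norm_coRhs_le (hχ : ∀ m, ‖χ m‖ ≤ 1) (n : ℕ) (t : ℝ) (x y z w : ℤ) :
    ‖coRhs χ n t x y z w‖ ≤ ‖rhsMajorant n x y z w‖ := by
  rw [rhsMajorant, Complex.norm_real, Real.norm_of_nonneg (by positivity), coRhs]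
  refine (norm_add_le _ _).trans (add_le_add (norm_coR3_le hχ n t x y z w) ?_)
  rw [norm_mul, norm_mul (-1 / 3 : ℂ), Complex.norm_real, Real.norm_of_nonneg (by positivity)]
  gcongr
  refine (norm_add_le _ _).trans (add_le_add ?_ (norm_coB402_le hχ n t x y z w))
  rw [norm_mul, norm_mul]
  gcongr
  exact norm_coB401_le hχ n t x y z w

end Majorant

section Limits

variable {ι : Type*} {F : Filter ι} {χ : ι → ℤ → ℂ} {χ' : ℤ → ℂ} {τ : ι → ℝ} {t : ℝ}

theorem tendsto_coLhs (hχ : ∀ m, Tendsto (fun i => χ i m) F (𝓝 (χ' m))) (hτ : Tendsto τ F (𝓝 t))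
    (n : ℕ) (x y z w : ℤ) :
    Tendsto (fun i => coLhs (χ i) n (τ i) x y z w) F (𝓝 (coLhs χ' n t x y z w)) := by
  have ho := fun m => ((continuous_osc m).tendsto t).comp hτ
  unfold coLhs coB2 coB30
  refine ((Tendsto.const_mul _ ?_).add (Tendsto.const_mul _ ?_))
  · split_ifs
    · exact (ho _).mul_const _
    · exact tendsto_const_nhds
  · split_ifs
    · exact ((hχ _).mul (ho _)).mul_const _
    · exact tendsto_const_nhds

theorem tendsto_coRhs (hχ : ∀ m, Tendsto (fun i => χ i m) F (𝓝 (χ' m))) (hτ : Tendsto τ F (𝓝 t))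
    (n : ℕ) (x y z w : ℤ) :
    Tendsto (fun i => coRhs (χ i) n (τ i) x y z w) F (𝓝 (coRhs χ' n t x y z w)) := by
  have ho := fun m => ((continuous_osc m).tendsto t).comp hτ
  unfold coRhs coR3 coB401 coB402
  refine Tendsto.add ?_ (Tendsto.const_mul _ ((Tendsto.const_mul _ ?_).add ?_))
  · split_ifs
    · exact ((hχ _).mul (ho _)).mul_const _
    · exact tendsto_const_nhds
  · split_ifs
    · exact (((hχ _).mul (hχ _)).mul (ho _)).mul_const _
    · exact tendsto_const_nhds
  · split_ifs
    · exact (((hχ _).mul (hχ _)).mul (ho _)).mul_const _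
    · exact tendsto_const_nhds

variable {u : ι → ℤ → ℂ} {u' : ℤ → ℂ}

theorem tendsto_quadForm_coLhs (hb : ∀ i m, ‖χ i m‖ ≤ 1)
    (hχ : ∀ m, Tendsto (fun i => χ i m) F (𝓝 (χ' m))) (hτ : Tendsto τ F (𝓝 t)) (n : ℕ)
    (hu0 : ∀ i, u i 0 = 0) (hu0' : u' 0 = 0) (hu' : l2 u' ≠ ⊤)
    (hu : Tendsto (fun i => l2 (fun k => u i k - u' k)) F (𝓝 0)) (k : ℤ) :
    Tendsto (fun i => quadForm (coLhs (χ i) n (τ i)) (withUnit (u i)) (withUnit (u i))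
      (withUnit (u i)) (withUnit (u i)) k) F (𝓝 (quadForm (coLhs χ' n t) (withUnit u')
      (withUnit u') (withUnit u') (withUnit u') k)) :=
  (lhsMajorant_bound n).tendsto_quadForm lhsConst_ne_top
    (fun i => norm_coLhs_le (hb i) n (τ i)) (tendsto_coLhs hχ hτ n) (l2_withUnit_ne_top hu')
    (by simpa only [withUnit_sub (hu0 _) hu0'] using hu) k

theorem tendsto_quadForm_coRhs (hb : ∀ i m, ‖χ i m‖ ≤ 1)
    (hχ : ∀ m, Tendsto (fun i => χ i m) F (𝓝 (χ' m))) (hτ : Tendsto τ F (𝓝 t)) (n : ℕ)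
    (hu0 : ∀ i, u i 0 = 0) (hu0' : u' 0 = 0) (hu' : l2 u' ≠ ⊤)
    (hu : Tendsto (fun i => l2 (fun k => u i k - u' k)) F (𝓝 0)) (k : ℤ) :
    Tendsto (fun i => quadForm (coRhs (χ i) n (τ i)) (withUnit (u i)) (withUnit (u i))
      (withUnit (u i)) (withUnit (u i)) k) F (𝓝 (quadForm (coRhs χ' n t) (withUnit u')
      (withUnit u') (withUnit u') (withUnit u') k)) :=
  (rhsMajorant_bound n).tendsto_quadForm (rhsConst_ne_top n)
    (fun i => norm_coRhs_le (hb i) n (τ i)) (tendsto_coRhs hχ hτ n) (l2_withUnit_ne_top hu')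
    (by simpa only [withUnit_sub (hu0 _) hu0'] using hu) k

end Limits

/-! ### Compactness and global existence -/

/-- Cauchy–Schwarz in the convolution. The bound depends on the mode but not on N, so each mode is
Lipschitz in time uniformly over the truncations. -/
theorem enorm_galerkin_le (N : ℕ) (t : ℝ) (u : ℤ → ℂ) (k : ℤ) :
    ‖galerkin N t u k‖ₑ ≤ ‖(k : ℂ)‖ₑ * l2 u ^ 2 := by
  have h1 : ‖Complex.I * k / 2 * cutoff N k‖ₑ ≤ ‖(k : ℂ)‖ₑ := by
    rw [enorm_le_iff_norm_le, norm_mul, norm_div, norm_mul, Complex.norm_I, one_mul]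
    calc _ ≤ ‖(k : ℂ)‖ / ‖(2 : ℂ)‖ * 1 := by gcongr; exact norm_cutoff_le N k
      _ ≤ ‖(k : ℂ)‖ := by rw [mul_one, Complex.norm_ofNat]; exact half_le_self (norm_nonneg _)
  have h2 : (∑' a, ‖u a‖ₑ * ‖u (k - a)‖ₑ) ≤ l2 u ^ 2 := by
    rw [← ENNReal.pow_le_pow_left_iff (n := 2) (by norm_num)]
    refine (tsum_mul_sq_le _ _).trans (le_of_eq ?_)
    rw [tsum_shift (fun a => ‖u a‖ₑ ^ 2), ← l2_sq]
    ring
  rw [galerkin, enorm_mul]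
  refine mul_le_mul' h1 (le_trans ?_ h2)
  refine (enorm_sum_le _ _).trans (le_trans (Finset.sum_le_sum fun a _ => ?_)
    (ENNReal.sum_le_tsum (modes N)))
  rw [Finset.sum_congr rfl fun b _ => if_congr (show a + b = k ↔ k - a = b by omega) rfl rfl,
    Finset.sum_ite_eq]
  split_ifs
  · rw [enorm_mul, enorm_osc, one_mul, enorm_mul]
  · simp

/-- The truncation of `u` to the modes `|k| ≤ N`. -/
noncomputable def truncate (N : ℕ) (u : ℤ → ℂ) (k : ℤ) : ℂ := if k ∈ modes N then u k else 0

theorem l2_weight_truncate_le (ω : ℤ → ℝ≥0∞) (N : ℕ) (u : ℤ → ℂ) :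
    l2 (fun k => ω k * ‖truncate N u k‖ₑ) ≤ l2 (fun k => ω k * ‖u k‖ₑ) := by
  refine l2_mono fun k => ?_
  unfold truncate
  split_ifs <;> simp

theorem l2_truncate_le (N : ℕ) (u : ℤ → ℂ) : l2 (truncate N u) ≤ l2 u := by
  refine l2_mono fun k => ?_
  unfold truncate
  split_ifs <;> simp

/-- A sequence of Galerkin solutions with initial value `u₀` that converges in each mode. -/
structure GalerkinLimit (u₀ : ℤ → ℂ) (N : ℕ → ℕ) (V : ℕ → ℝ → ℤ → ℂ) (v : ℝ → ℤ → ℂ) : Prop where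
  size : Tendsto N atTop atTop
  init : ∀ i, V i 0 = truncate (N i) u₀
  supp : ∀ i t, SuppModes (N i) (V i t)
  real : ∀ i t k, V i t (-k) = (starRingEnd ℂ) (V i t k)
  deriv : ∀ i, ∀ t ∈ Icc (0 : ℝ) (N i), ∀ k,
    HasDerivAt (fun τ => V i τ k) (galerkin (N i) t (V i t) k) t
  bound : ∀ i, ∀ t ∈ Icc (0 : ℝ) (N i), l2 (V i t) ≤ l2 u₀
  lim : ∀ t, 0 ≤ t → ∀ k, Tendsto (fun i => V i t k) atTop (𝓝 (v t k))

theorem galerkin_lipschitz {u₀ : ℤ → ℂ} (hl : l2 u₀ ≠ ⊤) {N : ℕ} {V : ℝ → ℤ → ℂ} {T : ℝ}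
    (hd : ∀ t ∈ Icc 0 T, ∀ k, HasDerivAt (fun τ => V τ k) (galerkin N t (V t) k) t)
    (hb : ∀ t ∈ Icc 0 T, l2 (V t) ≤ l2 u₀) (k : ℤ) {t t' : ℝ} (ht : t ∈ Icc 0 T)
    (ht' : t' ∈ Icc 0 T) :
    ‖V t k - V t' k‖ ≤ (‖(k : ℂ)‖ * (l2 u₀).toReal ^ 2) * |t - t'| := by
  refine (convex_Icc 0 T).norm_image_sub_le_of_norm_hasDerivWithin_le (f := fun τ => V τ k)
    (fun τ hτ => (hd τ hτ k).hasDerivWithinAt) (fun τ hτ => ?_) ht' ht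
  have h1 := (enorm_galerkin_le N τ (V τ) k).trans
    (mul_le_mul_right (pow_le_pow_left₀ zero_le (hb τ hτ) 2) _)
  have h2 := ENNReal.toReal_mono (by finiteness) h1
  simpa [ENNReal.toReal_mul, ENNReal.toReal_pow] using h2

/-- The values at rational times and all modes lie in a countable product of closed discs, which is
sequentially compact. The Lipschitz bound in time, uniform in N for each mode, extends convergence
from rational to all nonnegative times. -/
theorem exists_galerkinLimit {u₀ : ℤ → ℂ} (h0 : u₀ 0 = 0)
    (hr : ∀ k, u₀ (-k) = (starRingEnd ℂ) (u₀ k)) (hl : l2 u₀ ≠ ⊤) :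
    ∃ N V v, GalerkinLimit u₀ N V v := by
  have hsol : ∀ N : ℕ, ∃ v : ℝ → ℤ → ℂ, v 0 = truncate N u₀ ∧ (∀ t, SuppModes N (v t)) ∧
      (∀ t k, v t (-k) = (starRingEnd ℂ) (v t k)) ∧
      (∀ t ∈ Icc (0 : ℝ) N, ∀ k, HasDerivAt (fun τ => v τ k) (galerkin N t (v t) k) t) ∧
      ∀ t ∈ Icc (0 : ℝ) N, l2 (v t) = l2 (truncate N u₀) := by
    intro N
    refine exists_galerkin_solution N ⟨?_, fun k hk => if_neg hk⟩ (fun k => ?_) (by positivity)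
    · simp [h0]
    · have : -k ∈ modes N ↔ k ∈ modes N := by simp [mem_modes]
      simp only [this, hr]
      split_ifs <;> simp
  choose V hV0 hVs hVr hVd hVb using hsol
  have hb : ∀ N : ℕ, ∀ t ∈ Icc (0 : ℝ) N, l2 (V N t) ≤ l2 u₀ := fun N t ht =>
    (hVb N t ht).le.trans (l2_truncate_le N u₀)
  set R := (l2 u₀).toReal with hR
  have hR0 : 0 ≤ R := ENNReal.toReal_nonneg
  -- The N-th solution is controlled only on [0, N]; for a fixed nonnegative time the default value
  -- 0 is used for finitely many N only.
  let X : ℕ → ℚ × ℤ → ℂ := fun N p => if (p.1 : ℝ) ∈ Icc (0 : ℝ) N then V N p.1 p.2 else 0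
  have hX : ∀ N, X N ∈ Set.pi univ fun _ : ℚ × ℤ => Metric.closedBall (0 : ℂ) R := by
    intro N p _
    simp only [X, mem_closedBall_zero_iff]
    split_ifs with h
    · have h1 := ENNReal.toReal_mono hl ((enorm_le_l2 (V N p.1) p.2).trans (hb N _ h))
      simpa using h1
    · simpa using hR0
  obtain ⟨a, -, φ, hφ, ha⟩ := (isCompact_univ_pi fun _ : ℚ × ℤ =>
    isCompact_closedBall (0 : ℂ) R).tendsto_subseq hX
  rw [tendsto_pi_nhds] at ha
  have hφ' := hφ.tendsto_atTop
  have hlim : ∀ t : ℝ, ∀ k, ∃ z, 0 ≤ t → Tendsto (fun i => V (φ i) t k) atTop (𝓝 z) := by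
    intro t k
    by_cases ht : 0 ≤ t
    swap
    · exact ⟨0, fun h => absurd h ht⟩
    have hc : CauchySeq fun i => V (φ i) t k := by
      rw [Metric.cauchySeq_iff']
      intro ε hε
      set L := ‖(k : ℂ)‖ * R ^ 2 with hL
      have hL0 : 0 ≤ L := by positivity
      -- Here `L + 1` avoids division by zero. Replacing t by q costs ε/4 at each of two indices,
      -- and convergence at q accounts for two further quarters.
      obtain ⟨q, hq1, hq2⟩ := exists_rat_btwn (show t < t + ε / (4 * (L + 1)) by
        have : 0 < ε / (4 * (L + 1)) := by positivity
        linarith)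
      have hq : L * |t - q| ≤ ε / 4 := by
        have h1 : |t - q| ≤ ε / (4 * (L + 1)) := by
          rw [abs_sub_comm, abs_of_pos (by linarith)]; linarith
        calc L * |t - q| ≤ (L + 1) * (ε / (4 * (L + 1))) := by gcongr; linarith
          _ = ε / 4 := by field_simp
      have h2 := (ha (q, k)).cauchySeq
      rw [Metric.cauchySeq_iff'] at h2
      obtain ⟨I, hI⟩ := h2 (ε / 4) (by positivity)
      obtain ⟨m, hm⟩ := exists_nat_ge (q : ℝ)
      obtain ⟨J, hJ⟩ := (hφ'.eventually_ge_atTop m).exists_forall_of_atTop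
      have hmem : ∀ i, J ≤ i → t ∈ Icc (0 : ℝ) (φ i) ∧ (q : ℝ) ∈ Icc (0 : ℝ) (φ i) := by
        intro i hi
        have h3 : (m : ℝ) ≤ φ i := by exact_mod_cast hJ i hi
        exact ⟨⟨ht, by linarith⟩, ⟨by linarith, by linarith⟩⟩
      have hclose : ∀ i, J ≤ i → dist (V (φ i) t k) (X (φ i) (q, k)) ≤ ε / 4 := by
        intro i hi
        obtain ⟨m1, m2⟩ := hmem i hi
        simp only [X]
        rw [if_pos m2, dist_eq_norm]
        exact (galerkin_lipschitz hl (hVd (φ i)) (hb (φ i)) k m1 m2).trans hq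
      refine ⟨max I J, fun i hi => ?_⟩
      have d1 := hclose i ((le_max_right _ _).trans hi)
      have d2 := hclose (max I J) (le_max_right _ _)
      have d3 := hI i ((le_max_left _ _).trans hi)
      have d4 := hI (max I J) (le_max_left _ _)
      simp only [Function.comp] at d3 d4
      have t1 := dist_triangle4 (V (φ i) t k) (X (φ i) (q, k)) (X (φ (max I J)) (q, k))
        (V (φ (max I J)) t k)
      have t2 := dist_triangle_right (X (φ i) (q, k)) (X (φ (max I J)) (q, k)) (X (φ I) (q, k))
      rw [dist_comm (X (φ (max I J)) (q, k)) (V (φ (max I J)) t k)] at t1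
      linarith
    obtain ⟨z, hz⟩ := cauchySeq_tendsto_of_complete hc
    exact ⟨z, fun _ => hz⟩
  choose v hv using hlim
  exact ⟨φ, fun i => V (φ i), v, hφ', fun i => hV0 _, fun i => hVs _, fun i => hVr _,
    fun i => hVd _, fun i => hb _, fun t ht k => hv t k ht⟩

/-! ### Tightness, strong convergence and continuity of the Galerkin limit -/

section Limit

variable {u₀ : ℤ → ℂ} {N : ℕ → ℕ} {V : ℕ → ℝ → ℤ → ℂ} {v : ℝ → ℤ → ℂ}

theorem GalerkinLimit.eventually_mem (h : GalerkinLimit u₀ N V v) (T : ℝ) :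
    ∀ᶠ i in atTop, T ≤ N i := by
  obtain ⟨m, hm⟩ := exists_nat_ge T
  filter_upwards [h.size.eventually_ge_atTop m] with i hi
  exact hm.trans (by exact_mod_cast hi)

theorem GalerkinLimit.l2_le (h : GalerkinLimit u₀ N V v) {t : ℝ} (ht : 0 ≤ t) :
    l2 (v t) ≤ l2 u₀ :=
  l2_le_of_tendsto ((h.eventually_mem t).mono fun i hi => h.bound i t ⟨ht, hi⟩) (h.lim t ht)

theorem GalerkinLimit.zero_mode (h : GalerkinLimit u₀ N V v) {t : ℝ} (ht : 0 ≤ t) : v t 0 = 0 :=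
  tendsto_nhds_unique (h.lim t ht 0)
    ((tendsto_const_nhds (x := (0 : ℂ))).congr fun i => ((h.supp i t).1).symm)

theorem GalerkinLimit.conj (h : GalerkinLimit u₀ N V v) {t : ℝ} (ht : 0 ≤ t) (k : ℤ) :
    v t (-k) = (starRingEnd ℂ) (v t k) :=
  tendsto_nhds_unique (h.lim t ht (-k))
    (((Complex.continuous_conj.tendsto _).comp (h.lim t ht k)).congr fun i => (h.real i t k).symm)

theorem GalerkinLimit.initial (h : GalerkinLimit u₀ N V v) : v 0 = u₀ := by
  ext k
  refine tendsto_nhds_unique (h.lim 0 le_rfl k) (tendsto_const_nhds.congr' ?_)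
  filter_upwards [h.size.eventually_ge_atTop k.natAbs] with i hi
  rw [h.init i, truncate, if_pos]
  rw [mem_modes, Int.abs_eq_natAbs]; exact_mod_cast hi

theorem GalerkinLimit.lipschitz (h : GalerkinLimit u₀ N V v) (hl : l2 u₀ ≠ ⊤) (k : ℤ) {t t' : ℝ}
    (ht : 0 ≤ t) (ht' : 0 ≤ t') :
    ‖v t k - v t' k‖ ≤ (‖(k : ℂ)‖ * (l2 u₀).toReal ^ 2) * |t - t'| := by
  refine le_of_tendsto ((h.lim t ht k).sub (h.lim t' ht' k)).norm ?_
  filter_upwards [h.eventually_mem t, h.eventually_mem t'] with i hi hi'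
  exact galerkin_lipschitz hl (h.deriv i) (h.bound i) k ⟨ht, hi⟩ ⟨ht', hi'⟩

theorem GalerkinLimit.continuous_mode (h : GalerkinLimit u₀ N V v) (hl : l2 u₀ ≠ ⊤) (k : ℤ)
    {t : ℝ} (ht : 0 ≤ t) : Tendsto (fun τ => v τ k) (𝓝[Ici 0] t) (𝓝 (v t k)) := by
  rw [tendsto_iff_norm_sub_tendsto_zero]
  have h1 : Tendsto (fun τ => (‖(k : ℂ)‖ * (l2 u₀).toReal ^ 2) * |τ - t|) (𝓝[Ici 0] t) (𝓝 0) := by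
    have : Continuous fun τ => (‖(k : ℂ)‖ * (l2 u₀).toReal ^ 2) * |τ - t| := by fun_prop
    simpa using (this.tendsto t).mono_left nhdsWithin_le_nhds
  refine squeeze_zero' (.of_forall fun _ => norm_nonneg _) ?_ h1
  filter_upwards [self_mem_nhdsWithin] with τ hτ
  exact h.lipschitz hl k hτ ht

/-- The weighted bound is a fixed factor times the damped initial norm plus M^(s-1). Both tend to 0
as M grows, the second because s < 1, so one M serves all sufficiently large truncations; the limit
inherits the bound by lower semicontinuity. -/
theorem GalerkinLimit.tight (h : GalerkinLimit u₀ N V v) (hl : l2 u₀ ≠ ⊤) {s : ℝ} (hs0 : 0 ≤ s)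
    (hs1 : s < 1) (hs : l2 (fun k => sobWeight s k * ‖u₀ k‖ₑ) ≠ ⊤) (n : ℕ) {T : ℝ} (hT : 0 ≤ T)
    {ε : ℝ≥0∞} (hε : 0 < ε) :
    ∃ M : ℕ, M ≠ 0 ∧
      (∀ i, T ≤ N i → ∀ t ∈ Icc 0 T, l2 (fun k => tailWeight s M k * ‖V i t k‖ₑ) ≤ ε) ∧
      ∀ t ∈ Icc 0 T, l2 (fun k => tailWeight s M k * ‖v t k‖ₑ) ≤ ε := by
  set B : ℝ≥0 := (l2 u₀ + 1).toNNReal with hB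
  have hB' : (B : ℝ≥0∞) = l2 u₀ + 1 := ENNReal.coe_toNNReal (by finiteness)
  set A := growth n B T with hA
  have hAt : A ≠ ⊤ := growth_ne_top n B T
  set κ : ℕ → ℝ≥0 := fun M => ⟨(M : ℝ) ^ (s - 1), by positivity⟩ with hκ
  have h1 : Tendsto (fun M : ℕ => (κ M : ℝ≥0∞)) atTop (𝓝 0) := by
    rw [← ENNReal.coe_zero, ENNReal.tendsto_coe, ← NNReal.tendsto_coe]
    have := (tendsto_rpow_neg_atTop (show 0 < 1 - s by linarith)).comp
      (tendsto_natCast_atTop_atTop (R := ℝ))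
    change Tendsto (fun M : ℕ => (M : ℝ) ^ (s - 1)) atTop (𝓝 ((0 : ℝ≥0) : ℝ))
    simpa [Function.comp_def, neg_sub] using this
  have h2 : Tendsto (fun M : ℕ => A * (l2 (fun k => tailWeight s M k * ‖u₀ k‖ₑ) + κ M)) atTop
      (𝓝 0) := by
    have := ENNReal.Tendsto.const_mul (a := A) ((tendsto_l2_tailWeight hs).add h1) (Or.inr hAt)
    simpa using this
  obtain ⟨M, hM, hM0⟩ := ((h2.eventually_le_const hε).and (eventually_ge_atTop 1)).exists
  have hM0' : M ≠ 0 := by omega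
  have key : ∀ i, T ≤ N i → ∀ t ∈ Icc 0 T, l2 (fun k => tailWeight s M k * ‖V i t k‖ₑ) ≤ ε := by
    intro i hi t ht
    have hsub : Icc 0 T ⊆ Icc (0 : ℝ) (N i) := Icc_subset_Icc_right hi
    refine (galerkin_weight_bound n hT (h.supp i) (fun τ hτ => h.deriv i τ (hsub hτ))
      (M := B) (fun τ hτ => ?_) (tailWeight_isWeight hs0 hs1.le hM0') t ht).trans (le_trans ?_ hM)
    · rw [hB']; gcongr; exact h.bound i τ (hsub hτ)
    · gcongr
      rw [h.init i]
      exact l2_weight_truncate_le _ _ _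
  refine ⟨M, hM0', key, fun t ht => ?_⟩
  have h3 := l2_le_of_tendsto (F := atTop)
    (f := fun i k => ((tailWeight s M k : ℝ) : ℂ) * V i t k)
    (g := fun k => ((tailWeight s M k : ℝ) : ℂ) * v t k) (C := ε)
    ((h.eventually_mem T).mono fun i hi => ?_) fun k => (h.lim t ht.1 k).const_mul _
  · refine le_trans (le_of_eq ?_) h3
    exact l2_congr fun k => by rw [enorm_weight_mul, enorm_eq_self]
  · refine le_trans (le_of_eq ?_) (key i hi t ht)
    exact l2_congr fun k => by rw [enorm_weight_mul, enorm_eq_self]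

theorem sobWeight_zero (k : ℤ) : sobWeight 0 k = 1 := by
  ext
  change |(k : ℝ)| ^ (0 : ℝ) = 1
  exact Real.rpow_zero _

theorem l2_sobWeight_zero (u : ℤ → ℂ) : l2 (fun k => sobWeight 0 k * ‖u k‖ₑ) = l2 u :=
  l2_congr fun k => by simp [sobWeight_zero]

theorem l2_tailPart_le_zero {M : ℕ} (hM : M ≠ 0) (u : ℤ → ℂ) :
    l2 (tailPart M u) ≤ l2 (fun k => tailWeight 0 M k * ‖u k‖ₑ) := by
  simpa [sobWeight_zero] using l2_tailPart_le 0 hM u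

/-- Tightness at s = 0 upgrades modewise to ℓ² convergence. The Galerkin solutions do not involve n,
so any value, here 0, may be used in the auxiliary estimate. -/
theorem GalerkinLimit.strong (h : GalerkinLimit u₀ N V v) (hl : l2 u₀ ≠ ⊤) {t : ℝ} (ht : 0 ≤ t) :
    Tendsto (fun i => l2 (fun k => V i t k - v t k)) atTop (𝓝 0) := by
  refine tendsto_l2_of_tails (h.lim t ht) fun ε hε => ?_
  obtain ⟨M, hM, h1, h2⟩ := h.tight hl le_rfl (zero_lt_one) (by rwa [l2_sobWeight_zero]) 0 ht hε
  refine ⟨M, (l2_tailPart_le_zero hM _).trans (h2 t ⟨ht, le_rfl⟩), ?_⟩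
  filter_upwards [h.eventually_mem t] with i hi
  exact (l2_tailPart_le_zero hM _).trans (h1 i hi t ⟨ht, le_rfl⟩)

theorem GalerkinLimit.continuous_sob (h : GalerkinLimit u₀ N V v) (hl : l2 u₀ ≠ ⊤) {s : ℝ}
    (hs0 : 0 ≤ s) (hs1 : s < 1) (hs : l2 (fun k => sobWeight s k * ‖u₀ k‖ₑ) ≠ ⊤) {t : ℝ}
    (ht : 0 ≤ t) :
    Tendsto (fun τ => l2 (fun k => ((sobWeight s k : ℝ) : ℂ) * v τ k -
      ((sobWeight s k : ℝ) : ℂ) * v t k)) (𝓝[Ici 0] t) (𝓝 0) := by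
  refine tendsto_l2_of_tails (fun k => (h.continuous_mode hl k ht).const_mul _) fun ε hε => ?_
  obtain ⟨M, hM, -, h2⟩ := h.tight hl hs0 hs1 hs 0 (T := t + 1) (by linarith) hε
  refine ⟨M, (l2_tailPart_le s hM _).trans (h2 t ⟨ht, by linarith⟩), ?_⟩
  have : Iic (t + 1) ∈ 𝓝[Ici 0] t := mem_nhdsWithin_of_mem_nhds (Iic_mem_nhds (by linarith))
  filter_upwards [this, self_mem_nhdsWithin] with τ hτ hτ'
  exact (l2_tailPart_le s hM _).trans (h2 τ ⟨hτ', hτ⟩)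

theorem GalerkinLimit.continuous_l2 (h : GalerkinLimit u₀ N V v) (hl : l2 u₀ ≠ ⊤) {t : ℝ}
    (ht : 0 ≤ t) :
    Tendsto (fun τ => l2 (fun k => v τ k - v t k)) (𝓝[Ici 0] t) (𝓝 0) := by
  have := h.continuous_sob hl le_rfl zero_lt_one (by rwa [l2_sobWeight_zero]) ht
  simpa [sobWeight_zero] using this

/-- Below M the weight is at most M^s and the L₂ norm pays for it; from M on it equals the tail
weight. -/
theorem GalerkinLimit.sob_ne_top (h : GalerkinLimit u₀ N V v) (hl : l2 u₀ ≠ ⊤) {s : ℝ}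
    (hs0 : 0 ≤ s) (hs1 : s < 1) (hs : l2 (fun k => sobWeight s k * ‖u₀ k‖ₑ) ≠ ⊤) {t : ℝ}
    (ht : 0 ≤ t) : l2 (fun k => sobWeight s k * ‖v t k‖ₑ) ≠ ⊤ := by
  obtain ⟨M, hM, -, h2⟩ := h.tight hl hs0 hs1 hs 0 ht one_pos
  have h3 : l2 (fun k => (sobWeight s k : ℝ≥0∞) * ‖v t k‖ₑ) ≤
      (sobWeight s M : ℝ≥0∞) * l2 (v t) + l2 (fun k => tailWeight s M k * ‖v t k‖ₑ) := by
    rw [← l2_enorm (v t), ← l2_const_mul_ennreal]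
    refine le_trans (l2_mono fun k => ?_) (l2_add_le_ennreal _ _)
    simp only [enorm_eq_self]
    rcases le_total (M : ℤ) |k| with hk | hk
    · rw [tailWeight_of_le s hM hk]; exact le_add_self
    · refine le_trans ?_ le_self_add
      gcongr
      rw [← NNReal.coe_le_coe]
      change |(k : ℝ)| ^ s ≤ |((M : ℤ) : ℝ)| ^ s
      have : |(k : ℝ)| ≤ |((M : ℤ) : ℝ)| := by
        rw [abs_of_nonneg (a := ((M : ℤ) : ℝ)) (by positivity)]
        exact_mod_cast hk
      gcongr
  refine ne_top_of_le_ne_top ?_ h3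
  have h4 := ne_top_of_le_ne_top hl (h.l2_le ht)
  have h5 := ne_top_of_le_ne_top ENNReal.one_ne_top (h2 t ⟨ht, le_rfl⟩)
  finiteness

end Limit

/-! ### Passage to the limit in the integrated third form -/

theorem continuousOn_quadForm_coRhs {χ : ℤ → ℂ} (hχ : ∀ m, ‖χ m‖ ≤ 1) (n : ℕ) {J : Set ℝ}
    {v : ℝ → ℤ → ℂ} (h0 : ∀ t, v t 0 = 0) (hl : ∀ t ∈ J, l2 (v t) ≠ ⊤)
    (hc : ∀ t ∈ J, Tendsto (fun τ => l2 (fun k => v τ k - v t k)) (𝓝[J] t) (𝓝 0)) (k : ℤ) :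
    ContinuousOn (fun t => quadForm (coRhs χ n t) (withUnit (v t)) (withUnit (v t))
      (withUnit (v t)) (withUnit (v t)) k) J := fun t ht =>
  tendsto_quadForm_coRhs (fun _ => hχ) (fun _ => tendsto_const_nhds)
    (tendsto_id.mono_left nhdsWithin_le_nhds) n h0 (h0 t) (hl t ht) (hc t ht) k

theorem norm_quadForm_coRhs_le {χ : ℤ → ℂ} (hχ : ∀ m, ‖χ m‖ ≤ 1) (n : ℕ) (t : ℝ) {u : ℤ → ℂ}
    {M : ℝ≥0∞} (hM : M ≠ ⊤) (hu : l2 u ≤ M) (k : ℤ) :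
    ‖quadForm (coRhs χ n t) (withUnit u) (withUnit u) (withUnit u) (withUnit u) k‖ ≤
      (rhsConst n * (M + 1) ^ 4).toReal := by
  have h1 := rhsConst_ne_top n
  rw [← toReal_enorm]
  refine ENNReal.toReal_mono (by finiteness) ((enorm_le_l2 _ k).trans
    (((coRhs_bound hχ n t).l2_quadForm_le _ _ _ _).trans ?_))
  have h2 : l2 (withUnit u) ≤ M + 1 := (l2_withUnit_le u).trans (by gcongr)
  calc _ ≤ rhsConst n * ((M + 1) * (M + 1) * (M + 1) * (M + 1)) := by gcongr
    _ = _ := by ring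

/-- The truncated third form is integrated in time. The cutoffs tend to 1, the Galerkin solutions
converge in ℓ² at each time, and the integrands are uniformly bounded because the L₂ norm is, so
dominated convergence applies. The limit is fixed before n is chosen: one function solves the third
form for every n. -/
theorem GalerkinLimit.third {u₀ : ℤ → ℂ} {N : ℕ → ℕ} {V : ℕ → ℝ → ℤ → ℂ} {v : ℝ → ℤ → ℂ}
    (h : GalerkinLimit u₀ N V v) (hl : l2 u₀ ≠ ⊤) (n : ℕ) {t : ℝ} (ht : 0 ≤ t) {k : ℤ}
    (hk : k ≠ 0) :
    IntervalIntegrable (fun τ => rhs n τ (v τ) k) volume 0 t ∧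
      lhs n t (v t) k - lhs n 0 (v 0) k = -(Complex.I / 6) * ∫ τ in (0 : ℝ)..t, rhs n τ (v τ) k := by
  have hvl : ∀ τ, 0 ≤ τ → l2 (v τ) ≠ ⊤ := fun τ hτ => ne_top_of_le_ne_top hl (h.l2_le hτ)
  set P : ℝ → ℂ := fun τ => quadForm (coRhs 1 n τ) (withUnit (v τ)) (withUnit (v τ))
    (withUnit (v τ)) (withUnit (v τ)) k with hP
  set PN : ℕ → ℝ → ℂ := fun i τ => quadForm (coRhs (cutoff (N i)) n τ) (withUnit (V i τ))
    (withUnit (V i τ)) (withUnit (V i τ)) (withUnit (V i τ)) k with hPN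
  set ZN : ℕ → ℝ → ℂ := fun i τ => V i τ k + quadForm (coLhs (cutoff (N i)) n τ)
    (withUnit (V i τ)) (withUnit (V i τ)) (withUnit (V i τ)) (withUnit (V i τ)) k with hZN
  have hPe : ∀ τ, 0 ≤ τ → P τ = rhs n τ (v τ) k := fun τ hτ => quadForm_coRhs hk n τ (hvl τ hτ)
  have hIcc : uIcc 0 t = Icc 0 t := uIcc_of_le ht
  have hcut : ∀ m, Tendsto (fun i => cutoff (N i) m) atTop (𝓝 ((1 : ℤ → ℂ) m)) := by
    intro m
    refine tendsto_const_nhds.congr' ?_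
    filter_upwards [h.size.eventually_ge_atTop m.natAbs] with i hi
    rw [cutoff, if_pos (by rw [Int.abs_eq_natAbs]; exact_mod_cast hi)]
    rfl
  have hPc : ContinuousOn P (Icc 0 t) := by
    -- Nothing is known about v at negative times; `max τ 0` provides mean value zero at all times
    -- without changing v on the interval.
    have : ContinuousOn (fun τ => quadForm (coRhs 1 n τ) (withUnit (v (max τ 0)))
        (withUnit (v (max τ 0))) (withUnit (v (max τ 0))) (withUnit (v (max τ 0))) k) (Icc 0 t) := by
      refine continuousOn_quadForm_coRhs one_multiplier n
        (fun τ => h.zero_mode (le_max_right _ _)) (fun τ _ => hvl _ (le_max_right _ _))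
        (fun τ hτ => ?_) k
      have h1 : Tendsto (fun τ' : ℝ => max τ' 0) (𝓝[Icc 0 t] τ) (𝓝[Ici 0] (max τ 0)) := by
        refine tendsto_nhdsWithin_iff.2 ⟨?_, .of_forall fun τ' => mem_Ici.2 (le_max_right τ' 0)⟩
        exact ((continuous_id.max continuous_const).tendsto τ).mono_left nhdsWithin_le_nhds
      exact (h.continuous_l2 hl (le_max_right τ 0)).comp h1
    exact this.congr fun τ hτ => by simp only [hP, max_eq_left hτ.1]
  have hint : IntervalIntegrable (fun τ => rhs n τ (v τ) k) volume 0 t := by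
    have h1 : IntervalIntegrable P volume 0 t := (hIcc ▸ hPc).intervalIntegrable
    refine h1.congr fun τ hτ => ?_
    rw [uIoc_of_le ht] at hτ
    exact hPe τ hτ.1.le
  refine ⟨hint, ?_⟩
  have hgal : ∀ᶠ i in atTop, ZN i t - ZN i 0 = -(Complex.I / 6) * ∫ τ in (0 : ℝ)..t, PN i τ ∧
      ContinuousOn (PN i) (Icc 0 t) := by
    filter_upwards [h.eventually_mem t, h.size.eventually_ge_atTop k.natAbs] with i hi hki
    have hsub : Icc 0 t ⊆ Icc (0 : ℝ) (N i) := Icc_subset_Icc_right hi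
    have hc : ContinuousOn (PN i) (Icc 0 t) := by
      refine continuousOn_quadForm_coRhs (norm_cutoff_le _) n (fun τ => (h.supp i τ).1)
        (fun τ _ => l2_ne_top_of_suppModes (h.supp i τ)) (fun τ hτ => ?_) k
      refine tendsto_l2_of_tails (fun m =>
        (h.deriv i τ (hsub hτ) m).continuousAt.continuousWithinAt) fun ε hε => ?_
      -- A Galerkin solution has no modes beyond `N i`, so modewise continuity already gives
      -- continuity in ℓ².
      have hz : ∀ τ, tailPart (N i) (V i τ) = 0 := fun τ => by
        ext m
        unfold tailPart
        split_ifs with hm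
        · exact (h.supp i τ).2 m fun h' => absurd (mem_modes.1 h') (not_le.2 hm)
        · rfl
      have hz' : ∀ τ, l2 (tailPart (N i) (V i τ)) ≤ ε := fun τ => by
        rw [hz, l2_zero_iff.2 rfl]; exact zero_le
      exact ⟨N i, hz' τ, .of_forall hz'⟩
    refine ⟨?_, hc⟩
    rw [← intervalIntegral.integral_const_mul]
    refine (intervalIntegral.integral_eq_sub_of_hasDerivAt (f := ZN i) (fun τ hτ => ?_) ?_).symm
    · rw [hIcc] at hτ
      exact hasDerivAt_third n (h.supp i) (h.deriv i τ (hsub hτ)) hk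
        (mem_modes.2 (by rw [Int.abs_eq_natAbs]; exact_mod_cast hki))
    · exact ((hIcc ▸ hc).intervalIntegrable).const_mul _
  have hZlim : ∀ τ, 0 ≤ τ → Tendsto (fun i => ZN i τ) atTop (𝓝 (lhs n τ (v τ) k)) := by
    intro τ hτ
    rw [← quadForm_coLhs hk n τ (hvl τ hτ)]
    exact (h.lim τ hτ k).add (tendsto_quadForm_coLhs (fun i => norm_cutoff_le _) hcut
      tendsto_const_nhds n (fun i => (h.supp i τ).1) (h.zero_mode hτ) (hvl τ hτ)
      (h.strong hl hτ) k)
  have hIlim : Tendsto (fun i => ∫ τ in (0 : ℝ)..t, PN i τ) atTop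
      (𝓝 (∫ τ in (0 : ℝ)..t, rhs n τ (v τ) k)) := by
    refine intervalIntegral.tendsto_integral_filter_of_dominated_convergence
      (fun _ => (rhsConst n * (l2 u₀ + 1) ^ 4).toReal) ?_ ?_ (by simp) ?_
    · filter_upwards [hgal] with i hi
      rw [uIoc_of_le ht]
      exact (hi.2.mono Ioc_subset_Icc_self).aestronglyMeasurable measurableSet_Ioc
    · filter_upwards [h.eventually_mem t] with i hi
      refine .of_forall fun τ hτ => ?_
      rw [uIoc_of_le ht] at hτ
      exact norm_quadForm_coRhs_le (norm_cutoff_le _) n τ hl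
        (h.bound i τ ⟨hτ.1.le, hτ.2.trans hi⟩) k
    · refine .of_forall fun τ hτ => ?_
      rw [uIoc_of_le ht] at hτ
      rw [← hPe τ hτ.1.le]
      exact tendsto_quadForm_coRhs (fun i => norm_cutoff_le _) hcut
        tendsto_const_nhds n (fun i => (h.supp i τ).1) (h.zero_mode hτ.1.le) (hvl τ hτ.1.le)
        (h.strong hl hτ.1.le) k
  refine tendsto_nhds_unique ((hZlim t ht).sub (hZlim 0 le_rfl)) ?_
  refine (hIlim.const_mul (-(Complex.I / 6))).congr' ?_
  filter_upwards [hgal] with i hi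
  exact hi.1.symm

/-! ### The Sobolev norms as weighted `ℓ²` norms -/

/-- The norm of `Ḣ^s` with values in `[0, ∞]`. -/
noncomputable def sobNorm (s : ℝ) (u : ℤ → ℂ) : ℝ≥0∞ :=
  l2 fun k => (sobWeight s k : ℝ≥0∞) * ‖u k‖ₑ

theorem sobNorm_zero (u : ℤ → ℂ) : sobNorm 0 u = l2 u := l2_sobWeight_zero u

theorem sobNorm_sq (s : ℝ) {u : ℤ → ℂ} (h0 : u 0 = 0) :
    sobNorm s u ^ 2 =
      ∑' k : {k : ℤ // k ≠ 0}, (((sobWeight s k * ‖u k‖₊) ^ 2 : ℝ≥0) : ℝ≥0∞) := by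
  rw [sobNorm, l2_sq, ← tsum_subtype_eq_of_support_subset (s := {k : ℤ | k ≠ 0})
    (f := fun k => ‖(sobWeight s k : ℝ≥0∞) * ‖u k‖ₑ‖ₑ ^ 2)]
  · refine tsum_congr fun k => ?_
    simp [enorm_eq_nnnorm]
  · intro k hk h
    exact hk (by simp [h, h0])

theorem coe_sobWeight_sq (s : ℝ) (u : ℤ → ℂ) (k : ℤ) :
    (((sobWeight s k * ‖u k‖₊) ^ 2 : ℝ≥0) : ℝ) = |(k : ℝ)| ^ (2 * s) * ‖u k‖ ^ 2 := by
  rw [NNReal.coe_pow, NNReal.coe_mul, mul_pow, coe_nnnorm]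
  congr 1
  change (|(k : ℝ)| ^ s) ^ 2 = _
  rw [mul_comm 2 s, Real.rpow_mul (abs_nonneg _)]
  norm_cast

theorem memHdot_iff {s : ℝ} {u : ℤ → ℂ} :
    MemHdot s u ↔ u 0 = 0 ∧ (∀ k, u (-k) = (starRingEnd ℂ) (u k)) ∧ sobNorm s u ≠ ⊤ := by
  refine and_congr_right fun h0 => and_congr_right fun _ => ?_
  simp only [← coe_sobWeight_sq]
  rw [← ENNReal.tsum_coe_ne_top_iff_summable_coe, ← sobNorm_sq s h0]
  simp

theorem hnorm_eq (s : ℝ) {u : ℤ → ℂ} (h0 : u 0 = 0) : hnorm s u = (sobNorm s u).toReal := by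
  simp only [hnorm, ← coe_sobWeight_sq]
  rw [← Real.sqrt_sq (ENNReal.toReal_nonneg (a := sobNorm s u)), ← ENNReal.toReal_pow,
    sobNorm_sq s h0, ENNReal.tsum_toReal_eq (fun _ => ENNReal.coe_ne_top)]
  rfl

theorem sobNorm_add_le (s : ℝ) (u v : ℤ → ℂ) : sobNorm s (u + v) ≤ sobNorm s u + sobNorm s v := by
  refine le_trans (l2_mono fun k => ?_) (l2_add_le_ennreal _ _)
  simp only [enorm_eq_self, Pi.add_apply, ← mul_add]
  gcongr
  exact enorm_add_le _ _

theorem sobNorm_neg (s : ℝ) (u : ℤ → ℂ) : sobNorm s (-u) = sobNorm s u := by simp [sobNorm]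

theorem MemHdot.add {s : ℝ} {u v : ℤ → ℂ} (hu : MemHdot s u) (hv : MemHdot s v) :
    MemHdot s (u + v) := by
  rw [memHdot_iff] at *
  refine ⟨by simp [hu.1, hv.1], fun k => by simp [hu.2.1, hv.2.1], ?_⟩
  have h1 := hu.2.2
  have h2 := hv.2.2
  exact ne_top_of_le_ne_top (by finiteness) (sobNorm_add_le s u v)

theorem MemHdot.neg {s : ℝ} {u : ℤ → ℂ} (hu : MemHdot s u) : MemHdot s (-u) := by
  rw [memHdot_iff] at *
  exact ⟨by simp [hu.1], fun k => by simp [hu.2.1], by rw [sobNorm_neg]; exact hu.2.2⟩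

theorem MemHdot.sub {s : ℝ} {u v : ℤ → ℂ} (hu : MemHdot s u) (hv : MemHdot s v) :
    MemHdot s (u - v) := by
  rw [sub_eq_add_neg]; exact hu.add hv.neg

theorem l2_le_sobNorm {s : ℝ} (hs : 0 ≤ s) {u : ℤ → ℂ} (h0 : u 0 = 0) : l2 u ≤ sobNorm s u := by
  refine l2_mono fun k => ?_
  rw [enorm_eq_self]
  by_cases hk : k = 0
  · simp [hk, h0]
  · refine le_mul_of_one_le_left' ?_
    rw [ENNReal.one_le_coe_iff, ← NNReal.coe_le_coe]
    refine Real.one_le_rpow ?_ hs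
    exact_mod_cast Int.one_le_abs hk

theorem MemHdot.l2_ne_top {s : ℝ} (hs : 0 ≤ s) {u : ℤ → ℂ} (hu : MemHdot s u) : l2 u ≠ ⊤ :=
  ne_top_of_le_ne_top (memHdot_iff.1 hu).2.2 (l2_le_sobNorm hs hu.1)

theorem contHdot_iff {s : ℝ} {J : Set ℝ} {v : ℝ → ℤ → ℂ} :
    ContHdot s J v ↔ (∀ t ∈ J, MemHdot s (v t)) ∧
      ∀ t ∈ J, Tendsto (fun τ => sobNorm s (v τ - v t)) (𝓝[J] t) (𝓝 0) := by
  refine and_congr_right fun hm => forall₂_congr fun t ht => ?_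
  have h1 : (fun τ => hnorm s (v τ - v t)) =ᶠ[𝓝[J] t] fun τ => (sobNorm s (v τ - v t)).toReal := by
    filter_upwards [self_mem_nhdsWithin] with τ hτ
    exact hnorm_eq s ((hm τ hτ).sub (hm t ht)).1
  rw [tendsto_congr' h1]
  constructor
  · intro h
    have h2 := ENNReal.tendsto_ofReal h
    rw [ENNReal.ofReal_zero] at h2
    refine h2.congr' ?_
    filter_upwards [self_mem_nhdsWithin] with τ hτ
    exact ENNReal.ofReal_toReal (memHdot_iff.1 ((hm τ hτ).sub (hm t ht))).2.2
  · intro h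
    exact (ENNReal.tendsto_toReal ENNReal.zero_ne_top).comp h

theorem ContHdot.mono {s : ℝ} {I J : Set ℝ} {v : ℝ → ℤ → ℂ} (h : ContHdot s J v) (hI : I ⊆ J) :
    ContHdot s I v :=
  ⟨fun t ht => h.1 t (hI ht), fun t ht => (h.2 t (hI ht)).mono_left (nhdsWithin_mono t hI)⟩

theorem ContHdot.tendsto_l2 {s : ℝ} (hs : 0 ≤ s) {J : Set ℝ} {v : ℝ → ℤ → ℂ}
    (h : ContHdot s J v) {t : ℝ} (ht : t ∈ J) :
    Tendsto (fun τ => l2 (fun k => v τ k - v t k)) (𝓝[J] t) (𝓝 0) := by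
  refine tendsto_of_tendsto_of_tendsto_of_le_of_le' tendsto_const_nhds
    ((contHdot_iff.1 h).2 t ht) (.of_forall fun _ => zero_le) ?_
  filter_upwards [self_mem_nhdsWithin] with τ hτ
  exact l2_le_sobNorm hs ((h.1 τ hτ).sub (h.1 t ht)).1

theorem ContHdot.add_const {s : ℝ} {J : Set ℝ} {v : ℝ → ℤ → ℂ} (h : ContHdot s J v) {u : ℤ → ℂ}
    (hu : MemHdot s u) : ContHdot s J fun t => v t + u :=
  ⟨fun t ht => (h.1 t ht).add hu, fun t ht => by simpa using h.2 t ht⟩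

theorem SolvesThird.mono {s : ℝ} {n : ℕ} {v₀ : ℤ → ℂ} {I J : Set ℝ} {v : ℝ → ℤ → ℂ}
    (h : SolvesThird s n v₀ J v) (hI : I ⊆ J) : SolvesThird s n v₀ I v :=
  ⟨h.1.mono hI, h.2.1, fun t ht => h.2.2 t (hI ht)⟩

/-- Global existence, with a bound for the `L₂` norm. -/
theorem exists_global_solution {s : ℝ} (hs0 : 0 ≤ s) (hs1 : s < 1) {v₀ : ℤ → ℂ}
    (h₀ : MemHdot s v₀) :
    ∃ v : ℝ → ℤ → ℂ, (∀ n, SolvesThird s n v₀ (Ici 0) v) ∧ ∀ t, 0 ≤ t → l2 (v t) ≤ l2 v₀ := by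
  have hl := h₀.l2_ne_top hs0
  have hsob := (memHdot_iff.1 h₀).2.2
  obtain ⟨N, V, v, h⟩ := exists_galerkinLimit h₀.1 h₀.2.1 hl
  refine ⟨v, fun n => ⟨contHdot_iff.2 ⟨fun t ht => memHdot_iff.2 ⟨h.zero_mode ht, h.conj ht,
    h.sob_ne_top hl hs0 hs1 hsob ht⟩, fun t ht => ?_⟩, h.initial, fun t ht k hk =>
      h.third hl n ht hk⟩, fun t ht => h.l2_le ht⟩
  refine (h.continuous_sob hl hs0 hs1 hsob ht).congr fun τ => l2_congr fun k => ?_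
  rw [← mul_sub, enorm_weight_mul, enorm_eq_self]
  rfl

/-! ### The equation for the perturbation -/

theorem B2_comm (t : ℝ) (u v : ℤ → ℂ) (k : ℤ) : B2 t u v k = B2 t v u k := by
  let e : pairs k ≃ pairs k :=
    { toFun := fun p => ⟨(p.1.2, p.1.1), p.2.2.1, p.2.1, by have := p.2.2.2; simp only; omega⟩
      invFun := fun p => ⟨(p.1.2, p.1.1), p.2.2.1, p.2.1, by have := p.2.2.2; simp only; omega⟩
      left_inv := fun _ => rfl
      right_inv := fun _ => rfl }
  unfold B2
  rw [← e.tsum_eq]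
  refine tsum_congr fun p => ?_
  change osc (3 * k * p.1.2 * p.1.1) t * u p.1.2 * v p.1.1 / ((p.1.2 : ℂ) * (p.1.1 : ℂ)) = _
  rw [mul_right_comm (3 * k) p.1.2 p.1.1, mul_comm (p.1.2 : ℂ), mul_right_comm]

theorem B2_add_left {k : ℤ} (hk : k ≠ 0) (t : ℝ) {u u' v : ℤ → ℂ} (hu : l2 u ≠ ⊤)
    (hu' : l2 u' ≠ ⊤) (hv : l2 v ≠ ⊤) : B2 t (u + u') v k = B2 t u v k + B2 t u' v k := by
  have h1 : l2 (withUnit (0 : ℤ → ℂ)) ≠ ⊤ := by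
    refine l2_withUnit_ne_top ?_
    rw [l2_zero_iff.2 rfl]; exact ENNReal.zero_ne_top
  have hC : 2 * l2 recip ≠ ⊤ := by have := l2_recip_ne_top; finiteness
  simp only [← quadForm_coB2 hk t _ _ (withUnit_zero 0) (withUnit_zero 0), quadForm]
  rw [← ((coB2_bound t).summable hC hu hv h1 h1 k).tsum_add
    ((coB2_bound t).summable hC hu' hv h1 h1 k)]
  refine tsum_congr fun q => ?_
  simp only [Pi.add_apply]
  ring

theorem B2_add_right {k : ℤ} (hk : k ≠ 0) (t : ℝ) {u v v' : ℤ → ℂ} (hu : l2 u ≠ ⊤)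
    (hv : l2 v ≠ ⊤) (hv' : l2 v' ≠ ⊤) : B2 t u (v + v') k = B2 t u v k + B2 t u v' k := by
  rw [B2_comm, B2_add_left hk t hv hv' hu, B2_comm t v, B2_comm t v']

theorem B2_add_self {k : ℤ} (hk : k ≠ 0) (t : ℝ) {u v : ℤ → ℂ} (hu : l2 u ≠ ⊤)
    (hv : l2 v ≠ ⊤) :
    B2 t (u + v) (u + v) k = B2 t u u k + 2 * B2 t v u k + B2 t v v k := by
  have h : l2 (u + v) ≠ ⊤ := ne_top_of_le_ne_top (by finiteness) (l2_add_le u v)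
  rw [B2_add_left hk t hu hv h, B2_add_right hk t hu hu hv, B2_add_right hk t hv hu hv,
    B2_comm t u v]
  ring

/-- By symmetry and bilinearity, (1/6) B₂(y + v⁰, y + v⁰) contains the cross term (1/3) B₂(v⁰, y),
which is exactly what is moved to the left; otherwise the two equations coincide. -/
theorem solvesPerturbation_iff {s : ℝ} (hs : 0 ≤ s) {n : ℕ} {v₀ : ℤ → ℂ} (h₀ : MemHdot s v₀)
    {J : Set ℝ} {y : ℝ → ℤ → ℂ} :
    SolvesPerturbation s n v₀ J y ↔ SolvesThird s n v₀ J fun t => y t + v₀ := by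
  have hc : ContHdot s J y ↔ ContHdot s J fun t => y t + v₀ :=
    ⟨fun h => h.add_const h₀, fun h => by simpa using h.add_const h₀.neg⟩
  unfold SolvesPerturbation SolvesThird
  rw [← hc]
  refine and_congr_right fun hy => ?_
  simp only [add_eq_right]
  refine and_congr_right fun hy0 => forall₂_congr fun t ht =>
    forall₂_congr fun k hk => and_congr_right fun _ => ?_
  have h1 := B2_add_self hk t ((hy.1 t ht).l2_ne_top hs) (h₀.l2_ne_top hs)
  simp only [lhs, h1, hy0, zero_add, Pi.add_apply, Pi.zero_apply]
  constructor <;> intro h <;> linear_combination h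

/-! ### Absolutely convergent trigonometric series -/

/-- The sum of the trigonometric series with coefficients `g`. -/
noncomputable def trigSum (g : ℤ → ℂ) (x : ℝ) : ℂ := ∑' k, g k * osc k x

theorem norm_mul_osc (z : ℂ) (k : ℤ) (x : ℝ) : ‖z * osc k x‖ = ‖z‖ := by
  rw [norm_mul, norm_osc, mul_one]

theorem summable_trig {g : ℤ → ℂ} (hg : Summable fun k => ‖g k‖) (x : ℝ) :
    Summable fun k => g k * osc k x := .of_norm (by simpa only [norm_mul_osc] using hg)

theorem hasDerivAt_trigSum {g : ℤ → ℂ} (hg : Summable fun k => ‖g k‖)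
    (hg' : Summable fun k : ℤ => ‖(k : ℂ) * g k‖) (x : ℝ) :
    HasDerivAt (trigSum g) (Complex.I * trigSum (fun k => k * g k) x) x := by
  have h1 : Complex.I * trigSum (fun k => k * g k) x =
      ∑' k : ℤ, g k * (Complex.I * k * osc k x) := by
    rw [trigSum, ← tsum_mul_left]
    exact tsum_congr fun k => by ring
  rw [h1]
  refine hasDerivAt_tsum (g := fun (k : ℤ) x => g k * osc k x) hg'
    (fun k y => (hasDerivAt_osc k y).const_mul (g k)) (fun k y => le_of_eq ?_)
    (summable_trig hg 0) x
  rw [show g k * (Complex.I * k * osc k y) = (k * g k) * osc k y * Complex.I by ring, norm_mul,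
    Complex.norm_I, mul_one, norm_mul_osc]

theorem continuous_trigSum {g : ℤ → ℂ} (hg : Summable fun k => ‖g k‖) : Continuous (trigSum g) :=
  continuous_tsum (fun k => continuous_const.mul (continuous_osc k)) hg
    fun k x => (norm_mul_osc _ k x).le

theorem osc_two_pi (k : ℤ) : osc k (2 * Real.pi) = 1 := by
  rw [osc, ← Complex.exp_int_mul_two_pi_mul_I k]
  congr 1; push_cast; ring

theorem osc_zero_right (k : ℤ) : osc k 0 = 1 := by simp [osc]

theorem trigSum_two_pi (g : ℤ → ℂ) : trigSum g (2 * Real.pi) = trigSum g 0 := by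
  simp only [trigSum, osc_two_pi, osc_zero_right]

theorem integral_osc (k : ℤ) :
    ∫ x in (0 : ℝ)..2 * Real.pi, osc k x = if k = 0 then 2 * (Real.pi : ℂ) else 0 := by
  split_ifs with hk
  · simp [hk, osc_zero_left]
  · have hk' : Complex.I * (k : ℂ) ≠ 0 := by simp [hk]
    have h1 : ∀ x : ℝ, HasDerivAt (fun x => (Complex.I * k)⁻¹ * osc k x) (osc k x) x := fun x => by
      have := (hasDerivAt_osc k x).const_mul (Complex.I * k)⁻¹
      rwa [inv_mul_cancel_left₀ hk'] at this
    rw [intervalIntegral.integral_eq_sub_of_hasDerivAt (fun x _ => h1 x)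
      ((continuous_osc k).intervalIntegrable _ _), osc_two_pi, osc_zero_right, sub_self]

theorem integral_trigSum_mul_osc {g : ℤ → ℂ} (hg : Summable fun k => ‖g k‖) (m : ℤ) :
    ∫ x in (0 : ℝ)..2 * Real.pi, trigSum g x * osc (-m) x = 2 * Real.pi * g m := by
  have h1 := intervalIntegral.hasSum_integral_of_dominated_convergence (μ := volume)
    (a := 0) (b := 2 * Real.pi) (F := fun (k : ℤ) x => g k * osc k x * osc (-m) x)
    (f := fun x => trigSum g x * osc (-m) x) (fun k _ => ‖g k‖)
    (fun k => ((continuous_const.mul (continuous_osc k)).mul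
      (continuous_osc (-m))).aestronglyMeasurable)
    (fun k => .of_forall fun x _ => by rw [norm_mul_osc, norm_mul_osc])
    (.of_forall fun _ _ => hg) (by simp)
    (.of_forall fun x _ => (summable_trig hg x).hasSum.mul_right _)
  refine h1.unique ?_
  have h2 : ∀ k : ℤ, ∫ x in (0 : ℝ)..2 * Real.pi, g k * osc k x * osc (-m) x =
      if k = m then 2 * Real.pi * g m else 0 := by
    intro k
    simp only [mul_assoc (g k), ← osc_add, intervalIntegral.integral_const_mul, integral_osc]
    by_cases hk : k = m
    · subst hk; simp [mul_comm]
    · rw [if_neg (by omega), if_neg hk, mul_zero]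
  simp only [h2]
  exact hasSum_ite_eq m _

/-- The convolution of two sequences. -/
noncomputable def conv (f g : ℤ → ℂ) (k : ℤ) : ℂ := ∑' j, f j * g (k - j)

theorem summable_conv {f g : ℤ → ℂ} (hf : Summable fun k => ‖f k‖) (hg : Summable fun k => ‖g k‖) :
    (Summable fun p : ℤ × ℤ => ‖f p.2 * g (p.1 - p.2)‖) ∧ Summable fun k => ‖conv f g k‖ := by
  let e : ℤ × ℤ ≃ ℤ × ℤ :=
    { toFun := fun p => (p.2, p.1 - p.2)
      invFun := fun p => (p.1 + p.2, p.1)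
      left_inv := fun p => by simp
      right_inv := fun p => by simp }
  have h1 : Summable fun p : ℤ × ℤ => ‖f p.2 * g (p.1 - p.2)‖ :=
    (e.summable_iff (f := fun p : ℤ × ℤ => ‖f p.1 * g p.2‖)).2 (hf.mul_norm hg)
  refine ⟨h1, .of_nonneg_of_le (fun _ => norm_nonneg _) (fun k => ?_) h1.prod⟩
  exact norm_tsum_le_tsum_norm (h1.prod_factor k)

theorem trigSum_mul {f g : ℤ → ℂ} (hf : Summable fun k => ‖f k‖) (hg : Summable fun k => ‖g k‖)
    (x : ℝ) : trigSum f x * trigSum g x = trigSum (conv f g) x := by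
  let e : ℤ × ℤ ≃ ℤ × ℤ :=
    { toFun := fun p => (p.2, p.1 - p.2)
      invFun := fun p => (p.1 + p.2, p.1)
      left_inv := fun p => by simp
      right_inv := fun p => by simp }
  have h1 : ∀ p : ℤ × ℤ, f p.2 * osc p.2 x * (g (p.1 - p.2) * osc (p.1 - p.2) x) =
      f p.2 * g (p.1 - p.2) * osc p.1 x := fun p => by
    have : osc p.1 x = osc p.2 x * osc (p.1 - p.2) x := by rw [← osc_add]; congr 1; ring
    rw [this]; ring
  have h2 : Summable fun p : ℤ × ℤ => f p.2 * g (p.1 - p.2) * osc p.1 x :=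
    .of_norm (by simpa only [norm_mul_osc] using (summable_conv hf hg).1)
  unfold trigSum
  rw [tsum_mul_tsum_of_summable_norm (by simpa only [norm_mul_osc] using hf)
    (by simpa only [norm_mul_osc] using hg)]
  refine (e.tsum_eq _).symm.trans ((tsum_congr h1).trans (h2.tsum_prod.trans ?_))
  refine tsum_congr fun k => ?_
  rw [conv, ← tsum_mul_right]

theorem conj_osc (k : ℤ) (x : ℝ) : (starRingEnd ℂ) (osc k x) = osc (-k) x := by
  rw [osc, osc, ← Complex.exp_conj]
  congr 1
  simp

theorem conj_trigSum {g : ℤ → ℂ} (hg : ∀ k, g (-k) = (starRingEnd ℂ) (g k)) (x : ℝ) :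
    (starRingEnd ℂ) (trigSum g x) = trigSum g x := by
  rw [trigSum, Complex.conj_tsum, ← (Equiv.neg ℤ).tsum_eq]
  refine tsum_congr fun k => ?_
  simp [conj_osc, hg]

/-- A real-valued exponent makes the integrand positive. -/
theorem integral_exp_ne_zero {f : ℝ → ℂ} (hf : Continuous f)
    (hr : ∀ x, (starRingEnd ℂ) (f x) = f x) :
    ∫ x in (0 : ℝ)..2 * Real.pi, Complex.exp (f x) ≠ 0 := by
  have h1 : ∀ x, Complex.exp (f x) = ((Real.exp (f x).re : ℝ) : ℂ) := fun x => by
    rw [Complex.ofReal_exp, Complex.conj_eq_iff_re.1 (hr x)]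
  simp only [h1, intervalIntegral.integral_ofReal]
  have hc : Continuous fun x => Real.exp (f x).re :=
    Real.continuous_exp.comp (Complex.continuous_re.comp hf)
  exact_mod_cast (intervalIntegral.intervalIntegral_pos_of_pos (hc.intervalIntegrable _ _)
    (fun x => Real.exp_pos _) Real.two_pi_pos).ne'

/-! ### Injectivity of the linearised operator -/

/-- The coefficients of the primitive, up to the factor `i`. -/
noncomputable def divMode (u : ℤ → ℂ) (k : ℤ) : ℂ := u k / k

/-- Cauchy–Schwarz against 1/k: primitives of L₂ functions have absolutely convergent Fourier
series. -/
theorem summable_divMode {u : ℤ → ℂ} (hu : l2 u ≠ ⊤) : Summable fun k => ‖divMode u k‖ := by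
  have h1 : (∑' k, ‖u k‖ₑ * recip k) ≠ ⊤ := by
    have h2 := tsum_mul_sq_le (fun k => ‖u k‖ₑ) recip
    have h3 : (∑' k, recip k ^ 2) = l2 recip ^ 2 := by rw [l2_sq]; rfl
    rw [← l2_sq, h3] at h2
    have := l2_recip_ne_top
    have h4 : (∑' k, ‖u k‖ₑ * recip k) ^ 2 ≠ ⊤ := ne_top_of_le_ne_top (by finiteness) h2
    intro h5
    rw [h5] at h4
    exact h4 rfl
  have h2 : (∑' k, ((‖divMode u k‖₊ : ℝ≥0) : ℝ≥0∞)) ≠ ⊤ := by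
    refine ne_of_eq_of_ne (tsum_congr fun k => ?_) h1
    rw [recip, ← enorm_mul, divMode, div_eq_mul_inv]; rfl
  simpa using ENNReal.tsum_coe_ne_top_iff_summable_coe.1 h2

/-- The operator `I - (1/3) B₂(u, ·)` at time `0` is injective for real-valued `u`. -/
theorem eq_zero_of_eq_conv {u d : ℤ → ℂ}
    (hur : ∀ k, u (-k) = (starRingEnd ℂ) (u k)) (hu : l2 u ≠ ⊤) (hd0 : d 0 = 0) (hd : l2 d ≠ ⊤)
    (hd1 : Summable fun k => ‖d k‖)
    (heq : ∀ k, k ≠ 0 → d k = 1 / 3 * conv (divMode u) (divMode d) k) : d = 0 := by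
  set a := divMode u with ha
  set W := divMode d with hW
  -- The exponent of the integrating factor, with derivative -(i/3)a. Dividing u_k twice by k
  -- preserves the reality condition, so b is real-valued although a is not.
  set b : ℤ → ℂ := fun k => -(1 / 3) * divMode a k with hb
  have has : Summable fun k => ‖a k‖ := summable_divMode hu
  have hWs : Summable fun k => ‖W k‖ := summable_divMode hd
  have hkb : ∀ k : ℤ, (k : ℂ) * b k = -(1 / 3) * a k := fun k => by
    rcases eq_or_ne k 0 with rfl | hk
    · simp [ha, divMode]
    · have : (k : ℂ) ≠ 0 := by exact_mod_cast hk
      simp only [hb, divMode]; field_simp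
  have hkW : ∀ k : ℤ, (k : ℂ) * W k = d k := fun k => by
    rcases eq_or_ne k 0 with rfl | hk
    · simp [hd0]
    · have : (k : ℂ) ≠ 0 := by exact_mod_cast hk
      simp only [hW, divMode]; field_simp
  have hbs : Summable fun k => ‖b k‖ := by
    refine .of_nonneg_of_le (fun _ => norm_nonneg _) (fun k => ?_) has
    simp only [hb, divMode, norm_mul, norm_neg, norm_div, norm_one, Complex.norm_ofNat]
    have h1 : ‖a k‖ / ‖(k : ℂ)‖ ≤ ‖a k‖ := by
      rcases eq_or_ne k 0 with rfl | hk
      · simp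
      · refine div_le_self (norm_nonneg _) ?_
        rw [Complex.norm_intCast]
        exact_mod_cast Int.one_le_abs hk
    have h2 := norm_nonneg (a k)
    have h3 : 0 ≤ ‖a k‖ / ‖(k : ℂ)‖ := by positivity
    linarith
  have hbr : ∀ k, b (-k) = (starRingEnd ℂ) (b k) := fun k => by
    simp [hb, ha, divMode, hur, div_neg, neg_div, map_ofNat]
  -- The equation is given only for k ≠ 0; subtracting the mean c accounts for the zero mode.
  set c : ℂ := 1 / 3 * conv a W 0 with hc
  have hsum : ∀ x, trigSum d x = 1 / 3 * (trigSum a x * trigSum W x) - c := by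
    intro x
    have h1 : ∀ k, d k * osc k x = 1 / 3 * (conv a W k * osc k x) - if k = 0 then c else 0 := by
      intro k
      by_cases hk : k = 0
      · subst hk; simp [hd0, osc_zero_left, hc]
      · rw [heq k hk, if_neg hk]; ring
    have h2 := summable_trig (summable_conv has hWs).2 x
    rw [trigSum_mul has hWs, trigSum, tsum_congr h1,
      (h2.mul_left _).tsum_sub (hasSum_ite_eq 0 c).summable, tsum_mul_left, tsum_ite_eq, trigSum]
  have hdW : ∀ x, HasDerivAt (trigSum W) (Complex.I * trigSum d x) x := fun x => by
    simpa only [hkW] using hasDerivAt_trigSum hWs (by simpa only [hkW] using hd1) x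
  have hdb : ∀ x, HasDerivAt (trigSum b) (Complex.I * (-(1 / 3) * trigSum a x)) x := fun x => by
    have h1 := hasDerivAt_trigSum hbs (by
      simpa only [hkb, norm_mul] using has.mul_left ‖(-(1 / 3) : ℂ)‖) x
    have h2 : trigSum (fun k => -(1 / 3) * a k) x = -(1 / 3) * trigSum a x := by
      rw [trigSum, trigSum, ← tsum_mul_left]
      exact tsum_congr fun k => by ring
    simpa only [hkb, h2] using h1
  -- With W' = i d the equation reads W' = i((1/3) a W - c), and the integrating factor leaves the
  -- derivative -i c e^b.
  set G : ℝ → ℂ := fun x => Complex.exp (trigSum b x) * trigSum W x with hG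
  have hdG : ∀ x, HasDerivAt G (-Complex.I * c * Complex.exp (trigSum b x)) x := fun x => by
    refine ((hdb x).cexp.mul (hdW x)).congr_deriv ?_
    rw [hsum]; ring
  have hcb := continuous_trigSum hbs
  -- Periodicity makes the integral of G' over a period vanish, while e^b has positive integral.
  have hc0 : c = 0 := by
    have h1 := intervalIntegral.integral_eq_sub_of_hasDerivAt (a := 0) (b := 2 * Real.pi)
      (fun x _ => hdG x) (Continuous.intervalIntegrable (by fun_prop) _ _)
    rw [intervalIntegral.integral_const_mul] at h1
    simp only [hG, trigSum_two_pi, sub_self] at h1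
    have h2 := integral_exp_ne_zero hcb (conj_trigSum hbr)
    simpa [h2] using h1
  have hGc : ∀ x, G x = G 0 := fun x => is_const_of_deriv_eq_zero
    (fun x => (hdG x).differentiableAt) (fun x => by rw [(hdG x).deriv, hc0]; simp) x 0
  have hWx : ∀ x, trigSum W x = G 0 * Complex.exp (-trigSum b x) := fun x => by
    rw [← hGc x, hG, Complex.exp_neg]
    field_simp
  -- Now W is a constant multiple of e^{-b}, which has positive integral, but W has mean zero.
  have hG0 : G 0 = 0 := by
    have h1 := integral_trigSum_mul_osc hWs 0
    simp only [neg_zero, osc_zero_left, mul_one, hWx, intervalIntegral.integral_const_mul] at h1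
    have h2 := integral_exp_ne_zero hcb.neg fun x => by
      simp only [Pi.neg_apply, map_neg, conj_trigSum hbr]
    have h3 : W 0 = 0 := by simp [hW, divMode]
    rw [h3, mul_zero] at h1
    exact (mul_eq_zero.1 h1).resolve_right h2
  ext k
  have h1 := integral_trigSum_mul_osc hWs k
  simp only [hWx, hG0, zero_mul, intervalIntegral.integral_zero] at h1
  have h2 : W k = 0 := by simpa [Real.pi_ne_zero] using h1.symm
  rw [← hkW, h2, mul_zero]; rfl

/-! ### A lower bound for `I - (1/3) B₂(u, ·)` -/

/-- `B₂(u, v)`, with value `0` in the mode `k = 0`. -/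
noncomputable def bilB2 (t : ℝ) (u v : ℤ → ℂ) : ℤ → ℂ :=
  quadForm (coB2 t) u v (withUnit 0) (withUnit 0)

theorem bilB2_of_ne (t : ℝ) (u v : ℤ → ℂ) {k : ℤ} (hk : k ≠ 0) : bilB2 t u v k = B2 t u v k :=
  quadForm_coB2 hk t u v (withUnit_zero 0) (withUnit_zero 0)

theorem bilB2_zero (t : ℝ) (u v : ℤ → ℂ) : bilB2 t u v 0 = 0 := by
  refine (tsum_congr fun q => ?_).trans tsum_zero
  rw [coB2_zero_sum _ _ _ _ _ (by ring), zero_mul]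

theorem l2_withUnit_zero_le : l2 (withUnit (0 : ℤ → ℂ)) ≤ 1 := by
  have h := l2_withUnit_le (0 : ℤ → ℂ)
  rwa [l2_zero_iff.2 rfl, zero_add] at h

theorem l2_bilB2_le (t : ℝ) (u v : ℤ → ℂ) :
    l2 (bilB2 t u v) ≤ 2 * l2 recip * (l2 u * l2 v) := by
  have h := l2_withUnit_zero_le
  refine ((coB2_bound t).l2_quadForm_le _ _ _ _).trans ?_
  calc _ ≤ 2 * l2 recip * (l2 u * l2 v * 1 * 1) := by gcongr
    _ = _ := by ring

theorem l2_weight_bilB2_le (t : ℝ) (u v : ℤ → ℂ) :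
    l2 (fun k => ‖(k : ℂ)‖ₑ * ‖bilB2 t u v k‖ₑ) ≤ 2 * l2 recip * (l2 u * l2 v) := by
  have h := l2_withUnit_zero_le
  refine ((coB2_smoothing t).l2_weight_quadForm_le (ω := fun k => ‖(k : ℂ)‖ₑ) _ _ _ _).trans ?_
  calc _ ≤ 2 * l2 recip * (l2 u * l2 v * 1 * 1) := by gcongr
    _ = _ := by ring

theorem bilB2_const_mul (t : ℝ) (u v : ℤ → ℂ) (c : ℂ) (k : ℤ) :
    bilB2 t u (fun k => c * v k) k = c * bilB2 t u v k := by
  simp only [bilB2, quadForm]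
  rw [← tsum_mul_left]
  exact tsum_congr fun q => by ring

/-- The coefficients of the free evolution. -/
noncomputable def gauge (t : ℝ) (u : ℤ → ℂ) (k : ℤ) : ℂ := osc (-k ^ 3) t * u k

theorem l2_gauge (t : ℝ) (u : ℤ → ℂ) : l2 (gauge t u) = l2 u :=
  l2_congr fun k => by rw [gauge, enorm_mul, enorm_osc, one_mul]

theorem osc_mul_gauge (t : ℝ) (u : ℤ → ℂ) (k : ℤ) : osc (k ^ 3) t * gauge t u k = u k := by
  rw [gauge, ← mul_assoc, ← osc_add, add_neg_cancel, osc_zero_left, one_mul]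

/-- Since (x + y)³ - x³ - y³ = 3(x + y)xy, the time dependence of B₂ is pure conjugation by the free
evolution. -/
theorem bilB2_gauge (t : ℝ) (u v : ℤ → ℂ) (k : ℤ) :
    bilB2 t u v k = osc (k ^ 3) t * bilB2 0 (gauge t u) (gauge t v) k := by
  simp only [bilB2, quadForm]
  rw [← tsum_mul_left]
  refine tsum_congr fun ⟨x, y, z⟩ => ?_
  simp only [coB2]
  split_ifs with h
  · obtain ⟨rfl, h1, -⟩ := h
    obtain rfl : k = x + y := by omega
    rw [osc_zero_right, ← osc_mul_gauge t u x, ← osc_mul_gauge t v y]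
    have : osc ((x + y) ^ 3) t = osc (3 * (x + y) * x * y) t * (osc (x ^ 3) t * osc (y ^ 3) t) := by
      rw [← osc_add, ← osc_add]; congr 1; ring
    rw [this]
    ring
  · simp

theorem bilB2_eq_conv (u v : ℤ → ℂ) {k : ℤ} (hk : k ≠ 0) :
    bilB2 0 u v k = conv (divMode u) (divMode v) k := by
  have hinj : Function.Injective fun j : ℤ => ((j, k - j, 0) : ℤ × ℤ × ℤ) := fun a b h => by
    simpa using congrArg Prod.fst h
  rw [bilB2, quadForm, conv, ← hinj.tsum_eq]
  · refine tsum_congr fun j => ?_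
    simp [coB2, hk, osc_zero_right, withUnit_zero, divMode]
    ring
  · rintro ⟨x, y, z⟩ hq
    simp only [Function.mem_support, ne_eq, mul_eq_zero, not_or, coB2, ite_eq_right_iff,
      not_forall] at hq
    obtain ⟨⟨⟨rfl, h1, -⟩, -⟩, -⟩ := hq
    exact ⟨x, by simp only [Prod.mk.injEq, true_and, and_true]; omega⟩

theorem norm_divMode (u : ℤ → ℂ) (k : ℤ) : ‖divMode u k‖ = ‖u k‖ * ‖(k : ℂ)⁻¹‖ := by
  rw [divMode, div_eq_mul_inv, norm_mul]

theorem summable_norm_inv_mul_inv (k : ℤ) :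
    Summable fun j : ℤ => ‖(j : ℂ)⁻¹‖ * ‖((k - j : ℤ) : ℂ)⁻¹‖ := by
  have h1 : Summable fun j : ℤ => ‖(j : ℂ)⁻¹‖ ^ 2 := by
    refine (Real.summable_one_div_int_pow (p := 2) |>.2 (by norm_num)).congr fun j => ?_
    rw [norm_inv, Complex.norm_intCast, inv_pow, sq_abs, one_div]
  have h2 : Summable fun j : ℤ => ‖((k - j : ℤ) : ℂ)⁻¹‖ ^ 2 := (Equiv.subLeft k).summable_iff.2 h1
  refine .of_nonneg_of_le (fun j => by positivity) (fun j => ?_) (h1.add h2)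
  nlinarith [sq_nonneg (‖(j : ℂ)⁻¹‖ - ‖((k - j : ℤ) : ℂ)⁻¹‖), sq_nonneg ‖(j : ℂ)⁻¹‖,
    sq_nonneg ‖((k - j : ℤ) : ℂ)⁻¹‖]

/-- The kernel 1/(j(k - j)) is summable in j, so bounded modewise convergence of the arguments
suffices; no convergence in ℓ² is needed. -/
theorem tendsto_bilB2 {u d : ℕ → ℤ → ℂ} {u' d' : ℤ → ℂ} {A B : ℝ} (hA : ∀ i k, ‖u i k‖ ≤ A)
    (hB : ∀ i k, ‖d i k‖ ≤ B) (hu : ∀ k, Tendsto (fun i => u i k) atTop (𝓝 (u' k)))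
    (hd : ∀ k, Tendsto (fun i => d i k) atTop (𝓝 (d' k))) (k : ℤ) :
    Tendsto (fun i => bilB2 0 (u i) (d i) k) atTop (𝓝 (bilB2 0 u' d' k)) := by
  by_cases hk : k = 0
  · simp [hk, bilB2_zero]
  simp only [bilB2_eq_conv _ _ hk]
  have hA0 : 0 ≤ A := (norm_nonneg _).trans (hA 0 0)
  refine tendsto_tsum_of_dominated_convergence ((summable_norm_inv_mul_inv k).mul_left (A * B))
    (fun j => ((hu j).div_const _).mul ((hd (k - j)).div_const _)) (.of_forall fun i j => ?_)
  rw [norm_mul, norm_divMode, norm_divMode]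
  calc _ ≤ A * ‖(j : ℂ)⁻¹‖ * (B * ‖((k - j : ℤ) : ℂ)⁻¹‖) := by
        gcongr
        exacts [hA i j, hB i (k - j)]
    _ = _ := by ring

theorem recip_natCast (n : ℕ) (hn : n ≠ 0) : recip n = (n : ℝ≥0∞)⁻¹ := by
  rw [recip, enorm_inv (by exact_mod_cast hn)]
  congr 1
  rw [← ofReal_norm]
  simp

theorem tendsto_recip : Tendsto (fun n : ℕ => recip n) atTop (𝓝 0) := by
  refine ENNReal.tendsto_inv_nat_nhds_zero.congr' ?_
  filter_upwards [eventually_ne_atTop 0] with n hn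
  exact (recip_natCast n hn).symm

theorem l2_tailPart_le_recip {M : ℕ} (hM : M ≠ 0) (g : ℤ → ℂ) :
    l2 (tailPart M g) ≤ recip M * l2 (fun k => ‖(k : ℂ)‖ₑ * ‖g k‖ₑ) := by
  rw [← l2_const_mul_ennreal]
  refine l2_mono fun k => ?_
  unfold tailPart
  split_ifs with h
  · rw [enorm_eq_self, ← mul_assoc]
    refine le_mul_of_one_le_left zero_le ?_
    have h1 : ‖(1 : ℂ)‖ₑ ≤ ‖(((M : ℤ) : ℂ))⁻¹ * (k : ℂ)‖ₑ := by
      rw [enorm_le_iff_norm_le, norm_one, norm_mul, norm_inv, Complex.norm_intCast,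
        Complex.norm_intCast, ← div_eq_inv_mul, one_le_div (by simpa [Nat.pos_iff_ne_zero] using hM)]
      have : |(M : ℤ)| ≤ |k| := by rw [Nat.abs_cast]; exact h.le
      exact_mod_cast this
    simpa [recip, enorm_mul] using h1
  · simp

/-- Compactness and contradiction: take normalised d_m and bounded u_m with d_m - (1/3) B₂(u_m, d_m)
tending to 0. Along a subsequence both converge modewise, and the gained derivative makes B₂(u_m,
d_m) converge in ℓ². Hence d_m converges in ℓ² to a solution of the homogeneous equation, which
vanishes by `eq_zero_of_eq_conv`, against norm 1. -/
theorem exists_lower_bound_zero {R : ℝ≥0∞} (hR : R ≠ ⊤) : ∃ Λ : ℝ≥0∞, Λ ≠ ⊤ ∧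
    ∀ u d : ℤ → ℂ, (∀ k, u (-k) = (starRingEnd ℂ) (u k)) → l2 u ≤ R → d 0 = 0 →
      l2 d ≠ ⊤ → l2 d ≤ Λ * l2 (fun k => d k - 1 / 3 * bilB2 0 u d k) := by
  by_contra! hcon
  have hseq : ∀ m : ℕ, ∃ u d : ℤ → ℂ, (∀ k, u (-k) = (starRingEnd ℂ) (u k)) ∧
      l2 u ≤ R ∧ d 0 = 0 ∧ l2 d = 1 ∧ l2 (fun k => d k - 1 / 3 * bilB2 0 u d k) * m ≤ 1 := by
    intro m
    obtain ⟨u, d, hur, hul, hd0, hdl, hlt⟩ := hcon m (ENNReal.natCast_ne_top m)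
    have hne : l2 d ≠ 0 := (zero_le.trans_lt hlt).ne'
    set r : ℝ := (l2 d).toReal with hr
    have hr0 : 0 < r := ENNReal.toReal_pos hne hdl
    have hr1 : ‖((r : ℂ))⁻¹‖ₑ = (l2 d)⁻¹ := by
      rw [enorm_inv (by exact_mod_cast hr0.ne')]
      congr 1
      rw [← ofReal_norm, Complex.norm_real, Real.norm_of_nonneg hr0.le, hr, ENNReal.ofReal_toReal hdl]
    refine ⟨u, fun k => (r : ℂ)⁻¹ * d k, hur, hul, by simp [hd0], ?_, ?_⟩
    · rw [l2_const_mul, hr1, ENNReal.inv_mul_cancel hne hdl]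
    · have h1 : ∀ k, (r : ℂ)⁻¹ * d k - 1 / 3 * bilB2 0 u (fun k => (r : ℂ)⁻¹ * d k) k =
          (r : ℂ)⁻¹ * (d k - 1 / 3 * bilB2 0 u d k) := fun k => by
        rw [bilB2_const_mul]; ring
      simp only [h1]
      rw [l2_const_mul, hr1, mul_assoc, mul_comm _ (m : ℝ≥0∞)]
      calc _ ≤ (l2 d)⁻¹ * l2 d := by gcongr
        _ = 1 := ENNReal.inv_mul_cancel hne hdl
  choose U D hUr hUl hD0 hDl hF using hseq
  have hUb : ∀ m k, ‖U m k‖ ≤ R.toReal := fun m k => by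
    simpa using ENNReal.toReal_mono hR ((enorm_le_l2 _ k).trans (hUl m))
  have hDb : ∀ m k, ‖D m k‖ ≤ 1 := fun m k => by
    simpa using ENNReal.toReal_mono ENNReal.one_ne_top ((enorm_le_l2 _ k).trans (hDl m).le)
  obtain ⟨⟨u, d⟩, -, φ, hφ, hlim⟩ := ((isCompact_univ_pi fun _ : ℤ =>
    isCompact_closedBall (0 : ℂ) R.toReal).prod (isCompact_univ_pi fun _ : ℤ =>
    isCompact_closedBall (0 : ℂ) 1)).tendsto_subseq (x := fun m => (U m, D m))
    fun m => ⟨fun k _ => mem_closedBall_zero_iff.2 (hUb m k),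
      fun k _ => mem_closedBall_zero_iff.2 (hDb m k)⟩
  have hu := tendsto_pi_nhds.1 ((continuous_fst.tendsto _).comp hlim)
  have hd := tendsto_pi_nhds.1 ((continuous_snd.tendsto _).comp hlim)
  simp only [Function.comp_def] at hu hd
  have hul : l2 u ≤ R := l2_le_of_tendsto (.of_forall fun m => hUl (φ m)) hu
  have hdl : l2 d ≤ 1 := l2_le_of_tendsto (.of_forall fun m => (hDl (φ m)).le) hd
  set g := bilB2 0 u d with hg
  have hC : 2 * l2 recip * (R * 1) ≠ ⊤ := by have := l2_recip_ne_top; finiteness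
  have hgw : l2 (fun k => ‖(k : ℂ)‖ₑ * ‖g k‖ₑ) ≤ 2 * l2 recip * (R * 1) :=
    (l2_weight_bilB2_le 0 u d).trans (by gcongr)
  have hstrong : Tendsto (fun m => l2 (fun k => bilB2 0 (U (φ m)) (D (φ m)) k - g k)) atTop
      (𝓝 0) := by
    refine tendsto_l2_of_tails (tendsto_bilB2 (fun m => hUb (φ m)) (fun m => hDb (φ m)) hu hd)
      fun ε hε => ?_
    have h1 := ENNReal.Tendsto.mul_const (b := 2 * l2 recip * (R * 1)) tendsto_recip (Or.inr hC)
    rw [zero_mul] at h1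
    obtain ⟨M, hM, hM0⟩ := ((h1.eventually_le_const hε).and (eventually_ne_atTop 0)).exists
    refine ⟨M, (l2_tailPart_le_recip hM0 _).trans (le_trans (by gcongr) hM), .of_forall fun m =>
      (l2_tailPart_le_recip hM0 _).trans (le_trans ?_ hM)⟩
    gcongr
    exact (l2_weight_bilB2_le 0 _ _).trans (by gcongr; exacts [hUl _, (hDl _).le])
  have hres : Tendsto (fun m => l2 (fun k => D (φ m) k - 1 / 3 * bilB2 0 (U (φ m)) (D (φ m)) k))
      atTop (𝓝 0) := by
    refine tendsto_of_tendsto_of_tendsto_of_le_of_le tendsto_const_nhds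
      (ENNReal.tendsto_inv_nat_nhds_zero.comp hφ.tendsto_atTop) (fun _ => zero_le) fun m => ?_
    exact ENNReal.le_inv_iff_mul_le.2 (hF (φ m))
  have hconv : Tendsto (fun m => l2 (fun k => D (φ m) k - 1 / 3 * g k)) atTop (𝓝 0) := by
    have h1 := hres.add (ENNReal.Tendsto.const_mul (a := ‖(1 / 3 : ℂ)‖ₑ) hstrong
      (Or.inr enorm_ne_top))
    rw [mul_zero, add_zero] at h1
    refine tendsto_of_tendsto_of_tendsto_of_le_of_le tendsto_const_nhds h1 (fun _ => zero_le)
      fun m => ?_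
    rw [← l2_const_mul]
    refine le_trans (le_of_eq (l2_congr fun k => ?_)) (l2_add_le _ _)
    congr 1; ring
  have hdg : ∀ k, d k = 1 / 3 * g k := fun k => by
    refine tendsto_nhds_unique (hd k) ?_
    rw [tendsto_iff_edist_tendsto_0]
    refine tendsto_of_tendsto_of_tendsto_of_le_of_le tendsto_const_nhds hconv (fun _ => zero_le)
      fun m => ?_
    simp only [edist_eq_enorm_sub]
    exact enorm_le_l2 (fun k => D (φ m) k - 1 / 3 * g k) k
  have hd0 : d = 0 := by
    refine eq_zero_of_eq_conv (fun k => ?_)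
      (ne_top_of_le_ne_top hR hul) (by rw [hdg, hg, bilB2_zero, mul_zero])
      (ne_top_of_le_ne_top ENNReal.one_ne_top hdl) ?_
      fun k hk => by rw [hdg, hg, bilB2_eq_conv u d hk]
    · refine tendsto_nhds_unique (hu (-k)) ?_
      simp only [hUr]
      exact (Complex.continuous_conj.tendsto _).comp (hu k)
    · have h1 : l2 (fun k : ℤ => (k : ℂ) * g k) ≠ ⊤ := by
        refine ne_top_of_le_ne_top hC (le_trans (le_of_eq (l2_congr fun k => ?_)) hgw)
        rw [enorm_mul, enorm_eq_self]
      refine ((summable_divMode h1).mul_left ‖(1 / 3 : ℂ)‖).congr fun k => ?_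
      rw [hdg, ← norm_mul, divMode]
      congr 2
      by_cases hk : k = 0
      · simp [hk, hg, bilB2_zero]
      · have : (k : ℂ) ≠ 0 := by exact_mod_cast hk
        field_simp
  have h1 : (1 : ℝ≥0∞) ≤ 0 := by
    refine ge_of_tendsto' hconv fun m => ?_
    have h2 : (fun k => D (φ m) k - 1 / 3 * g k) = D (φ m) := by
      ext k; rw [← hdg, hd0]; simp
    rw [h2, hDl]
  simp at h1

/-- The operator `I - (1/3) B₂(u, ·)` is bounded below, uniformly in time and for `u` in a ball. -/
theorem exists_lower_bound {R : ℝ≥0∞} (hR : R ≠ ⊤) : ∃ Λ : ℝ≥0∞, Λ ≠ ⊤ ∧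
    ∀ (t : ℝ) (u d : ℤ → ℂ), (∀ k, u (-k) = (starRingEnd ℂ) (u k)) → l2 u ≤ R →
      d 0 = 0 → l2 d ≠ ⊤ → l2 d ≤ Λ * l2 (fun k => d k - 1 / 3 * bilB2 t u d k) := by
  obtain ⟨Λ, hΛ, h⟩ := exists_lower_bound_zero hR
  refine ⟨Λ, hΛ, fun t u d hur hul hd0 hdl => ?_⟩
  -- Conjugation by the free evolution is isometric and preserves reality, so the constant at time 0
  -- serves for all times.
  have h1 := h (gauge t u) (gauge t d) (fun k => ?_) (by rwa [l2_gauge])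
    (by simp [gauge, hd0]) (by rwa [l2_gauge])
  · rw [l2_gauge] at h1
    refine h1.trans (le_of_eq ?_)
    congr 1
    refine l2_congr fun k => ?_
    rw [bilB2_gauge t u d, ← osc_mul_gauge t d k]
    have : osc (k ^ 3) t * gauge t d k - 1 / 3 * (osc (k ^ 3) t * bilB2 0 (gauge t u) (gauge t d) k) =
      osc (k ^ 3) t * (gauge t d k - 1 / 3 * bilB2 0 (gauge t u) (gauge t d) k) := by ring
    rw [this, enorm_mul, enorm_osc, one_mul]
  · rw [gauge, gauge, map_mul, conj_osc, hur]
    congr 2; ring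

/-! ### Uniqueness -/

theorem sq_lintegral_le {α : Type*} [MeasurableSpace α] {μ : Measure α} {f : α → ℝ≥0∞}
    (hf : AEMeasurable f μ) : (∫⁻ a, f a ∂μ) ^ 2 ≤ μ univ * ∫⁻ a, f a ^ 2 ∂μ := by
  have h := ENNReal.lintegral_mul_le_Lp_mul_Lq μ (Real.HolderConjugate.two_two) (f := 1) (g := f)
    (by fun_prop) hf
  simp only [Pi.mul_apply, Pi.one_apply, one_mul, ENNReal.one_rpow, lintegral_one] at h
  have h2 := pow_le_pow_left₀ zero_le h 2
  rw [mul_pow, ← ENNReal.rpow_natCast, ← ENNReal.rpow_natCast, ← ENNReal.rpow_natCast,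
    ← ENNReal.rpow_mul, ← ENNReal.rpow_mul] at h2
  simpa using h2

/-- A form of Minkowski's inequality for the sup bound `K`: Cauchy–Schwarz in time for each mode,
then exchange of sum and integral. -/
theorem l2_setLIntegral_le {F : ℝ → ℤ → ℝ≥0∞} {A : Set ℝ} (hA : MeasurableSet A)
    (hF : ∀ k, AEMeasurable (fun τ => F τ k) (volume.restrict A)) {K : ℝ≥0∞}
    (hK : ∀ τ ∈ A, l2 (F τ) ≤ K) : l2 (fun k => ∫⁻ τ in A, F τ k) ≤ volume A * K := by
  apply l2_le_of_sq_le
  calc ∑' k, ‖∫⁻ τ in A, F τ k‖ₑ ^ 2 ≤ ∑' k, volume A * ∫⁻ τ in A, F τ k ^ 2 := by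
        refine ENNReal.tsum_le_tsum fun k => ?_
        simpa using sq_lintegral_le (hF k)
    _ = volume A * ∫⁻ τ in A, ∑' k, F τ k ^ 2 := by
        rw [ENNReal.tsum_mul_left, lintegral_tsum fun k => (hF k).pow_const 2]
    _ ≤ volume A * ∫⁻ _ in A, K ^ 2 := by
        refine mul_le_mul_right (setLIntegral_mono' hA fun τ hτ => ?_) _
        have := pow_le_pow_left₀ zero_le (hK τ hτ) 2
        rw [l2_sq] at this
        simpa using this
    _ = (volume A * K) ^ 2 := by rw [setLIntegral_const]; ring

theorem l2_rhs_sub_le (n : ℕ) (t : ℝ) {u v : ℤ → ℂ} (hu0 : u 0 = 0) (hv0 : v 0 = 0) {A : ℝ≥0∞}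
    (hA : A ≠ ⊤) (hu : l2 u ≤ A) (hv : l2 v ≤ A) :
    l2 (fun k => if k = 0 then 0 else ‖rhs n t u k - rhs n t v k‖ₑ) ≤
      4 * rhsConst n * (A + 1) ^ 3 * l2 (fun k => u k - v k) := by
  have hu' := ne_top_of_le_ne_top hA hu
  have hv' := ne_top_of_le_ne_top hA hv
  have h := (coRhs_bound one_multiplier n t).l2_quadForm_sub_le (rhsConst_ne_top n)
    (u := withUnit u) (v := withUnit v) (M := A + 1) (by finiteness)
    ((l2_withUnit_le u).trans (by gcongr)) ((l2_withUnit_le v).trans (by gcongr))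
  simp only [withUnit_sub hu0 hv0] at h
  refine (l2_mono fun k => ?_).trans h
  split_ifs with hk
  · simp
  · rw [quadForm_coRhs hk n t hu', quadForm_coRhs hk n t hv', enorm_eq_self]

theorem l2_B30_sub_le {n : ℕ} (hn : n ≠ 0) (t : ℝ) {u v : ℤ → ℂ} (hu0 : u 0 = 0) (hv0 : v 0 = 0)
    {A : ℝ≥0∞} (hA : A ≠ ⊤) (hu : l2 u ≤ A) (hv : l2 v ≤ A) :
    l2 (fun k => if k = 0 then 0 else ‖B30 n t u u u k - B30 n t v v v k‖ₑ) ≤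
      4 * (2 * recip n * (l2 recip * l2 recip)) * (A + 1) ^ 3 * l2 (fun k => u k - v k) := by
  have hH := l2_recip_ne_top
  have hr : recip n ≠ ⊤ := ne_top_of_le_ne_top ENNReal.one_ne_top (recip_le_one n)
  have h := (coB30_bound one_multiplier hn t).l2_quadForm_sub_le (by finiteness)
    (u := withUnit u) (v := withUnit v) (M := A + 1) (by finiteness)
    ((l2_withUnit_le u).trans (by gcongr)) ((l2_withUnit_le v).trans (by gcongr))
  simp only [withUnit_sub hu0 hv0] at h
  refine (l2_mono fun k => ?_).trans h
  split_ifs with hk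
  · simp
  · rw [quadForm_coB30 hk n t, quadForm_coB30 hk n t, enorm_eq_self]

/-- The identities for w and v are subtracted between t₀ and t, and B₂ is expanded about the frozen
state v(t₀). This isolates the operator with the lower bound. The four terms on the right are the
quadratic one, the one with the increment of v, B₃₀ with its factor 1/n, and the time integral;
numerical coefficients of modulus at most 1 are dropped. -/
theorem SolvesThird.l2_sub_le {s : ℝ} (hs : 0 ≤ s) {n : ℕ} (hn : n ≠ 0) {v₀ : ℤ → ℂ} {T : ℝ}
    {v w : ℝ → ℤ → ℂ} (hv : SolvesThird s n v₀ (Icc 0 T) v) (hw : SolvesThird s n v₀ (Icc 0 T) w)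
    {t₀ t : ℝ} (ht₀ : 0 ≤ t₀) (htt : t₀ ≤ t) (htT : t ≤ T) (heq : w t₀ = v t₀) {A M : ℝ≥0∞}
    (hA : A ≠ ⊤) (hvA : ∀ τ ∈ Icc t₀ t, l2 (v τ) ≤ A) (hwA : ∀ τ ∈ Icc t₀ t, l2 (w τ) ≤ A)
    (hM : ∀ τ ∈ Icc t₀ t, l2 (fun k => w τ k - v τ k) ≤ M) :
    l2 (fun k => (w t - v t) k - 1 / 3 * bilB2 t (v t₀) (w t - v t) k) ≤
      (2 * l2 recip * (l2 (w t - v t) * l2 (w t - v t)) +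
      2 * l2 recip * (l2 (fun k => v t k - v t₀ k) * l2 (w t - v t))) +
      (4 * (2 * recip n * (l2 recip * l2 recip)) * (A + 1) ^ 3 * l2 (w t - v t) +
      ENNReal.ofReal (t - t₀) * (4 * rhsConst n * (A + 1) ^ 3 * M)) := by
  have hmem : ∀ τ ∈ Icc t₀ t, τ ∈ Icc 0 T := fun τ hτ => ⟨ht₀.trans hτ.1, hτ.2.trans htT⟩
  have hm₀ := hmem t₀ ⟨le_rfl, htt⟩
  have hm := hmem t ⟨htt, le_rfl⟩
  have hv0 : ∀ τ ∈ Icc t₀ t, v τ 0 = 0 := fun τ hτ => (hv.1.1 τ (hmem τ hτ)).1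
  have hw0 : ∀ τ ∈ Icc t₀ t, w τ 0 = 0 := fun τ hτ => (hw.1.1 τ (hmem τ hτ)).1
  have hvl := (hv.1.1 t hm).l2_ne_top hs
  have hwl := (hw.1.1 t hm).l2_ne_top hs
  have hvl₀ := (hv.1.1 t₀ hm₀).l2_ne_top hs
  set d : ℤ → ℂ := w t - v t with hd
  have hd0 : d 0 = 0 := by simp [hd, hv0 t ⟨htt, le_rfl⟩, hw0 t ⟨htt, le_rfl⟩]
  have hdl : l2 d ≠ ⊤ := l2_sub_ne_top hwl hvl
  set F : ℝ → ℤ → ℝ≥0∞ := fun τ k =>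
    if k = 0 then 0 else ‖rhs n τ (w τ) k - rhs n τ (v τ) k‖ₑ with hF
  set E : ℤ → ℝ≥0∞ := fun k =>
    if k = 0 then 0 else ‖B30 n t (w t) (w t) (w t) k - B30 n t (v t) (v t) (v t) k‖ₑ with hE
  have hint : ∀ {u : ℝ → ℤ → ℂ}, SolvesThird s n v₀ (Icc 0 T) u → ∀ k, k ≠ 0 →
      IntervalIntegrable (fun τ => rhs n τ (u τ) k) volume t₀ t := fun hu k hk =>
    (hu.2.2 t₀ hm₀ k hk).1.symm.trans (hu.2.2 t hm k hk).1
  have hstep : ∀ {u : ℝ → ℤ → ℂ}, SolvesThird s n v₀ (Icc 0 T) u → ∀ k, k ≠ 0 →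
      lhs n t (u t) k - lhs n t₀ (u t₀) k =
        -(Complex.I / 6) * ∫ τ in t₀..t, rhs n τ (u τ) k := fun {u} hu k hk => by
    have h1 := intervalIntegral.integral_add_adjacent_intervals (hu.2.2 t₀ hm₀ k hk).1
      (hint hu k hk)
    have h2 := (hu.2.2 t₀ hm₀ k hk).2
    have h3 := (hu.2.2 t hm k hk).2
    rw [← h1] at h3
    linear_combination h3 - h2
  have hFm : ∀ k, AEMeasurable (fun τ => F τ k) (volume.restrict (Ioc t₀ t)) := by
    intro k
    by_cases hk : k = 0
    · simp [hF, hk]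
    · simp only [hF, if_neg hk]
      have h1 := ((hint hw k hk).sub (hint hv k hk)).1.aestronglyMeasurable
      exact h1.enorm
  have hFK : l2 (fun k => ∫⁻ τ in Ioc t₀ t, F τ k) ≤
      ENNReal.ofReal (t - t₀) * (4 * rhsConst n * (A + 1) ^ 3 * M) := by
    rw [← Real.volume_Ioc]
    refine l2_setLIntegral_le measurableSet_Ioc hFm fun τ hτ => ?_
    have hτ' : τ ∈ Icc t₀ t := ⟨hτ.1.le, hτ.2⟩
    refine (l2_rhs_sub_le n τ (hw0 τ hτ') (hv0 τ hτ') hA (hwA τ hτ') (hvA τ hτ')).trans ?_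
    gcongr
    exact hM τ hτ'
  have hEK := l2_B30_sub_le hn t (hw0 t ⟨htt, le_rfl⟩) (hv0 t ⟨htt, le_rfl⟩) hA
    (hwA t ⟨htt, le_rfl⟩) (hvA t ⟨htt, le_rfl⟩)
  refine le_trans (l2_mono (v := fun k => (‖bilB2 t d d k‖ₑ +
    ‖bilB2 t (fun k => v t k - v t₀ k) d k‖ₑ) + (E k + ∫⁻ τ in Ioc t₀ t, F τ k)) fun k => ?_)
    ((l2_add_le_ennreal _ _).trans (add_le_add
      ((l2_add_le_ennreal _ _).trans (add_le_add ?_ ?_))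
      ((l2_add_le_ennreal _ _).trans (add_le_add hEK hFK))))
  rotate_left
  · rw [l2_enorm]; exact l2_bilB2_le t d d
  · rw [l2_enorm]; exact l2_bilB2_le t _ d
  rw [enorm_eq_self]
  by_cases hk : k = 0
  · subst hk
    simp [hd0, bilB2_zero]
  have e1 : w t = d + v t := by simp [hd]
  have e2 : v t = (fun k => v t k - v t₀ k) + v t₀ := by ext k; simp
  have h1 : B2 t (w t) (w t) k = B2 t d d k + 2 * B2 t (v t) d k + B2 t (v t) (v t) k := by
    conv_lhs => rw [e1]
    exact B2_add_self hk t hdl hvl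
  have h2 : B2 t (v t) d k = B2 t (fun k => v t k - v t₀ k) d k + B2 t (v t₀) d k := by
    conv_lhs => rw [e2]
    exact B2_add_left hk t (l2_sub_ne_top hvl hvl₀) hvl₀ hdl
  have h3 := hstep hw k hk
  have h4 := hstep hv k hk
  have h5 := intervalIntegral.integral_sub (hint hw k hk) (hint hv k hk)
  have key : d k - 1 / 3 * bilB2 t (v t₀) d k =
      (1 / 6 * bilB2 t d d k + 1 / 3 * bilB2 t (fun k => v t k - v t₀ k) d k) +
      (-1 / 18 * (B30 n t (w t) (w t) (w t) k - B30 n t (v t) (v t) (v t) k) +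
      (-Complex.I / 6) * ∫ τ in t₀..t, (rhs n τ (w τ) k - rhs n τ (v τ) k)) := by
    simp only [bilB2_of_ne t _ _ hk]
    rw [h5]
    simp only [lhs, heq] at h3 h4
    simp only [hd, Pi.sub_apply] at h1 h2 ⊢
    linear_combination h3 - h4 + 1 / 6 * h1 + 1 / 3 * h2
  have small : ∀ c z : ℂ, ‖c‖ ≤ 1 → ‖c * z‖ₑ ≤ ‖z‖ₑ := fun c z hc => by
    rw [enorm_le_iff_norm_le, norm_mul]
    exact mul_le_of_le_one_left (norm_nonneg _) hc
  rw [key]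
  refine (enorm_add_le _ _).trans (add_le_add ((enorm_add_le _ _).trans (add_le_add
    (small _ _ (by norm_num)) (small _ _ (by norm_num)))) ((enorm_add_le _ _).trans (add_le_add
    ?_ ?_)))
  · simp only [hE, if_neg hk]
    exact small _ _ (by norm_num)
  · refine (small _ _ (by norm_num)).trans ?_
    rw [intervalIntegral.integral_of_le htt]
    refine (enorm_integral_le_lintegral_enorm _).trans (le_of_eq ?_)
    simp only [hF, if_neg hk]

/-- For large `n`, depending only on the radius `R`, the third form has no second solution with the
same initial value as a solution in the ball of radius `R` of `L₂`. -/
theorem exists_uniqueness_threshold {R : ℝ≥0∞} (hR : R ≠ ⊤) : ∃ n₀ : ℕ, ∀ n, n₀ ≤ n →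
    ∀ {s : ℝ}, 0 ≤ s → ∀ {v₀ : ℤ → ℂ} {T : ℝ} {v w : ℝ → ℤ → ℂ},
      SolvesThird s n v₀ (Icc 0 T) v → SolvesThird s n v₀ (Icc 0 T) w →
      (∀ t ∈ Icc 0 T, l2 (v t) ≤ R) → EqOn w v (Icc 0 T) := by
  obtain ⟨Λ, hΛ, hlow⟩ := exists_lower_bound hR
  have hH := l2_recip_ne_top
  -- The second solution has no a priori bound; continuity keeps it in the ball of radius R + 1 just
  -- after a time of agreement. The other 1 comes from the unit at the zero mode.
  set ε : ℕ → ℝ≥0∞ := fun n => 4 * (2 * recip n * (l2 recip * l2 recip)) * (R + 1 + 1) ^ 3 with hε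
  have hεlim : Tendsto (fun n => Λ * ε n) atTop (𝓝 0) := by
    have h1 := ENNReal.Tendsto.const_mul (a := Λ * (8 * (l2 recip * l2 recip) * (R + 1 + 1) ^ 3))
      tendsto_recip (Or.inr (by finiteness))
    rw [mul_zero] at h1
    refine h1.congr fun n => ?_
    simp only [hε]; ring
  obtain ⟨n₀, hn₀⟩ := ((hεlim.eventually_le_const (show (0 : ℝ≥0∞) < 4⁻¹ by simp)).and
    (eventually_ne_atTop 0)).exists_forall_of_atTop
  refine ⟨n₀, fun n hn s hs v₀ T v w hv hw hvR => ?_⟩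
  obtain ⟨hεn, hn0⟩ := hn₀ n hn
  have hK := rhsConst_ne_top n
  set C : ℝ≥0∞ := 6 * l2 recip + 4 * rhsConst n * (R + 1 + 1) ^ 3 with hC
  have hCt : C ≠ ⊤ := by finiteness
  -- η bounds the increments of both solutions and the elapsed time. In C the coefficient 6 is 2·2 +
  -- 2·1: the difference is at most 2η in the quadratic term, the increment of v at most η.
  obtain ⟨η, hη0, hη1, hηC⟩ : ∃ η : ℝ≥0∞, 0 < η ∧ η ≤ 1 ∧ Λ * (η * C) ≤ 4⁻¹ := by
    have h1 := ENNReal.Tendsto.const_mul (a := Λ * C) ENNReal.tendsto_inv_nat_nhds_zero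
      (Or.inr (by finiteness))
    rw [mul_zero] at h1
    obtain ⟨m, hm, hm1⟩ := ((h1.eventually_le_const (show (0 : ℝ≥0∞) < 4⁻¹ by simp)).and
      (eventually_ge_atTop 1)).exists
    refine ⟨(m : ℝ≥0∞)⁻¹, by simp, ENNReal.inv_le_one.2 (by exact_mod_cast hm1), ?_⟩
    rwa [mul_comm _ C, ← mul_assoc]
  have hmode : ∀ {u : ℝ → ℤ → ℂ}, SolvesThird s n v₀ (Icc 0 T) u → ∀ k,
      ContinuousOn (fun τ => u τ k) (Icc 0 T) := fun {u} hu k t ht => by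
    rw [ContinuousWithinAt, tendsto_iff_edist_tendsto_0]
    refine tendsto_of_tendsto_of_tendsto_of_le_of_le tendsto_const_nhds
      (hu.1.tendsto_l2 hs ht) (fun _ => zero_le) fun τ => ?_
    simp only [edist_eq_enorm_sub]
    exact enorm_le_l2 (fun k => u τ k - u t k) k
  rcases lt_or_ge T 0 with hT | hT
  · simp [Icc_eq_empty (not_le.2 hT)]
  -- Continuity argument: the set of agreement is closed, contains 0, and meets every right
  -- neighbourhood of each of its points before T.
  refine IsClosed.Icc_subset_of_forall_exists_gt (s := {t | w t = v t}) ?_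
    (by change w 0 = v 0; rw [hw.2.1, hv.2.1]) fun t₀ ht₀ y hy => ?_
  · have h1 : {t | w t = v t} ∩ Icc 0 T =
        ⋂ k, Icc 0 T ∩ (fun τ => w τ k - v τ k) ⁻¹' {0} := by
      ext t
      simp only [mem_inter_iff, mem_ofPred_eq, mem_iInter, mem_preimage, mem_singleton_iff,
        sub_eq_zero, funext_iff]
      exact ⟨fun h k => ⟨h.2, h.1 k⟩, fun h => ⟨fun k => (h k).2, (h 0).1⟩⟩
    rw [h1]
    exact isClosed_iInter fun k => ((hmode hw k).sub (hmode hv k)).preimage_isClosed_of_isClosed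
      isClosed_Icc isClosed_singleton
  obtain ⟨heq, ht₀0, ht₀T⟩ := ht₀
  rw [mem_ofPred_eq] at heq
  have hm₀ : t₀ ∈ Icc 0 T := ⟨ht₀0, ht₀T.le⟩
  have hev : ∀ᶠ τ in 𝓝[Icc 0 T] t₀, l2 (fun k => v τ k - v t₀ k) ≤ η ∧
      l2 (fun k => w τ k - w t₀ k) ≤ η ∧ ENNReal.ofReal (τ - t₀) ≤ η := by
    have h1 : Tendsto (fun τ => ENNReal.ofReal (τ - t₀)) (𝓝[Icc 0 T] t₀) (𝓝 0) := by
      have h2 : Continuous fun τ => ENNReal.ofReal (τ - t₀) :=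
        ENNReal.continuous_ofReal.comp (by fun_prop)
      simpa using (h2.tendsto t₀).mono_left nhdsWithin_le_nhds
    exact ((hv.1.tendsto_l2 hs hm₀).eventually_le_const hη0).and
      (((hw.1.tendsto_l2 hs hm₀).eventually_le_const hη0).and (h1.eventually_le_const hη0))
  obtain ⟨δ, hδ, hball⟩ := Metric.mem_nhdsWithin_iff.1 hev
  set t₁ := min (t₀ + δ / 2) (min y T) with ht₁
  have hlt : t₀ < t₁ := lt_min (by linarith) (lt_min hy ht₀T)
  have ht₁T : t₁ ≤ T := (min_le_right _ _).trans (min_le_right _ _)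
  have hsub : ∀ τ ∈ Icc t₀ t₁, τ ∈ Icc 0 T := fun τ hτ => ⟨ht₀0.trans hτ.1, hτ.2.trans ht₁T⟩
  have hsm : ∀ τ ∈ Icc t₀ t₁, l2 (fun k => v τ k - v t₀ k) ≤ η ∧
      l2 (fun k => w τ k - w t₀ k) ≤ η ∧ ENNReal.ofReal (τ - t₀) ≤ η := fun τ hτ => by
    refine hball ⟨?_, hsub τ hτ⟩
    rw [Metric.mem_ball, Real.dist_eq, abs_of_nonneg (by linarith [hτ.1])]
    have : τ ≤ t₀ + δ / 2 := hτ.2.trans (min_le_left _ _)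
    linarith
  have hwR : ∀ τ ∈ Icc t₀ t₁, l2 (w τ) ≤ R + 1 := fun τ hτ => by
    have h1 : w τ = fun k => w t₀ k + (w τ k - w t₀ k) := by ext k; ring
    rw [h1, heq]
    refine (l2_add_le _ _).trans (add_le_add (hvR t₀ hm₀) ?_)
    rw [← heq]
    exact ((hsm τ hτ).2.1).trans hη1
  have hvR' : ∀ τ ∈ Icc t₀ t₁, l2 (v τ) ≤ R + 1 := fun τ hτ => (hvR τ (hsub τ hτ)).trans le_self_add
  have hD2 : ∀ τ ∈ Icc t₀ t₁, l2 (w τ - v τ) ≤ 2 * η := fun τ hτ => by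
    have h1 : w τ - v τ = fun k => (w τ k - w t₀ k) - (v τ k - v t₀ k) := by
      ext k; rw [heq]; simp
    rw [h1, two_mul]
    exact (l2_sub_le _ _).trans (add_le_add (hsm τ hτ).2.1 (hsm τ hτ).1)
  set M : ℝ≥0∞ := ⨆ τ ∈ Icc t₀ t₁, l2 (w τ - v τ) with hM
  have hDM : ∀ τ ∈ Icc t₀ t₁, l2 (w τ - v τ) ≤ M := fun τ hτ =>
    le_iSup₂ (f := fun τ (_ : τ ∈ Icc t₀ t₁) => l2 (w τ - v τ)) τ hτ
  have hMt : M ≠ ⊤ := ne_top_of_le_ne_top (b := 2 * η)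
    (ENNReal.mul_ne_top (by simp) (ne_top_of_le_ne_top ENNReal.one_ne_top hη1)) (iSup₂_le hD2)
  -- One quarter comes from the choice of n, the other from that of η. As M is finite, it must be 0.
  have hhalf : M ≤ 2⁻¹ * M := by
    refine iSup₂_le fun t ht => ?_
    have htsub : ∀ τ ∈ Icc t₀ t, τ ∈ Icc t₀ t₁ := fun τ hτ => ⟨hτ.1, hτ.2.trans ht.2⟩
    have htm := hsub t ht
    have h1 := hv.l2_sub_le hs hn0 hw ht₀0 ht.1 htm.2 heq (A := R + 1) (M := M) (by finiteness)
      (fun τ hτ => hvR' τ (htsub τ hτ)) (fun τ hτ => hwR τ (htsub τ hτ))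
      (fun τ hτ => hDM τ (htsub τ hτ))
    have h2 := hlow t (v t₀) (w t - v t) (hv.1.1 t₀ hm₀).2.1 (hvR t₀ hm₀)
      (by simp [(hv.1.1 t htm).1, (hw.1.1 t htm).1])
      (l2_sub_ne_top ((hw.1.1 t htm).l2_ne_top hs) ((hv.1.1 t htm).l2_ne_top hs))
    refine h2.trans ((mul_le_mul_right h1 Λ).trans ?_)
    have g1 := hD2 t ht
    have g2 := hDM t ht
    obtain ⟨g3, -, g4⟩ := hsm t ht
    calc _ ≤ Λ * ((2 * l2 recip * ((2 * η) * M) + 2 * l2 recip * (η * M)) +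
          (ε n * M + η * (4 * rhsConst n * (R + 1 + 1) ^ 3 * M))) := by gcongr
      _ = (Λ * (η * C) + Λ * ε n) * M := by simp only [hC]; ring
      _ ≤ (4⁻¹ + 4⁻¹) * M := by gcongr
      _ = 2⁻¹ * M := by
        congr 1
        rw [← two_mul, show (4 : ℝ≥0∞) = 2 * 2 by norm_num,
          ENNReal.mul_inv (by simp) (by simp), ← mul_assoc, ENNReal.mul_inv_cancel (by simp)
          (by simp), one_mul]
  have hM0 : M = 0 := by
    by_contra h
    have h1 : M / 2 < M := ENNReal.half_lt_self h hMt
    rw [ENNReal.div_eq_inv_mul] at h1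
    exact absurd hhalf (not_le.2 h1)
  refine ⟨t₁, ?_, hlt, (min_le_right _ _).trans (min_le_left _ _)⟩
  have h1 := hDM t₁ ⟨hlt.le, le_rfl⟩
  rw [hM0, nonpos_iff_eq_zero, l2_zero_iff] at h1
  exact sub_eq_zero.1 h1

theorem l2_eq_ofReal_hnorm {s : ℝ} (hs : 0 ≤ s) {u : ℤ → ℂ} (hu : MemHdot s u) :
    l2 u = ENNReal.ofReal (hnorm 0 u) := by
  rw [hnorm_eq 0 hu.1, sobNorm_zero, ENNReal.ofReal_toReal (hu.l2_ne_top hs)]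

end KdV

theorem theoremT :
    ∃ (n₀ : ℝ → ℕ) (Tstar : ℝ → ℝ), (∀ r, 0 < Tstar r) ∧
      ∀ s : ℝ, 0 ≤ s → s ≤ 1 / 2 → ∀ v₀ : ℤ → ℂ, KdV.MemHdot s v₀ →
        ∀ n : ℕ, n₀ (KdV.hnorm 0 v₀) ≤ n →
          ∃ y : ℝ → ℤ → ℂ,
            -- unique solvability of the equation for `y` on `[0, T*]`
            (KdV.SolvesPerturbation s n v₀ (Set.Icc 0 (Tstar (KdV.hnorm 0 v₀))) y ∧
              ∀ z : ℝ → ℤ → ℂ,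
                KdV.SolvesPerturbation s n v₀ (Set.Icc 0 (Tstar (KdV.hnorm 0 v₀))) z →
                  Set.EqOn z y (Set.Icc 0 (Tstar (KdV.hnorm 0 v₀)))) ∧
            -- `v⁰ + y` is the unique solution of the third form on `[0, T*]`
            (KdV.SolvesThird s n v₀ (Set.Icc 0 (Tstar (KdV.hnorm 0 v₀))) (fun t => y t + v₀) ∧
              ∀ w : ℝ → ℤ → ℂ,
                KdV.SolvesThird s n v₀ (Set.Icc 0 (Tstar (KdV.hnorm 0 v₀))) w →
                  Set.EqOn w (fun t => y t + v₀) (Set.Icc 0 (Tstar (KdV.hnorm 0 v₀)))) ∧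
            -- extension to the maximal interval `[0, Tmax)`
            ∃ (Tmax : EReal) (v : ℝ → ℤ → ℂ),
              (Tstar (KdV.hnorm 0 v₀) : EReal) < Tmax ∧
              Set.EqOn v (fun t => y t + v₀) (Set.Icc 0 (Tstar (KdV.hnorm 0 v₀))) ∧
              KdV.SolvesThird s n v₀ {t : ℝ | 0 ≤ t ∧ (t : EReal) < Tmax} v ∧
              (∀ (T : ℝ) (w : ℝ → ℤ → ℂ), 0 < T → KdV.SolvesThird s n v₀ (Set.Ico 0 T) w →
                (T : EReal) ≤ Tmax ∧ Set.EqOn w v (Set.Ico 0 T)) ∧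
              (Tmax = ⊤ ∨
                Filter.limsup (fun t : ℝ => ((KdV.hnorm s (v t) : ℝ) : EReal))
                  (𝓝[<] Tmax.toReal) = ⊤) := by
  -- The radius is the L₂ norm of the initial value, so the threshold depends on nothing else.
  choose n₀ huniq using fun r : ℝ =>
    KdV.exists_uniqueness_threshold (ENNReal.ofReal_ne_top (r := r))
  refine ⟨n₀, fun _ => 1, fun _ => one_pos, fun s hs0 hs1 v₀ hv₀ n hn => ?_⟩
  obtain ⟨v, hv, hvl⟩ := KdV.exists_global_solution hs0 (show s < 1 by linarith) hv₀
  -- The global solution supplies the L₂ bound required of one of the two competitors, so nothing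
  -- beyond solving the equation is asked of w, and T is arbitrary.
  have hu : ∀ (T : ℝ) (w : ℝ → ℤ → ℂ), KdV.SolvesThird s n v₀ (Icc 0 T) w →
      EqOn w v (Icc 0 T) := fun T w hw =>
    huniq _ n hn hs0 ((hv n).mono Icc_subset_Ici_self) hw fun t ht =>
      (hvl t ht.1).trans (KdV.l2_eq_ofReal_hnorm hs0 hv₀).le
  have hy : (fun t => v t - v₀ + v₀) = v := by simp
  have hdom : {t : ℝ | 0 ≤ t ∧ (t : EReal) < ⊤} = Ici 0 := by
    ext t; simp [EReal.coe_lt_top]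
  refine ⟨fun t => v t - v₀, ⟨?_, fun z hz t ht => ?_⟩, ⟨?_, fun w hw => ?_⟩,
    ⊤, v, EReal.coe_lt_top _, ?_, ?_, fun T w _ hw => ⟨le_top, fun t ht => ?_⟩, Or.inl rfl⟩
  · rw [KdV.solvesPerturbation_iff hs0 hv₀, hy]
    exact (hv n).mono Icc_subset_Ici_self
  · exact eq_sub_of_add_eq (hu _ _ ((KdV.solvesPerturbation_iff hs0 hv₀).1 hz) ht)
  · rw [hy]
    exact (hv n).mono Icc_subset_Ici_self
  · rw [hy]
    exact hu _ w hw
  · rw [hy]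
    exact fun _ _ => rfl
  · rw [hdom]
    exact hv n
  · exact hu t w (hw.mono (Icc_subset_Ico_right ht.2)) ⟨ht.1, le_rfl⟩
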